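/- Let $\Omega=(0,1)^2$ and let $\mathcal T_h$ be the partition of $\Omega$ into the rectangles $T_{ij}=[x_{i-1},x_i]\times[y_{j-1},y_j]$, $1\le i\le n$, $1\le j\le m$, where $0=x_0<x_1<\dots<x_n=1$ and $0=y_0<y_1<\dots<y_m=1$ are arbitrary (nonuniform) partitions; let $h=\max_T \operatorname{diam}T$ be the mesh size. Let $a=\operatorname{diag}(a_{11},a_{22})$ be constant on each $T\in\mathcal T_h$ with $0<\lambda\le a_{11},a_{22}\le\Lambda$, let $f\in L^2(\Omega)$, and let $u\in H^3(\Omega)$ be a weak solution of $-\nabla\cdot(a\nabla u)=f$ in $\Omega$, $u=g$ on $\partial\Omega$ (in the sense of traces). Let $g_{yy}$ and $g_{xx}$ denote the weak second tangential derivatives of $g$ in $L^2$ of the vertical and of the horizontal sides of $\Omega$. Let $V_h$ be the space of $v=\{v_0,v_b\}$ with $v_0|_T$ a polynomial of degree at most $1$ for each $T\in\mathcal T_h$ and $v_b$ a single constant on each edge of $\mathcal T_h$, and $V_h^0=\{v\in V_h: v_b|_{\partial\Omega}=0\}$. Let $Q_b$ be the $L^2$ projection onto constants on each edge, $\mathbb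 Q_h$ the $L^2$ projection onto constant vectors on each $T$, and let $\nabla_d v|_T=|T|^{-1}\int_{\partial T}v_b\,\mathbf n\,ds$ be the discrete weak gradient (it depends only on $v_b$; write $\nabla_d v_b$). For a fixed $\rho>0$ let $u_h=\{u_0,u_b\}\in V_h$ satisfy $$\sum_T (a\nabla_d u_h,\nabla_d v)_T+\rho h^{-1}\sum_T\langle u_b-Q_bu_0,\,v_b-Q_bv_0\rangle_{\partial T}=(f,v_0)\qquad\forall v\in V_h^0,$$ with the boundary values $$u_b=Q_b g+\tfrac1{12}h_y\,(h_y-6\rho^{-1}a_{22}h)\,Q_b(g_{yy})\ \text{ on vertical boundary edges},$$ $$u_b=Q_b g+\tfrac1{12}h_x\,(h_x-6\rho^{-1}a_{11}h)\,Q_b(g_{xx})\ \text{ on horizontal boundary edges},$$ where $h_y$, respectively $h_x$, is the length of the edge and the coefficient is taken on the element that contains the edge. Assume that $a_{22}Q_b(u_{yy})$ has the same value from both sides of each interior vertical edge and that $a_{11}Q_b(u_{xx})$ has the same value from both sides of each interior horizontal edge (which is automatic if $a$ is constant on $\Omega$). Then $$\Big(\sum_{T\in\mathcal T_h}\|\mathbb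 Q_h\nabla u-\nabla_d u_b\|_T^2\Big)^{1/2}\le C h^2\|u\|_3,$$ where $\|u\|_3$ is the norm of $H^3(\Omega)$ and $C$ depends only on $\rho$, $\lambda$ and $\Lambda$. -/

import Mathlib

open MeasureTheory Set Filter Topology
open scoped ContDiff

namespace WG

noncomputable section

/-! ### Sobolev functions on the unit square -/

/-- The domain `Ω = (0,1)²`. -/
def Omega : Set (ℝ × ℝ) := Ioo 0 1 ×ˢ Ioo 0 1

/-- Lebesgue measure on `Ω`. -/
def muOmega : Measure (ℝ × ℝ) := volume.restrict Omega

/-- Classical partial derivative in `x`. -/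
def dx (φ : ℝ × ℝ → ℝ) (p : ℝ × ℝ) : ℝ := fderiv ℝ φ p (1, 0)

/-- Classical partial derivative in `y`. -/
def dy (φ : ℝ × ℝ → ℝ) (p : ℝ × ℝ) : ℝ := fderiv ℝ φ p (0, 1)

/-- `φ ∈ C_c^∞(Ω)`. -/
def IsTest (φ : ℝ × ℝ → ℝ) : Prop :=
  ContDiff ℝ ∞ φ ∧ HasCompactSupport φ ∧ tsupport φ ⊆ Omega

/-- `v ∈ L²(Ω)` is the weak derivative `∂_x^i ∂_y^j u` on `Ω`. -/
def IsWeakDeriv (i j : ℕ) (u v : ℝ × ℝ → ℝ) : Prop :=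
  MemLp v 2 muOmega ∧ ∀ φ, IsTest φ →
    ∫ p in Omega, u p * (dx^[i] (dy^[j] φ)) p = (-1) ^ (i + j) * ∫ p in Omega, v p * φ p

/-- `u ∈ H^k(Ω)`. -/
def MemSobolev (k : ℕ) (u : ℝ × ℝ → ℝ) : Prop :=
  MemLp u 2 muOmega ∧ ∀ i j, i + j ≤ k → ∃ v, IsWeakDeriv i j u v

open Classical in
/-- The weak derivative `∂_x^i ∂_y^j u` in `L²(Ω)`, if there is one
(it is unique up to null sets for `u ∈ L²(Ω)`), and `0` otherwise. -/
def weakDeriv (i j : ℕ) (u : ℝ × ℝ → ℝ) : ℝ × ℝ → ℝ :=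
  if h : ∃ v, IsWeakDeriv i j u v then h.choose else 0

/-- The norm `‖u‖_k` of `H^k(Ω)`. -/
def sobolevNorm (k : ℕ) (u : ℝ × ℝ → ℝ) : ℝ :=
  Real.sqrt (∑ i ∈ Finset.range (k + 1), ∑ j ∈ Finset.range (k + 1 - i),
    ∫ p in Omega, (weakDeriv i j u p) ^ 2)

/-- The functions `φ k`, smooth on the closed square, converge to `v` in `H¹(Ω)`. -/
def TendstoH1 (φ : ℕ → ℝ × ℝ → ℝ) (v : ℝ × ℝ → ℝ) : Prop :=
  (∀ k, ContDiff ℝ ∞ (φ k)) ∧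
  Tendsto (fun k => eLpNorm (φ k - v) 2 muOmega) atTop (𝓝 0) ∧
  Tendsto (fun k => eLpNorm (dx (φ k) - weakDeriv 1 0 v) 2 muOmega) atTop (𝓝 0) ∧
  Tendsto (fun k => eLpNorm (dy (φ k) - weakDeriv 0 1 v) 2 muOmega) atTop (𝓝 0)

/-- `τ ∈ L²(0,1)` is the trace of `v ∈ H¹(Ω)` on the vertical segment `{c} × (0,1)`, `0 ≤ c ≤ 1`:
the limit of the restrictions of smooth functions that converge to `v` in `H¹(Ω)`. -/
def IsTraceV (v : ℝ × ℝ → ℝ) (c : ℝ) (τ : ℝ → ℝ) : Prop :=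
  MemLp τ 2 (volume.restrict (Ioo (0 : ℝ) 1)) ∧ ∃ φ, TendstoH1 φ v ∧
    Tendsto (fun k => eLpNorm (fun y => φ k (c, y) - τ y) 2 (volume.restrict (Ioo (0 : ℝ) 1)))
      atTop (𝓝 0)

/-- `τ ∈ L²(0,1)` is the trace of `v ∈ H¹(Ω)` on the horizontal segment `(0,1) × {c}`,
`0 ≤ c ≤ 1`. -/
def IsTraceH (v : ℝ × ℝ → ℝ) (c : ℝ) (τ : ℝ → ℝ) : Prop :=
  MemLp τ 2 (volume.restrict (Ioo (0 : ℝ) 1)) ∧ ∃ φ, TendstoH1 φ v ∧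
    Tendsto (fun k => eLpNorm (fun x => φ k (x, c) - τ x) 2 (volume.restrict (Ioo (0 : ℝ) 1)))
      atTop (𝓝 0)

/-- `u = g` on `∂Ω` in the sense of traces. -/
def HasBoundaryValue (u g : ℝ × ℝ → ℝ) : Prop :=
  IsTraceV u 0 (fun y => g (0, y)) ∧ IsTraceV u 1 (fun y => g (1, y)) ∧
  IsTraceH u 0 (fun x => g (x, 0)) ∧ IsTraceH u 1 (fun x => g (x, 1))

/-- `G ∈ L²(0,1)` is the weak second derivative of `g` on the interval `(0,1)`. -/
def IsWeakSecondDeriv (g G : ℝ → ℝ) : Prop :=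
  MemLp G 2 (volume.restrict (Ioo (0 : ℝ) 1)) ∧
  ∀ φ : ℝ → ℝ, ContDiff ℝ ∞ φ → HasCompactSupport φ → tsupport φ ⊆ Ioo 0 1 →
    ∫ t in Ioo (0 : ℝ) 1, g t * iteratedDeriv 2 φ t = ∫ t in Ioo (0 : ℝ) 1, G t * φ t

/-- `gxx` and `gyy` are the second tangential derivatives of the boundary function `g`
on the horizontal and on the vertical sides of `Ω`, respectively. -/
def IsTangentialSecondDeriv (g gxx gyy : ℝ × ℝ → ℝ) : Prop :=
  (∀ c : ℝ, c = 0 ∨ c = 1 → IsWeakSecondDeriv (fun y => g (c, y)) (fun y => gyy (c, y))) ∧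
  (∀ c : ℝ, c = 0 ∨ c = 1 → IsWeakSecondDeriv (fun x => g (x, c)) (fun x => gxx (x, c)))

/-! ### Rectangular partitions -/

/-- The Cartesian product of `0 = x₀ < ⋯ < x_n = 1` and `0 = y₀ < ⋯ < y_m = 1`.
The elements are indexed by `Fin n × Fin m`. -/
structure Mesh (n m : ℕ) where
  x : Fin (n + 1) → ℝ
  y : Fin (m + 1) → ℝ
  x_strictMono : StrictMono x
  y_strictMono : StrictMono y
  x_zero : x 0 = 0
  x_last : x (Fin.last n) = 1
  y_zero : y 0 = 0
  y_last : y (Fin.last m) = 1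

variable {n m : ℕ}

namespace Mesh

/-- Width of the `i`-th column, the length of its horizontal edges. -/
def hx (M : Mesh n m) (i : Fin n) : ℝ := M.x i.succ - M.x i.castSucc

/-- Height of the `j`-th row, the length of its vertical edges. -/
def hy (M : Mesh n m) (j : Fin m) : ℝ := M.y j.succ - M.y j.castSucc

/-- The element `T_{ij}`. -/
def elem (M : Mesh n m) (i : Fin n) (j : Fin m) : Set (ℝ × ℝ) :=
  Icc (M.x i.castSucc) (M.x i.succ) ×ˢ Icc (M.y j.castSucc) (M.y j.succ)

/-- The area of `T_{ij}`. -/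
def area (M : Mesh n m) (i : Fin n) (j : Fin m) : ℝ := M.hx i * M.hy j

/-- The mesh size, the maximum of the Euclidean diameters of the elements. -/
def size (M : Mesh n m) : ℝ :=
  ⨆ T : Fin n × Fin m, Real.sqrt (M.hx T.1 ^ 2 + M.hy T.2 ^ 2)

/-- `Q_b` on the vertical edge `{x_i} × [y_j, y_{j+1}]`: the `L²` projection onto constants. -/
def QbV (M : Mesh n m) (i : Fin (n + 1)) (j : Fin m) (w : ℝ × ℝ → ℝ) : ℝ :=
  ⨍ t in M.y j.castSucc..M.y j.succ, w (M.x i, t)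

/-- `Q_b` on the horizontal edge `[x_i, x_{i+1}] × {y_j}`. -/
def QbH (M : Mesh n m) (i : Fin n) (j : Fin (m + 1)) (w : ℝ × ℝ → ℝ) : ℝ :=
  ⨍ s in M.x i.castSucc..M.x i.succ, w (s, M.y j)

/-- `ℚ_h` on `T_{ij}` for a scalar function: the `L²(T)` projection onto constants. -/
def Qh (M : Mesh n m) (i : Fin n) (j : Fin m) (w : ℝ × ℝ → ℝ) : ℝ :=
  ⨍ p in M.elem i j, w p

end Mesh

/-! ### The lowest order weak Galerkin method -/

/-- The space `V_h` for `k = 1`: a polynomial of degree at most one on each element, and a constant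
on each vertical edge `{x_i} × [y_j, y_{j+1}]` and each horizontal edge `[x_i, x_{i+1}] × {y_j}`. -/
structure WeakFun (n m : ℕ) where
  v0 : Fin n → Fin m → (ℝ × ℝ →ᵃ[ℝ] ℝ)
  vV : Fin (n + 1) → Fin m → ℝ
  vH : Fin n → Fin (m + 1) → ℝ

/-- The subspace `V_h^0` of functions that vanish on `∂Ω`. -/
def WeakFun.VanishesOnBoundary (v : WeakFun n m) : Prop :=
  (∀ j, v.vV 0 j = 0 ∧ v.vV (Fin.last n) j = 0) ∧
  (∀ i, v.vH i 0 = 0 ∧ v.vH i (Fin.last m) = 0)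

/-- The discrete weak gradient on `T_{ij}`, the constant vector `|T|⁻¹ ∫_{∂T} v_b n ds`. -/
def weakGrad (M : Mesh n m) (v : WeakFun n m) (i : Fin n) (j : Fin m) : ℝ × ℝ :=
  ((M.area i j)⁻¹ * (M.hy j * v.vV i.succ j - M.hy j * v.vV i.castSucc j),
   (M.area i j)⁻¹ * (M.hx i * v.vH i j.succ - M.hx i * v.vH i j.castSucc))

/-- `weakGrad` is the only constant vector with `(∇_d v, ψ)_T = ⟨v_b, ψ · n⟩_{∂T}` for all constant
vectors `ψ`; the term `(v_0, ∇ · ψ)_T` is zero. -/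
theorem weakGrad_unique (M : Mesh n m) (v : WeakFun n m) (i : Fin n) (j : Fin m) (d : ℝ × ℝ) :
    d = weakGrad M v i j ↔ ∀ ψ : ℝ × ℝ,
      M.area i j * (d.1 * ψ.1 + d.2 * ψ.2) =
        M.hy j * (v.vV i.castSucc j * (-ψ.1)) + M.hy j * (v.vV i.succ j * ψ.1) +
        M.hx i * (v.vH i j.castSucc * (-ψ.2)) + M.hx i * (v.vH i j.succ * ψ.2) := by
  have hx : 0 < M.hx i := sub_pos.2 (M.x_strictMono Fin.castSucc_lt_succ)
  have hy : 0 < M.hy j := sub_pos.2 (M.y_strictMono Fin.castSucc_lt_succ)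
  have hA : M.area i j ≠ 0 := (mul_pos hx hy).ne'
  constructor
  · rintro rfl ψ
    simp only [weakGrad]
    field_simp
    ring
  · intro h
    have h1 := h (1, 0)
    have h2 := h (0, 1)
    simp only [weakGrad] at *
    refine Prod.ext ?_ ?_
    · simp only
      rw [eq_inv_mul_iff_mul_eq₀ hA]
      linarith
    · simp only
      rw [eq_inv_mul_iff_mul_eq₀ hA]
      linarith

/-- `Σ_T (a ∇_d w, ∇_d v)_T` for the tensor `a = diag(a11, a22)`, constant on each element. -/
def diffusionForm (M : Mesh n m) (a11 a22 : Fin n → Fin m → ℝ) (w v : WeakFun n m) : ℝ :=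
  ∑ i, ∑ j, M.area i j *
    (a11 i j * (weakGrad M w i j).1 * (weakGrad M v i j).1 +
     a22 i j * (weakGrad M w i j).2 * (weakGrad M v i j).2)

/-- The stabilizer `s(w, v) = ρ h⁻¹ Σ_T ⟨w_b - Q_b w_0, v_b - Q_b v_0⟩_{∂T}`. -/
def stabilizer (M : Mesh n m) (ρ : ℝ) (w v : WeakFun n m) : ℝ :=
  ρ * M.size⁻¹ * ∑ i, ∑ j,
    (M.hy j * ((w.vV i.castSucc j - M.QbV i.castSucc j (w.v0 i j)) *
        (v.vV i.castSucc j - M.QbV i.castSucc j (v.v0 i j))) +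
     M.hy j * ((w.vV i.succ j - M.QbV i.succ j (w.v0 i j)) *
        (v.vV i.succ j - M.QbV i.succ j (v.v0 i j))) +
     M.hx i * ((w.vH i j.castSucc - M.QbH i j.castSucc (w.v0 i j)) *
        (v.vH i j.castSucc - M.QbH i j.castSucc (v.v0 i j))) +
     M.hx i * ((w.vH i j.succ - M.QbH i j.succ (w.v0 i j)) *
        (v.vH i j.succ - M.QbH i j.succ (v.v0 i j))))

/-- `u_h` satisfies `(a ∇_d u_h, ∇_d v)_h + s(u_h, v) = (f, v_0)` for all `v ∈ V_h^0`. -/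
def IsWGSolution (M : Mesh n m) (ρ : ℝ) (a11 a22 : Fin n → Fin m → ℝ) (f : ℝ × ℝ → ℝ)
    (uh : WeakFun n m) : Prop :=
  ∀ v : WeakFun n m, v.VanishesOnBoundary →
    diffusionForm M a11 a22 uh v + stabilizer M ρ uh v =
      ∑ i, ∑ j, ∫ p in M.elem i j, f p * v.v0 i j p

/-- The boundary value of `u_h`: `Q_b g + (1/12) h_y (h_y - 6 ρ⁻¹ a22 h) Q_b(g_yy)` on the vertical
and `Q_b g + (1/12) h_x (h_x - 6 ρ⁻¹ a11 h) Q_b(g_xx)` on the horizontal boundary edges, with the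
value of the coefficient on the element that contains the edge. -/
def HasPerturbedBoundaryValue (M : Mesh n m) (ρ : ℝ) (a11 a22 : Fin n → Fin m → ℝ)
    (g gxx gyy : ℝ × ℝ → ℝ) (uh : WeakFun n m) : Prop :=
  (∀ (i : Fin n) (j : Fin m) (k : Fin (n + 1)),
    (k = 0 ∧ k = i.castSucc) ∨ (k = Fin.last n ∧ k = i.succ) →
    uh.vV k j = M.QbV k j g +
      1 / 12 * M.hy j * (M.hy j - 6 * ρ⁻¹ * a22 i j * M.size) * M.QbV k j gyy) ∧
  (∀ (i : Fin n) (j : Fin m) (k : Fin (m + 1)),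
    (k = 0 ∧ k = j.castSucc) ∨ (k = Fin.last m ∧ k = j.succ) →
    uh.vH i k = M.QbH i k g +
      1 / 12 * M.hx i * (M.hx i - 6 * ρ⁻¹ * a11 i j * M.size) * M.QbH i k gxx)

/-! ### The model problem -/

/-- `u` is a weak solution of `-∇ · (a ∇u) = f` in `Ω`, where `a = diag(a11, a22)` is constant on
each element of the partition. -/
def IsWeakSolution (M : Mesh n m) (a11 a22 : Fin n → Fin m → ℝ) (f u : ℝ × ℝ → ℝ) : Prop :=
  ∀ φ, IsTest φ →
    ∑ i, ∑ j, ∫ p in M.elem i j,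
        (a11 i j * weakDeriv 1 0 u p * dx φ p + a22 i j * weakDeriv 0 1 u p * dy φ p) =
      ∫ p in Omega, f p * φ p

/-- `a22 Q_b(u_yy)` takes the same value from both sides of each interior vertical edge, and so does
`a11 Q_b(u_xx)` for each interior horizontal edge: where the coefficient jumps, the average over the
edge of the trace of the second derivative is zero. This holds trivially for constant `a`. -/
def EdgeSingleValued (M : Mesh n m) (a11 a22 : Fin n → Fin m → ℝ) (u : ℝ × ℝ → ℝ) : Prop :=
  (∀ (i i' : Fin n) (j : Fin m), i'.val = i.val + 1 → a22 i j ≠ a22 i' j →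
    ∃ τ, IsTraceV (weakDeriv 0 2 u) (M.x i.succ) τ ∧
      ⨍ t in M.y j.castSucc..M.y j.succ, τ t = 0) ∧
  (∀ (i : Fin n) (j j' : Fin m), j'.val = j.val + 1 → a11 i j ≠ a11 i j' →
    ∃ τ, IsTraceH (weakDeriv 2 0 u) (M.y j.succ) τ ∧
      ⨍ s in M.x i.castSucc..M.x i.succ, τ s = 0)

/-- `(Σ_T ‖ℚ_h ∇u - ∇_d u_b‖_T²)^{1/2}`. -/
def gradError (M : Mesh n m) (u : ℝ × ℝ → ℝ) (uh : WeakFun n m) : ℝ :=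
  Real.sqrt (∑ i, ∑ j, M.area i j *
    ((M.Qh i j (weakDeriv 1 0 u) - (weakGrad M uh i j).1) ^ 2 +
     (M.Qh i j (weakDeriv 0 1 u) - (weakGrad M uh i j).2) ^ 2))

end

end WG

/-!
The mean of the flux `a ∂_n u` over an edge `e` of `T` differs from its mean over `T` by
`a₁₁ h_x u_xx / 2` on the vertical and by `a₂₂ h_y u_yy / 2` on the horizontal edges, up to second
order. The stabilizer absorbs this defect if `w_b - Q_b w_0` is `h ρ⁻¹` times it. Giving `w_b` the
perturbed edge means of `u` that are prescribed on the boundary, this means that `Q_b w_0` is the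
mean of `u` plus `h_e² / 12` times the mean of the second tangential derivative, minus the quantity
`h (a₁₁ h_x u_xx + a₂₂ h_y u_yy) / (2ρ)`, which is the same on all four edges of `T`. An affine
`w_0` takes arbitrary mean values on the edges as long as the sums over the two pairs of opposite
edges agree. By the trapezoidal rule these corrected means satisfy this condition up to third order.

The resulting interpolant `w` is single-valued on the edges, coincides with `u_h` on the boundary,
and satisfies the discrete equation up to second order. As `w - u_h` is a test function, coercivity
bounds it in the energy norm. The perturbation enters `∇_d w_b` only through differences over
opposite edges, so that `∇_d w_b` agrees with `ℚ_h ∇u` up to second order as well.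
-/

namespace WG

/-! ### Test functions and weak derivatives on an interval -/

/-- `k` is a bounded measurable function, the class of weights that may multiply an integrable
function. -/
def IsWeight {α : Type*} [MeasurableSpace α] (k : α → ℝ) : Prop :=
  Measurable k ∧ ∃ C, ∀ y, ‖k y‖ ≤ C

namespace IsWeight

variable {α β : Type*} [MeasurableSpace α] [MeasurableSpace β] {k l : α → ℝ}

theorem integrable_mul {μ : Measure α} {F : α → ℝ} (hk : IsWeight k) (hF : Integrable F μ) :
    Integrable (fun p => k p * F p) μ := by
  obtain ⟨C, hC⟩ := hk.2
  exact hF.bdd_mul hk.1.aestronglyMeasurable (Eventually.of_forall hC)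

theorem integrable_mul' {μ : Measure α} {F : α → ℝ} (hk : IsWeight k) (hF : Integrable F μ) :
    Integrable (fun p => F p * k p) μ := by
  simpa only [mul_comm] using hk.integrable_mul hF

theorem comp (hk : IsWeight k) {g : β → α} (hg : Measurable g) : IsWeight fun p => k (g p) :=
  ⟨hk.1.comp hg, hk.2.choose, fun _ => hk.2.choose_spec _⟩

theorem mul (hk : IsWeight k) (hl : IsWeight l) : IsWeight fun p => k p * l p := by
  obtain ⟨C, hC⟩ := hk.2
  obtain ⟨D, hD⟩ := hl.2
  refine ⟨hk.1.mul hl.1, C * D, fun y => ?_⟩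
  rw [norm_mul]
  exact mul_le_mul (hC y) (hD y) (norm_nonneg _) ((norm_nonneg _).trans (hC y))

theorem indicator (hk : IsWeight k) {s : Set α} (hs : MeasurableSet s) :
    IsWeight (s.indicator k) :=
  ⟨hk.1.indicator hs, hk.2.choose,
    fun y => (norm_indicator_le_norm_self _ _).trans (hk.2.choose_spec y)⟩

theorem const (c : ℝ) : IsWeight fun _ : α => c := ⟨measurable_const, ‖c‖, fun _ => le_rfl⟩

theorem indicator_Ioo_of_continuous {p : ℝ → ℝ} (hp : Continuous p) (a b : ℝ) :
    IsWeight ((Ioo a b).indicator p) := by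
  obtain ⟨C, hC⟩ := isCompact_Icc.exists_bound_of_continuousOn (s := Icc a b) hp.continuousOn
  refine ⟨hp.measurable.indicator measurableSet_Ioo, max C 0, fun y => ?_⟩
  by_cases hy : y ∈ Ioo a b
  · rw [indicator_of_mem hy]
    exact (hC y (Ioo_subset_Icc_self hy)).trans (le_max_left _ _)
  · rw [indicator_of_notMem hy, norm_zero]
    exact le_max_right _ _

end IsWeight

/-- `φ ∈ C_c^∞(U)`. In particular `IsTest` is `IsTestOn Omega`. -/
def IsTestOn {E : Type*} [NormedAddCommGroup E] [NormedSpace ℝ E] (U : Set E) (φ : E → ℝ) : Prop :=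
  ContDiff ℝ ∞ φ ∧ HasCompactSupport φ ∧ tsupport φ ⊆ U

namespace IsTestOn

variable {E : Type*} [NormedAddCommGroup E] [NormedSpace ℝ E] {U V : Set E} {φ χ : E → ℝ}

theorem mono (h : IsTestOn U φ) (hUV : U ⊆ V) : IsTestOn V φ :=
  ⟨h.1, h.2.1, h.2.2.trans hUV⟩

theorem eq_zero (h : IsTestOn U φ) {x : E} (hx : x ∉ U) : φ x = 0 :=
  image_eq_zero_of_notMem_tsupport fun hx' => hx (h.2.2 hx')

theorem differentiable (h : IsTestOn U φ) : Differentiable ℝ φ := h.1.differentiable (by simp)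

theorem isWeight [MeasurableSpace E] [BorelSpace E] (h : IsTestOn U φ) : IsWeight φ :=
  ⟨h.1.continuous.measurable, h.2.1.exists_bound_of_continuous h.1.continuous⟩

theorem sub_const_mul (hφ : IsTestOn U φ) (hχ : IsTestOn U χ) (c : ℝ) :
    IsTestOn U fun x => φ x - c * χ x := by
  have hs : tsupport (fun x => φ x - c * χ x) ⊆ tsupport φ ∪ tsupport χ := by
    refine closure_minimal (fun x hx => ?_) ((isClosed_tsupport _).union (isClosed_tsupport _))
    by_contra hx'
    rw [mem_union, not_or] at hx'
    exact hx (by simp [image_eq_zero_of_notMem_tsupport hx'.1,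
      image_eq_zero_of_notMem_tsupport hx'.2])
  exact ⟨hφ.1.sub (contDiff_const.mul hχ.1), HasCompactSupport.of_support_subset_isCompact
    (hφ.2.1.isCompact.union hχ.2.1.isCompact) ((subset_tsupport _).trans hs),
    hs.trans (union_subset hφ.2.2 hχ.2.2)⟩

theorem deriv {U : Set ℝ} {ψ : ℝ → ℝ} (h : IsTestOn U ψ) : IsTestOn U (deriv ψ) :=
  ⟨h.1.deriv', h.2.1.deriv, tsupport_deriv_subset.trans h.2.2⟩

end IsTestOn

theorem ae_eq_zero_of_integral_test_mul_eq_zero {E : Type*} [NormedAddCommGroup E]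
    [NormedSpace ℝ E] [FiniteDimensional ℝ E] [MeasurableSpace E] [BorelSpace E] {μ : Measure E}
    {U : Set E} (hU : IsOpen U) {F : E → ℝ} (hF : IntegrableOn F U μ)
    (h : ∀ φ, IsTestOn U φ → ∫ x in U, φ x * F x ∂μ = 0) :
    ∀ᵐ x ∂μ.restrict U, F x = 0 := by
  refine (ae_restrict_iff' hU.measurableSet).2
    (hU.ae_eq_zero_of_integral_contDiff_smul_eq_zero hF.locallyIntegrableOn fun φ h1 h2 h3 => ?_)
  have hφ : IsTestOn U φ := ⟨h1, h2, h3⟩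
  rw [← h φ hφ, setIntegral_eq_integral_of_forall_compl_eq_zero]
  · rfl
  · intro x hx
    rw [hφ.eq_zero hx, zero_mul]

section Interval

variable {a b : ℝ}

theorem exists_Icc_of_isCompact_subset_Ioo {K : Set ℝ} (hK : IsCompact K) (hs : K ⊆ Ioo a b) :
    ∃ c d : ℝ, a < c ∧ d < b ∧ K ⊆ Icc c d := by
  rcases K.eq_empty_or_nonempty with rfl | hne
  · exact ⟨a + 1, b - 1, by linarith, by linarith, empty_subset _⟩
  · obtain ⟨c, hc, hc'⟩ := hK.exists_isMinOn hne continuousOn_id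
    obtain ⟨d, hd, hd'⟩ := hK.exists_isMaxOn hne continuousOn_id
    exact ⟨c, d, (hs hc).1, (hs hd).2, fun x hx => ⟨hc' hx, hd' hx⟩⟩

theorem IsTestOn.exists_deriv_eq {χ : ℝ → ℝ} (hχ : IsTestOn (Ioo a b) χ) (h0 : ∫ x, χ x = 0) :
    ∃ ψ, IsTestOn (Ioo a b) ψ ∧ _root_.deriv ψ = χ := by
  obtain ⟨c, d, hac, hdb, hK⟩ := exists_Icc_of_isCompact_subset_Ioo hχ.2.1.isCompact hχ.2.2
  have hχ0 : ∀ x ∉ Icc c d, χ x = 0 := fun x hx =>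
    image_eq_zero_of_notMem_tsupport fun h => hx (hK h)
  set ψ : ℝ → ℝ := fun x => ∫ s in a..x, χ s
  have hderiv : ∀ x, HasDerivAt ψ (χ x) x := fun x =>
    intervalIntegral.integral_hasDerivAt_right (hχ.1.continuous.intervalIntegrable _ _)
      (hχ.1.continuous.stronglyMeasurableAtFilter _ _) hχ.1.continuous.continuousAt
  have hderiv' : _root_.deriv ψ = χ := funext fun x => (hderiv x).deriv
  have hsmooth : ContDiff ℝ ∞ ψ := by
    rw [contDiff_infty_iff_deriv, hderiv']
    exact ⟨fun x => (hderiv x).differentiableAt, hχ.1⟩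
  have hψ0 : ∀ x ∉ Icc c d, ψ x = 0 := by
    intro x hx
    rw [mem_Icc, not_and_or, not_le, not_le] at hx
    rcases hx with hx | hx
    · refine intervalIntegral.integral_zero_ae (Eventually.of_forall fun s hs => hχ0 s fun h => ?_)
      rcases mem_uIoc.1 hs with h' | h' <;> linarith [h.1, h'.2]
    · rw [← h0]
      refine intervalIntegral.integral_eq_integral_of_support_subset fun s hs => ?_
      have hs' : s ∈ Icc c d := hK (subset_tsupport _ hs)
      exact ⟨hac.trans_le hs'.1, hs'.2.trans hx.le⟩
  have hsupp : tsupport ψ ⊆ Icc c d :=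
    closure_minimal (fun x hx => by_contra fun h => hx (hψ0 x h)) isClosed_Icc
  exact ⟨ψ, ⟨hsmooth, HasCompactSupport.of_support_subset_isCompact isCompact_Icc
    ((subset_tsupport _).trans hsupp), hsupp.trans (Icc_subset_Ioo hac hdb)⟩, hderiv'⟩

theorem exists_isTestOn_integral_eq_one (hab : a < b) :
    ∃ θ, IsTestOn (Ioo a b) θ ∧ ∫ x, θ x = 1 := by
  let B : ContDiffBump ((a + b) / 2) := ⟨(b - a) / 8, (b - a) / 4, by linarith, by linarith⟩
  refine ⟨B.normed volume, ⟨B.contDiff_normed, B.hasCompactSupport_normed, ?_⟩, B.integral_normed⟩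
  rw [B.tsupport_normed_eq, Real.closedBall_eq_Icc]
  refine Icc_subset_Ioo ?_ ?_ <;> dsimp only [B] <;> linarith

theorem exists_ae_eq_const_of_integral_mul_deriv_eq_zero (hab : a < b) {F : ℝ → ℝ}
    (hF : IntegrableOn F (Ioo a b))
    (h : ∀ ψ, IsTestOn (Ioo a b) ψ → ∫ x in Ioo a b, F x * deriv ψ x = 0) :
    ∃ c, ∀ᵐ x ∂volume.restrict (Ioo a b), F x = c := by
  obtain ⟨θ, hθ, hθ1⟩ := exists_isTestOn_integral_eq_one hab
  set c := ∫ x in Ioo a b, θ x * F x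
  have hzero : ∀ᵐ x ∂volume.restrict (Ioo a b), F x - c = 0 := by
    refine ae_eq_zero_of_integral_test_mul_eq_zero isOpen_Ioo
      (hF.sub (integrableOn_const (by simp))) fun χ hχ => ?_
    set I := ∫ x, χ x
    -- `χ - I θ` has mean zero, so it is the derivative of a test function.
    obtain ⟨ψ, hψ, hψ'⟩ := (hχ.sub_const_mul hθ I).exists_deriv_eq (by
      rw [integral_sub (hχ.1.continuous.integrable_of_hasCompactSupport hχ.2.1)
        ((hθ.1.continuous.integrable_of_hasCompactSupport hθ.2.1).const_mul _),
        integral_const_mul, hθ1, mul_one, sub_self])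
    have hξ := h ψ hψ
    have hχI : ∫ x in Ioo a b, χ x = I :=
      setIntegral_eq_integral_of_forall_compl_eq_zero fun x hx => hχ.eq_zero hx
    simp only [hψ', mul_comm (F _), sub_mul, mul_assoc] at hξ
    rw [integral_sub (hχ.isWeight.integrable_mul hF) ((hθ.isWeight.integrable_mul hF).const_mul I),
      integral_const_mul] at hξ
    simp only [mul_sub]
    rw [integral_sub (hχ.isWeight.integrable_mul hF)
      ((hχ.1.continuous.integrable_of_hasCompactSupport hχ.2.1).integrableOn.mul_const c),
      integral_mul_const, hχI, hξ]
  exact ⟨c, hzero.mono fun x hx => sub_eq_zero.1 hx⟩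

theorem integral_primitive_mul_deriv_add {Z p : ℝ → ℝ} {s t : ℝ} (c : ℝ)
    (hZ : IntervalIntegrable Z volume a b) (hs : s ∈ uIcc a b) (ht : t ∈ uIcc a b)
    (hp : ContDiff ℝ 1 p) :
    ∫ x in s..t, ((c + ∫ r in a..x, Z r) * deriv p x + Z x * p x) =
      (c + ∫ r in a..t, Z r) * p t - (c + ∫ r in a..s, Z r) * p s := by
  have hsub : uIcc s t ⊆ uIcc a b := uIcc_subset_uIcc hs ht
  have hprim : AbsolutelyContinuousOnInterval (fun x => ∫ r in a..x, Z r) s t :=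
    (hZ.absolutelyContinuousOnInterval_intervalIntegral left_mem_uIcc).mono hsub
  have hconst : AbsolutelyContinuousOnInterval (fun _ : ℝ => c) s t :=
    (contDiff_const : ContDiff ℝ 1 fun _ : ℝ => c).contDiffOn.absolutelyContinuousOnInterval
  have hparts := (hconst.add hprim).integral_deriv_mul_eq_sub
    hp.contDiffOn.absolutelyContinuousOnInterval
  simp only [Pi.add_apply] at hparts
  rw [← hparts]
  refine intervalIntegral.integral_congr_ae ?_
  filter_upwards [hZ.ae_hasDerivAt_integral] with x hx hxst
  have hderiv : deriv ((fun _ : ℝ => c) + fun x => ∫ r in a..x, Z r) x = Z x :=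
    ((hx (hsub (uIoc_subset_uIcc hxst)) a left_mem_uIcc).const_add c).deriv
  rw [hderiv]
  ring

theorem ae_eq_primitive_of_weak_deriv (hab : a < b) {W Z : ℝ → ℝ}
    (hW : IntegrableOn W (Ioo a b)) (hZ : IntegrableOn Z (Ioo a b))
    (h : ∀ ψ, IsTestOn (Ioo a b) ψ → ∫ x in Ioo a b, (W x * deriv ψ x + Z x * ψ x) = 0) :
    ∃ c, ∀ᵐ x ∂volume.restrict (Ioo a b), W x = c + ∫ s in a..x, Z s := by
  have hZ' : IntervalIntegrable Z volume a b := by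
    rwa [intervalIntegrable_iff_integrableOn_Ioo_of_le hab.le]
  have hP : IntegrableOn (fun x => ∫ s in a..x, Z s) (Ioo a b) := by
    have hcont :=
      (hZ'.absolutelyContinuousOnInterval_intervalIntegral (left_mem_uIcc (b := b))).continuousOn
    rw [uIcc_of_le hab.le] at hcont
    exact (hcont.integrableOn_compact isCompact_Icc).mono_set Ioo_subset_Icc_self
  suffices hWP : ∀ ψ, IsTestOn (Ioo a b) ψ →
      ∫ x in Ioo a b, (W x - ∫ s in a..x, Z s) * deriv ψ x = 0 by
    obtain ⟨c, hc⟩ := exists_ae_eq_const_of_integral_mul_deriv_eq_zero hab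
      (F := fun x => W x - ∫ s in a..x, Z s) (hW.sub hP) hWP
    exact ⟨c, hc.mono fun x hx => by linear_combination hx⟩
  intro ψ hψ
  have hparts := integral_primitive_mul_deriv_add 0 hZ' left_mem_uIcc right_mem_uIcc
    (hψ.1.of_le (by norm_cast))
  simp only [zero_add, hψ.eq_zero left_notMem_Ioo, hψ.eq_zero right_notMem_Ioo, mul_zero, sub_zero,
    intervalIntegral.integral_of_le hab.le, integral_Ioc_eq_integral_Ioo] at hparts
  calc ∫ x in Ioo a b, (W x - ∫ s in a..x, Z s) * deriv ψ x
      = ∫ x in Ioo a b, ((W x * deriv ψ x + Z x * ψ x) -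
          ((∫ s in a..x, Z s) * deriv ψ x + Z x * ψ x)) := by
        congr 1
        funext x
        ring
    _ = 0 := by
        have hZψ := hψ.isWeight.integrable_mul' hZ
        rw [integral_sub (f := fun x => W x * deriv ψ x + Z x * ψ x)
          (g := fun x => (∫ s in a..x, Z s) * deriv ψ x + Z x * ψ x)
          ((hψ.deriv.isWeight.integrable_mul' hW).add hZψ)
          ((hψ.deriv.isWeight.integrable_mul' hP).add hZψ), h ψ hψ, hparts, sub_zero]

end Interval

/-- The kernel `K(t, ·)` on `(0,1)`, extended by `0`, with `W t = ∫₀¹ (W + K(t, ·) W')` for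
absolutely continuous `W`. It expresses boundary values by integrals over the interior. -/
noncomputable def traceKernel (t : ℝ) : ℝ → ℝ :=
  (Ioo (0 : ℝ) 1).indicator fun s => if s < t then s else s - 1

theorem isWeight_traceKernel (t : ℝ) : IsWeight (traceKernel t) := by
  refine ⟨(Measurable.ite measurableSet_Iio measurable_id (measurable_id.sub_const 1)).indicator
    measurableSet_Ioo, 1, fun s => ?_⟩
  by_cases hs : s ∈ Ioo (0 : ℝ) 1
  · rw [traceKernel, indicator_of_mem hs, Real.norm_eq_abs, abs_le]
    split_ifs <;> constructor <;> linarith [hs.1, hs.2]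
  · rw [traceKernel, indicator_of_notMem hs]
    simp

theorem integral_add_traceKernel_mul {W Z : ℝ → ℝ} {c t : ℝ} (hW : IntegrableOn W (Ioo 0 1))
    (hZ : IntegrableOn Z (Ioo 0 1)) (ht : t ∈ Icc (0 : ℝ) 1)
    (h : ∀ᵐ x ∂volume.restrict (Ioo 0 1), W x = c + ∫ s in (0 : ℝ)..x, Z s) :
    ∫ s in Ioo (0 : ℝ) 1, (W s + traceKernel t s * Z s) = c + ∫ s in (0 : ℝ)..t, Z s := by
  have hZ' : IntervalIntegrable Z volume 0 1 := by
    rwa [intervalIntegrable_iff_integrableOn_Ioo_of_le zero_le_one]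
  have ht' : t ∈ uIcc (0 : ℝ) 1 := by rwa [uIcc_of_le zero_le_one]
  have hint : IntervalIntegrable (fun s => W s + traceKernel t s * Z s) volume 0 1 := by
    rw [intervalIntegrable_iff_integrableOn_Ioo_of_le zero_le_one]
    exact hW.add ((isWeight_traceKernel t).integrable_mul hZ)
  rw [ae_restrict_iff' measurableSet_Ioo] at h
  have hne : ∀ r : ℝ, ∀ᵐ x : ℝ, x ≠ r := fun r => by simp [ae_iff]
  have hleft : ∫ s in (0 : ℝ)..t, (W s + traceKernel t s * Z s) =
      (c + ∫ s in (0 : ℝ)..t, Z s) * t := by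
    have hparts := integral_primitive_mul_deriv_add (p := fun x => x) c hZ' left_mem_uIcc ht'
      contDiff_id
    rw [mul_zero, sub_zero] at hparts
    rw [← hparts]
    refine intervalIntegral.integral_congr_ae ?_
    filter_upwards [h, hne 1, hne t] with x hx hx1 hxt hx'
    rw [uIoc_of_le ht.1] at hx'
    have hmem : x ∈ Ioo (0 : ℝ) 1 := ⟨hx'.1, lt_of_le_of_ne (hx'.2.trans ht.2) hx1⟩
    rw [hx hmem, traceKernel, indicator_of_mem hmem, if_pos (lt_of_le_of_ne hx'.2 hxt)]
    simp [mul_comm]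
  have hright : ∫ s in t..1, (W s + traceKernel t s * Z s) =
      -((c + ∫ s in (0 : ℝ)..t, Z s) * (t - 1)) := by
    have hparts := integral_primitive_mul_deriv_add (p := fun x => x - 1) c hZ' ht' right_mem_uIcc
      (contDiff_id.sub contDiff_const)
    rw [sub_self, mul_zero, zero_sub] at hparts
    rw [← hparts]
    refine intervalIntegral.integral_congr_ae ?_
    filter_upwards [h, hne 1] with x hx hx1 hx'
    rw [uIoc_of_le ht.2] at hx'
    have hmem : x ∈ Ioo (0 : ℝ) 1 := ⟨ht.1.trans_lt hx'.1, lt_of_le_of_ne hx'.2 hx1⟩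
    rw [hx hmem, traceKernel, indicator_of_mem hmem, if_neg (not_lt.2 hx'.1.le)]
    simp [mul_comm]
  rw [← integral_Ioc_eq_integral_Ioo, ← intervalIntegral.integral_of_le zero_le_one,
    ← intervalIntegral.integral_add_adjacent_intervals
      (hint.mono_set (uIcc_subset_uIcc_left ht')) (hint.mono_set (uIcc_subset_uIcc_right ht')),
    hleft, hright]
  ring

/-! ### Weak derivatives on the unit square -/

theorem isOpen_Omega : IsOpen Omega := isOpen_Ioo.prod isOpen_Ioo

theorem muOmega_eq_prod : muOmega =
    (volume.restrict (Ioo (0 : ℝ) 1)).prod (volume.restrict (Ioo (0 : ℝ) 1)) := by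
  rw [muOmega, Omega, Measure.prod_restrict, Measure.volume_eq_prod]

instance isFiniteMeasure_muOmega : IsFiniteMeasure muOmega := by
  rw [muOmega_eq_prod]
  infer_instance

theorem measurePreserving_swap_muOmega : MeasurePreserving Prod.swap muOmega muOmega := by
  rw [muOmega_eq_prod]
  exact Measure.measurePreserving_swap

theorem integral_comp_swap_muOmega (F : ℝ × ℝ → ℝ) :
    ∫ p, F p.swap ∂muOmega = ∫ p, F p ∂muOmega :=
  measurePreserving_swap_muOmega.integral_comp MeasurableEquiv.prodComm.measurableEmbedding F

theorem integral_muOmega {F : ℝ × ℝ → ℝ} (hF : Integrable F muOmega) :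
    ∫ p, F p ∂muOmega = ∫ x in Ioo (0 : ℝ) 1, ∫ y in Ioo (0 : ℝ) 1, F (x, y) := by
  rw [muOmega_eq_prod] at hF ⊢
  exact integral_prod _ hF

theorem integral_muOmega_symm {F : ℝ × ℝ → ℝ} (hF : Integrable F muOmega) :
    ∫ p, F p ∂muOmega = ∫ y in Ioo (0 : ℝ) 1, ∫ x in Ioo (0 : ℝ) 1, F (x, y) := by
  rw [muOmega_eq_prod] at hF ⊢
  exact integral_prod_symm _ hF

theorem hasDerivAt_fst {φ : ℝ × ℝ → ℝ} (h : Differentiable ℝ φ) (x y : ℝ) :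
    HasDerivAt (fun s => φ (s, y)) (dx φ (x, y)) x :=
  (h (x, y)).hasFDerivAt.comp_hasDerivAt x ((hasDerivAt_id x).prodMk (hasDerivAt_const x y))

theorem hasDerivAt_snd {φ : ℝ × ℝ → ℝ} (h : Differentiable ℝ φ) (x y : ℝ) :
    HasDerivAt (fun s => φ (x, s)) (dy φ (x, y)) y :=
  (h (x, y)).hasFDerivAt.comp_hasDerivAt y ((hasDerivAt_const y x).prodMk (hasDerivAt_id y))

theorem contDiff_dx {φ : ℝ × ℝ → ℝ} (h : ContDiff ℝ ∞ φ) : ContDiff ℝ ∞ (dx φ) :=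
  (h.fderiv_right (m := ∞) (by norm_cast)).clm_apply contDiff_const

theorem contDiff_dy {φ : ℝ × ℝ → ℝ} (h : ContDiff ℝ ∞ φ) : ContDiff ℝ ∞ (dy φ) :=
  (h.fderiv_right (m := ∞) (by norm_cast)).clm_apply contDiff_const

theorem dx_dy_comm {φ : ℝ × ℝ → ℝ} (h : ContDiff ℝ ∞ φ) : dx (dy φ) = dy (dx φ) := by
  funext p
  have hd : DifferentiableAt ℝ (fderiv ℝ φ) p :=
    ((h.fderiv_right (m := ∞) (by norm_cast)).differentiable (by simp)) p
  have hsnd (v w : ℝ × ℝ) :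
      fderiv ℝ (fun q => fderiv ℝ φ q v) p w = fderiv ℝ (fderiv ℝ φ) p w v := by
    rw [fderiv_clm_apply hd (differentiableAt_const v)]
    simp
  have hsymm : IsSymmSndFDerivAt ℝ φ p := by
    refine (h.contDiffAt (x := p)).isSymmSndFDerivAt ?_
    simp only [minSmoothness_of_isRCLikeNormedField]
    norm_cast
  unfold dx dy
  rw [hsnd, hsnd]
  exact hsymm _ _

theorem dy_iterate_dx_comm {φ : ℝ × ℝ → ℝ} (h : ContDiff ℝ ∞ φ) (j : ℕ) :
    dy^[j] (dx φ) = dx (dy^[j] φ) := by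
  induction j generalizing φ with
  | zero => rfl
  | succ j ih =>
    rw [Function.iterate_succ_apply, Function.iterate_succ_apply, ← dx_dy_comm h,
      ih (contDiff_dy h)]

theorem dx_comp_swap {φ : ℝ × ℝ → ℝ} (h : Differentiable ℝ φ) (p : ℝ × ℝ) :
    dx (fun q => φ q.swap) p = dy φ p.swap :=
  (hasDerivAt_fst (h.comp (differentiable_snd.prodMk differentiable_fst)) p.1 p.2).unique
    (hasDerivAt_snd h p.2 p.1)

theorem dy_comp_swap {φ : ℝ × ℝ → ℝ} (h : Differentiable ℝ φ) (p : ℝ × ℝ) :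
    dy (fun q => φ q.swap) p = dx φ p.swap :=
  (hasDerivAt_snd (h.comp (differentiable_snd.prodMk differentiable_fst)) p.1 p.2).unique
    (hasDerivAt_fst h p.2 p.1)

namespace IsTest

variable {φ : ℝ × ℝ → ℝ}

theorem isWeight (h : IsTest φ) : IsWeight φ := IsTestOn.isWeight h

theorem differentiable (h : IsTest φ) : Differentiable ℝ φ := IsTestOn.differentiable h

theorem dx (h : IsTest φ) : IsTest (dx φ) :=
  ⟨contDiff_dx h.1, h.2.1.fderiv_apply ℝ _, (tsupport_fderiv_apply_subset ℝ _).trans h.2.2⟩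

theorem dy (h : IsTest φ) : IsTest (dy φ) :=
  ⟨contDiff_dy h.1, h.2.1.fderiv_apply ℝ _, (tsupport_fderiv_apply_subset ℝ _).trans h.2.2⟩

theorem comp_swap (h : IsTest φ) : IsTest fun q => φ q.swap := by
  refine ⟨h.1.comp (contDiff_snd.prodMk contDiff_fst),
    h.2.1.comp_homeomorph (Homeomorph.prodComm ℝ ℝ), ?_⟩
  have hs : tsupport (fun q : ℝ × ℝ => φ q.swap) = Prod.swap ⁻¹' tsupport φ :=
    tsupport_comp_eq_preimage φ (Homeomorph.prodComm ℝ ℝ)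
  rw [hs]
  exact fun p hp => (h.2.2 hp).symm

end IsTest

section ProductTest

variable {ψ η : ℝ → ℝ} (hψ : IsTestOn (Ioo 0 1) ψ) (hη : IsTestOn (Ioo 0 1) η)

include hψ hη

theorem isTest_mul : IsTest fun p => ψ p.1 * η p.2 := by
  have hs : tsupport (fun p : ℝ × ℝ => ψ p.1 * η p.2) ⊆ tsupport ψ ×ˢ tsupport η :=
    closure_minimal (fun p (hp : ψ p.1 * η p.2 ≠ 0) =>
      ⟨subset_tsupport _ (left_ne_zero_of_mul hp), subset_tsupport _ (right_ne_zero_of_mul hp)⟩)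
      ((isClosed_tsupport _).prod (isClosed_tsupport _))
  exact ⟨(hψ.1.comp contDiff_fst).mul (hη.1.comp contDiff_snd),
    HasCompactSupport.of_support_subset_isCompact
      (hψ.2.1.isCompact.prod hη.2.1.isCompact) ((subset_tsupport _).trans hs),
    hs.trans (prod_mono hψ.2.2 hη.2.2)⟩

theorem dx_mul (p : ℝ × ℝ) : dx (fun p => ψ p.1 * η p.2) p = deriv ψ p.1 * η p.2 :=
  (hasDerivAt_fst (isTest_mul hψ hη).differentiable p.1 p.2).unique
    ((hψ.differentiable p.1).hasDerivAt.mul_const (η p.2))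

theorem dy_mul (p : ℝ × ℝ) : dy (fun p => ψ p.1 * η p.2) p = ψ p.1 * deriv η p.2 :=
  (hasDerivAt_snd (isTest_mul hψ hη).differentiable p.1 p.2).unique
    ((hη.differentiable p.2).hasDerivAt.const_mul (ψ p.1))

end ProductTest

theorem IsWeakDeriv.ae_eq {i j : ℕ} {u v v' : ℝ × ℝ → ℝ} (h : IsWeakDeriv i j u v)
    (h' : IsWeakDeriv i j u v') : v =ᵐ[muOmega] v' := by
  have hv := h.1.integrable one_le_two
  have hv' := h'.1.integrable one_le_two
  refine (ae_eq_zero_of_integral_test_mul_eq_zero isOpen_Omega (hv.sub hv') fun φ hφ => ?_).mono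
    fun p hp => sub_eq_zero.1 hp
  have heq : ∫ p in Omega, v p * φ p = ∫ p in Omega, v' p * φ p :=
    mul_left_cancel₀ (pow_ne_zero _ (by norm_num)) ((h.2 φ hφ).symm.trans (h'.2 φ hφ))
  simp only [Pi.sub_apply, mul_comm (φ _), sub_mul]
  exact (integral_sub (hφ.isWeight.integrable_mul' hv) (hφ.isWeight.integrable_mul' hv')).trans
    (sub_eq_zero.2 heq)

theorem weakDeriv_spec {k : ℕ} {u : ℝ × ℝ → ℝ} (hu : MemSobolev k u) {i j : ℕ} (h : i + j ≤ k) :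
    IsWeakDeriv i j u (weakDeriv i j u) := by
  rw [weakDeriv, dif_pos (hu.2 i j h)]
  exact (hu.2 i j h).choose_spec

/-- `w ∈ L²(Ω)` has the weak partial derivative `z ∈ L²(Ω)` in `x`. -/
structure HasWeakDx (w z : ℝ × ℝ → ℝ) : Prop where
  memLp : MemLp w 2 muOmega
  memLp_deriv : MemLp z 2 muOmega
  integral_mul_dx : ∀ φ, IsTest φ → ∫ p, w p * dx φ p ∂muOmega = -∫ p, z p * φ p ∂muOmega

/-- `w ∈ L²(Ω)` has the weak partial derivative `z ∈ L²(Ω)` in `y`. -/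
structure HasWeakDy (w z : ℝ × ℝ → ℝ) : Prop where
  memLp : MemLp w 2 muOmega
  memLp_deriv : MemLp z 2 muOmega
  integral_mul_dy : ∀ φ, IsTest φ → ∫ p, w p * dy φ p ∂muOmega = -∫ p, z p * φ p ∂muOmega

section PartialDerivatives

variable {w z : ℝ × ℝ → ℝ}

theorem HasWeakDx.integrable (h : HasWeakDx w z) : Integrable w muOmega :=
  h.memLp.integrable one_le_two

theorem HasWeakDx.integrable_deriv (h : HasWeakDx w z) : Integrable z muOmega :=
  h.memLp_deriv.integrable one_le_two

theorem HasWeakDx.isWeakDeriv (h : HasWeakDx w z) : IsWeakDeriv 1 0 w z :=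
  ⟨h.memLp_deriv, fun φ hφ => by simpa [muOmega] using h.integral_mul_dx φ hφ⟩

theorem HasWeakDy.isWeakDeriv (h : HasWeakDy w z) : IsWeakDeriv 0 1 w z :=
  ⟨h.memLp_deriv, fun φ hφ => by simpa [muOmega] using h.integral_mul_dy φ hφ⟩

theorem HasWeakDy.swap (h : HasWeakDy w z) :
    HasWeakDx (fun p => w p.swap) (fun p => z p.swap) where
  memLp := h.memLp.comp_measurePreserving measurePreserving_swap_muOmega
  memLp_deriv := h.memLp_deriv.comp_measurePreserving measurePreserving_swap_muOmega
  integral_mul_dx φ hφ := by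
    calc ∫ p, w p.swap * dx φ p ∂muOmega
        = ∫ p, w p * dx φ p.swap ∂muOmega := integral_comp_swap_muOmega fun p => w p * dx φ p.swap
      _ = ∫ p, w p * dy (fun q => φ q.swap) p ∂muOmega := by
          simp only [dy_comp_swap hφ.differentiable]
      _ = -∫ p, z p * φ p.swap ∂muOmega := h.integral_mul_dy _ hφ.comp_swap
      _ = -∫ p, z p.swap * φ p ∂muOmega :=
          congrArg _ (integral_comp_swap_muOmega fun p => z p * φ p.swap).symm

theorem HasWeakDx.swap (h : HasWeakDx w z) :
    HasWeakDy (fun p => w p.swap) (fun p => z p.swap) where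
  memLp := h.memLp.comp_measurePreserving measurePreserving_swap_muOmega
  memLp_deriv := h.memLp_deriv.comp_measurePreserving measurePreserving_swap_muOmega
  integral_mul_dy φ hφ := by
    calc ∫ p, w p.swap * dy φ p ∂muOmega
        = ∫ p, w p * dy φ p.swap ∂muOmega := integral_comp_swap_muOmega fun p => w p * dy φ p.swap
      _ = ∫ p, w p * dx (fun q => φ q.swap) p ∂muOmega := by
          simp only [dx_comp_swap hφ.differentiable]
      _ = -∫ p, z p * φ p.swap ∂muOmega := h.integral_mul_dx _ hφ.comp_swap
      _ = -∫ p, z p.swap * φ p ∂muOmega :=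
          congrArg _ (integral_comp_swap_muOmega fun p => z p * φ p.swap).symm

/-- Since the test functions in `y` separate points of `L¹(0,1)`, the weight in `y` need not be
smooth. -/
theorem HasWeakDx.integral_weight (h : HasWeakDx w z) {k : ℝ → ℝ} (hk : IsWeight k) {ψ : ℝ → ℝ}
    (hψ : IsTestOn (Ioo 0 1) ψ) :
    ∫ p, k p.2 * (w p * deriv ψ p.1 + z p * ψ p.1) ∂muOmega = 0 := by
  set G : ℝ × ℝ → ℝ := fun p => w p * deriv ψ p.1 + z p * ψ p.1
  have hG : Integrable G muOmega :=
    ((hψ.deriv.isWeight.comp measurable_fst).integrable_mul' h.integrable).add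
      ((hψ.isWeight.comp measurable_fst).integrable_mul' h.integrable_deriv)
  set F : ℝ → ℝ := fun y => ∫ x in Ioo (0 : ℝ) 1, G (x, y)
  have hF : IntegrableOn F (Ioo 0 1) := by
    rw [muOmega_eq_prod] at hG
    exact hG.integral_prod_right
  have hfubini {l : ℝ → ℝ} (hl : IsWeight l) :
      ∫ p, l p.2 * G p ∂muOmega = ∫ y in Ioo (0 : ℝ) 1, l y * F y := by
    rw [integral_muOmega_symm ((hl.comp measurable_snd).integrable_mul hG)]
    simp only [integral_const_mul, F]
  have hF0 : ∀ᵐ y ∂volume.restrict (Ioo 0 1), F y = 0 := by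
    refine ae_eq_zero_of_integral_test_mul_eq_zero isOpen_Ioo hF fun η hη => ?_
    have htest := h.integral_mul_dx _ (isTest_mul hψ hη)
    simp only [dx_mul hψ hη] at htest
    have hη' := hη.isWeight.comp (measurable_snd (α := ℝ))
    rw [← hfubini hη.isWeight]
    calc ∫ p, η p.2 * G p ∂muOmega
        = ∫ p, (w p * (deriv ψ p.1 * η p.2) + z p * (ψ p.1 * η p.2)) ∂muOmega := by
          congr 1
          funext p
          simp only [G]
          ring
      _ = 0 := by
          rw [integral_add
            (((hψ.deriv.isWeight.comp measurable_fst).mul hη').integrable_mul' h.integrable)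
            (((hψ.isWeight.comp measurable_fst).mul hη').integrable_mul' h.integrable_deriv),
            htest, neg_add_cancel]
  rw [hfubini hk]
  exact integral_eq_zero_of_ae (hF0.mono fun y hy => by simp [hy])

theorem HasWeakDy.integral_weight (h : HasWeakDy w z) {k : ℝ → ℝ} (hk : IsWeight k) {ψ : ℝ → ℝ}
    (hψ : IsTestOn (Ioo 0 1) ψ) :
    ∫ p, k p.1 * (w p * deriv ψ p.2 + z p * ψ p.2) ∂muOmega = 0 := by
  rw [← integral_comp_swap_muOmega]
  exact h.swap.integral_weight hk hψ

theorem IsWeakDeriv.hasWeakDx {i j : ℕ} {u : ℝ × ℝ → ℝ} (hw : IsWeakDeriv i j u w)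
    (hz : IsWeakDeriv (i + 1) j u z) : HasWeakDx w z where
  memLp := hw.1
  memLp_deriv := hz.1
  integral_mul_dx φ hφ := by
    have h := hw.2 (dx φ) hφ.dx
    rw [dy_iterate_dx_comm hφ.1, ← Function.iterate_succ_apply, hz.2 φ hφ] at h
    refine mul_left_cancel₀ (pow_ne_zero (i + j) (by norm_num : (-1 : ℝ) ≠ 0)) (h.symm.trans ?_)
    rw [muOmega]
    ring

theorem IsWeakDeriv.hasWeakDy {i j : ℕ} {u : ℝ × ℝ → ℝ} (hw : IsWeakDeriv i j u w)
    (hz : IsWeakDeriv i (j + 1) u z) : HasWeakDy w z where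
  memLp := hw.1
  memLp_deriv := hz.1
  integral_mul_dy φ hφ := by
    have h := hw.2 (dy φ) hφ.dy
    rw [← Function.iterate_succ_apply, hz.2 φ hφ] at h
    refine mul_left_cancel₀ (pow_ne_zero (i + j) (by norm_num : (-1 : ℝ) ≠ 0)) (h.symm.trans ?_)
    rw [muOmega]
    ring

end PartialDerivatives

/-- `D i j` represents the weak derivative `∂_x^i ∂_y^j` of `D 0 0 ∈ H^k(Ω)` for all `i + j ≤ k`;
the other entries are arbitrary. -/
structure IsJet (k : ℕ) (D : ℕ → ℕ → ℝ × ℝ → ℝ) : Prop where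
  memLp : ∀ i j, i + j ≤ k → MemLp (D i j) 2 muOmega
  hasWeakDx : ∀ i j, i + 1 + j ≤ k → HasWeakDx (D i j) (D (i + 1) j)
  hasWeakDy : ∀ i j, i + (j + 1) ≤ k → HasWeakDy (D i j) (D i (j + 1))

/-- The jet of `p ↦ u p.swap`, where `D` is the jet of `u`. -/
def swapJet (D : ℕ → ℕ → ℝ × ℝ → ℝ) (i j : ℕ) (p : ℝ × ℝ) : ℝ := D j i p.swap

theorem IsJet.swap {k : ℕ} {D : ℕ → ℕ → ℝ × ℝ → ℝ} (h : IsJet k D) : IsJet k (swapJet D) where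
  memLp i j hij := (h.memLp j i (by omega)).comp_measurePreserving measurePreserving_swap_muOmega
  hasWeakDx i j hij := (h.hasWeakDy j i (by omega)).swap
  hasWeakDy i j hij := (h.hasWeakDx j i (by omega)).swap

theorem MemSobolev.ae_eq_weakDeriv_zero {k : ℕ} {u : ℝ × ℝ → ℝ} (hu : MemSobolev k u) :
    u =ᵐ[muOmega] weakDeriv 0 0 u :=
  IsWeakDeriv.ae_eq (u := u) ⟨hu.1, fun φ _ => by simp⟩ (weakDeriv_spec hu (by omega))

theorem MemSobolev.isJet {k : ℕ} {u : ℝ × ℝ → ℝ} (hu : MemSobolev k u) :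
    IsJet k fun i j => weakDeriv i j u where
  memLp _ _ hij := (weakDeriv_spec hu hij).1
  hasWeakDx _ _ hij := (weakDeriv_spec hu (by omega)).hasWeakDx (weakDeriv_spec hu hij)
  hasWeakDy _ _ hij := (weakDeriv_spec hu (by omega)).hasWeakDy (weakDeriv_spec hu hij)

/-! ### Traces on vertical segments -/

/-- The integral of `k F` over the vertical segment `{x} × (0,1)`. -/
noncomputable def sliceIntegral (k : ℝ → ℝ) (F : ℝ × ℝ → ℝ) (x : ℝ) : ℝ :=
  ∫ y in Ioo (0 : ℝ) 1, k y * F (x, y)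

/-- For `z = ∂_x w`, the trace of `w` on the segment `{t} × (0,1)` as a function of `y`. The kernel
makes it depend only on the almost everywhere classes of `w` and `z`. -/
noncomputable def traceAt (w z : ℝ × ℝ → ℝ) (t y : ℝ) : ℝ :=
  ∫ x in Ioo (0 : ℝ) 1, (w (x, y) + traceKernel t x * z (x, y))

section Slices

variable {w z F : ℝ × ℝ → ℝ} {k l : ℝ → ℝ}

theorem integrable_mul_mul (hF : Integrable F muOmega) (hk : IsWeight k) (hl : IsWeight l) :
    Integrable (fun p => k p.2 * (F p * l p.1)) muOmega :=
  (hk.comp measurable_snd).integrable_mul ((hl.comp measurable_fst).integrable_mul' hF)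

theorem integrableOn_sliceIntegral (hF : Integrable F muOmega) (hk : IsWeight k) :
    IntegrableOn (sliceIntegral k F) (Ioo 0 1) := by
  have hkF := (hk.comp measurable_snd).integrable_mul hF
  rw [muOmega_eq_prod] at hkF
  exact hkF.integral_prod_left

theorem integral_mul_mul_eq_integral_sliceIntegral (hF : Integrable F muOmega) (hk : IsWeight k)
    (hl : IsWeight l) :
    ∫ p, k p.2 * (F p * l p.1) ∂muOmega = ∫ x in Ioo (0 : ℝ) 1, sliceIntegral k F x * l x := by
  rw [integral_muOmega (integrable_mul_mul hF hk hl)]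
  simp only [sliceIntegral, ← mul_assoc, integral_mul_const]

theorem integral_mul_deriv_add_eq_integral_sliceIntegral {p q : ℝ → ℝ} (hw : Integrable w muOmega)
    (hz : Integrable z muOmega) (hk : IsWeight k) (hp : IsWeight p) (hq : IsWeight q) :
    ∫ r, k r.2 * (w r * q r.1 + z r * p r.1) ∂muOmega =
      ∫ x in Ioo (0 : ℝ) 1, (sliceIntegral k w x * q x + sliceIntegral k z x * p x) := by
  simp only [mul_add]
  rw [integral_add (integrable_mul_mul hw hk hq) (integrable_mul_mul hz hk hp),
    integral_mul_mul_eq_integral_sliceIntegral hw hk hq,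
    integral_mul_mul_eq_integral_sliceIntegral hz hk hp,
    integral_add (hq.integrable_mul' (integrableOn_sliceIntegral hw hk))
      (hp.integrable_mul' (integrableOn_sliceIntegral hz hk))]

theorem integrable_add_traceKernel_mul (hw : Integrable w muOmega) (hz : Integrable z muOmega)
    (t : ℝ) : Integrable (fun p => w p + traceKernel t p.1 * z p) muOmega :=
  hw.add (((isWeight_traceKernel t).comp measurable_fst).integrable_mul hz)

theorem integrableOn_traceAt (hw : Integrable w muOmega) (hz : Integrable z muOmega) (t : ℝ) :
    IntegrableOn (traceAt w z t) (Ioo 0 1) := by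
  have h := integrable_add_traceKernel_mul hw hz t
  rw [muOmega_eq_prod] at h
  exact h.integral_prod_right

theorem integral_mul_traceAt (hw : Integrable w muOmega) (hz : Integrable z muOmega)
    (hk : IsWeight k) (t : ℝ) :
    ∫ y in Ioo (0 : ℝ) 1, k y * traceAt w z t y =
      ∫ p, k p.2 * (w p + traceKernel t p.1 * z p) ∂muOmega := by
  rw [integral_muOmega_symm
    ((hk.comp measurable_snd).integrable_mul (integrable_add_traceKernel_mul hw hz t))]
  simp only [integral_const_mul, traceAt]

theorem HasWeakDx.exists_primitive (h : HasWeakDx w z) (hk : IsWeight k) :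
    ∃ c : ℝ,
      (∀ᵐ x ∂volume.restrict (Ioo 0 1),
        sliceIntegral k w x = c + ∫ s in (0 : ℝ)..x, sliceIntegral k z s) ∧
      ∀ t ∈ Icc (0 : ℝ) 1, ∫ y in Ioo (0 : ℝ) 1, k y * traceAt w z t y =
        c + ∫ s in (0 : ℝ)..t, sliceIntegral k z s := by
  have hW := integrableOn_sliceIntegral h.integrable hk
  have hZ := integrableOn_sliceIntegral h.integrable_deriv hk
  obtain ⟨c, hc⟩ := ae_eq_primitive_of_weak_deriv zero_lt_one hW hZ fun ψ hψ => by
    rw [← integral_mul_deriv_add_eq_integral_sliceIntegral h.integrable h.integrable_deriv hk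
      hψ.isWeight hψ.deriv.isWeight]
    exact h.integral_weight hk hψ
  refine ⟨c, hc, fun t ht => ?_⟩
  rw [← integral_add_traceKernel_mul hW hZ ht hc,
    integral_mul_traceAt h.integrable h.integrable_deriv hk]
  have hslices := integral_mul_deriv_add_eq_integral_sliceIntegral h.integrable h.integrable_deriv
    hk (isWeight_traceKernel t) (IsWeight.const 1)
  simpa only [mul_one, mul_comm (traceKernel t _)] using hslices

end Slices

/-! ### Integration by parts on rectangles -/

section Rectangles

variable {a b c d : ℝ}

theorem restrict_Icc_prod_Icc (a b c d : ℝ) :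
    (volume : Measure (ℝ × ℝ)).restrict (Icc a b ×ˢ Icc c d) =
      volume.restrict (Ioo a b ×ˢ Ioo c d) := by
  rw [Measure.volume_eq_prod, ← Measure.prod_restrict, ← Measure.prod_restrict,
    Measure.restrict_congr_set Ioo_ae_eq_Icc, Measure.restrict_congr_set Ioo_ae_eq_Icc]

theorem setIntegral_Icc_prod_Icc (ha : 0 ≤ a) (hb : b ≤ 1) (hc : 0 ≤ c) (hd : d ≤ 1)
    (F : ℝ × ℝ → ℝ) :
    ∫ q in Icc a b ×ˢ Icc c d, F q = ∫ q, (Ioo a b ×ˢ Ioo c d).indicator F q ∂muOmega := by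
  rw [restrict_Icc_prod_Icc, muOmega,
    setIntegral_indicator (measurableSet_Ioo.prod measurableSet_Ioo), inter_eq_right.2]
  exact prod_mono (Ioo_subset_Ioo ha hb) (Ioo_subset_Ioo hc hd)

theorem setIntegral_Ioo_indicator_mul (ha : 0 ≤ a) (hab : a ≤ b) (hb : b ≤ 1) (f g : ℝ → ℝ) :
    ∫ x in Ioo (0 : ℝ) 1, (Ioo a b).indicator f x * g x = ∫ x in a..b, f x * g x := by
  simp only [← indicator_mul_left]
  rw [setIntegral_indicator measurableSet_Ioo, inter_eq_right.2 (Ioo_subset_Ioo ha hb),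
    intervalIntegral.integral_of_le hab, integral_Ioc_eq_integral_Ioo]

theorem HasWeakDx.integral_rect {w z : ℝ × ℝ → ℝ} {k p : ℝ → ℝ} (h : HasWeakDx w z)
    (hk : IsWeight k) (hp : ContDiff ℝ 1 p) (ha : 0 ≤ a) (hab : a ≤ b) (hb : b ≤ 1) (hc : 0 ≤ c)
    (hcd : c ≤ d) (hd : d ≤ 1) :
    ∫ q in Icc a b ×ˢ Icc c d, k q.2 * (w q * deriv p q.1 + z q * p q.1) =
      (∫ y in c..d, k y * traceAt w z b y) * p b - (∫ y in c..d, k y * traceAt w z a y) * p a := by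
  set κ := (Ioo c d).indicator k
  have hκ : IsWeight κ := hk.indicator measurableSet_Ioo
  obtain ⟨e, he, htrace⟩ := h.exists_primitive hκ
  have hedge {t : ℝ} (ht : t ∈ Icc (0 : ℝ) 1) : ∫ y in c..d, k y * traceAt w z t y =
      e + ∫ s in (0 : ℝ)..t, sliceIntegral κ z s := by
    rw [← htrace t ht, setIntegral_Ioo_indicator_mul hc hcd hd]
  have hZ : IntervalIntegrable (sliceIntegral κ z) volume 0 1 := by
    rw [intervalIntegrable_iff_integrableOn_Ioo_of_le zero_le_one]
    exact integrableOn_sliceIntegral h.integrable_deriv hκ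
  have ha1 : a ∈ Icc (0 : ℝ) 1 := ⟨ha, hab.trans hb⟩
  have hb1 : b ∈ Icc (0 : ℝ) 1 := ⟨ha.trans hab, hb⟩
  have hIcc : uIcc (0 : ℝ) 1 = Icc 0 1 := uIcc_of_le zero_le_one
  have hparts := integral_primitive_mul_deriv_add e hZ (hIcc ▸ ha1) (hIcc ▸ hb1) hp
  rw [hedge hb1, hedge ha1, ← hparts, setIntegral_Icc_prod_Icc ha hb hc hd]
  calc ∫ q, (Ioo a b ×ˢ Ioo c d).indicator
          (fun q => k q.2 * (w q * deriv p q.1 + z q * p q.1)) q ∂muOmega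
      = ∫ q, κ q.2 * (w q * (Ioo a b).indicator (deriv p) q.1 +
          z q * (Ioo a b).indicator p q.1) ∂muOmega := by
        refine integral_congr_ae (Eventually.of_forall fun q => ?_)
        by_cases h1 : q.1 ∈ Ioo a b <;> by_cases h2 : q.2 ∈ Ioo c d <;>
          simp [indicator, mem_prod, h1, h2, κ]
    _ = ∫ x in Ioo (0 : ℝ) 1, (sliceIntegral κ w x * (Ioo a b).indicator (deriv p) x +
          sliceIntegral κ z x * (Ioo a b).indicator p x) :=
        integral_mul_deriv_add_eq_integral_sliceIntegral h.integrable h.integrable_deriv hκ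
          (.indicator_Ioo_of_continuous hp.continuous a b)
          (.indicator_Ioo_of_continuous (hp.continuous_deriv le_rfl) a b)
    _ = ∫ x in Ioo (0 : ℝ) 1, (Ioo a b).indicator 1 x * ((e + ∫ s in (0 : ℝ)..x,
          sliceIntegral κ z s) * deriv p x + sliceIntegral κ z x * p x) := by
        refine integral_congr_ae (he.mono fun x hx => ?_)
        by_cases h1 : x ∈ Ioo a b <;> simp [h1, hx]
    _ = ∫ x in a..b, ((e + ∫ s in (0 : ℝ)..x, sliceIntegral κ z s) * deriv p x +
          sliceIntegral κ z x * p x) := by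
        simpa only [Pi.one_apply, one_mul] using setIntegral_Ioo_indicator_mul ha hab hb 1 _

end Rectangles

/-! ### Traces as limits of smooth functions -/

theorem tendsto_integral_weight_mul {α : Type*} [MeasurableSpace α] {μ : Measure α}
    [IsFiniteMeasure μ] {F : ℕ → α → ℝ} {f k : α → ℝ} (hk : IsWeight k)
    (hF : ∀ i, Integrable (F i) μ) (hf : Integrable f μ)
    (h : Tendsto (fun i => eLpNorm (F i - f) 2 μ) atTop (𝓝 0)) :
    Tendsto (fun i => ∫ p, k p * F i p ∂μ) atTop (𝓝 (∫ p, k p * f p ∂μ)) := by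
  obtain ⟨C, hC⟩ := hk.2
  set r : ℝ := 1 / (1 : ENNReal).toReal - 1 / (2 : ENNReal).toReal
  refine tendsto_integral_of_L1' _ (hk.integrable_mul hf).aestronglyMeasurable
    (Eventually.of_forall fun i => hk.integrable_mul (hF i)) ?_
  have hbound (i : ℕ) : eLpNorm ((fun p => k p * F i p) - fun p => k p * f p) 1 μ ≤
      ENNReal.ofReal C * (eLpNorm (F i - f) 2 μ * μ univ ^ r) := by
    refine (eLpNorm_le_mul_eLpNorm_of_ae_le_mul (g := F i - f) (c := C)
      (Eventually.of_forall fun p => ?_) 1).trans ?_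
    · simp only [Pi.sub_apply, ← mul_sub, norm_mul]
      exact mul_le_mul_of_nonneg_right (hC p) (norm_nonneg _)
    · gcongr
      exact eLpNorm_le_eLpNorm_mul_rpow_measure_univ one_le_two
        ((hF i).sub hf).aestronglyMeasurable
  have hμ : μ univ ^ r ≠ ⊤ := ENNReal.rpow_ne_top_of_nonneg (by norm_num [r]) (measure_ne_top _ _)
  have hlim := ENNReal.Tendsto.const_mul (a := ENNReal.ofReal C)
    (ENNReal.Tendsto.mul_const h (Or.inr hμ)) (Or.inr ENNReal.ofReal_ne_top)
  rw [zero_mul, mul_zero] at hlim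
  exact tendsto_of_tendsto_of_tendsto_of_le_of_le tendsto_const_nhds hlim (fun _ => zero_le)
    hbound

theorem integrable_muOmega_of_continuous {φ : ℝ × ℝ → ℝ} (h : Continuous φ) :
    Integrable φ muOmega := by
  have hφ : IntegrableOn φ (Icc 0 1 ×ˢ Icc 0 1) :=
    h.continuousOn.integrableOn_compact (isCompact_Icc.prod isCompact_Icc)
  exact hφ.mono_set (prod_mono Ioo_subset_Icc_self Ioo_subset_Icc_self)

theorem traceAt_of_contDiff {φ : ℝ × ℝ → ℝ} (h : ContDiff ℝ ∞ φ) {t : ℝ}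
    (ht : t ∈ Icc (0 : ℝ) 1) (y : ℝ) : traceAt φ (dx φ) t y = φ (t, y) := by
  have hline {f : ℝ × ℝ → ℝ} (hf : Continuous f) : Continuous fun s => f (s, y) := by fun_prop
  have hint {f : ℝ × ℝ → ℝ} (hf : Continuous f) : IntegrableOn (fun s => f (s, y)) (Ioo 0 1) :=
    (hline hf).integrableOn_Icc.mono_set Ioo_subset_Icc_self
  have hd := (contDiff_dx h).continuous
  have hFTC (x : ℝ) : φ (x, y) = φ (0, y) + ∫ s in (0 : ℝ)..x, dx φ (s, y) := by
    rw [intervalIntegral.integral_eq_sub_of_hasDerivAt (f := fun s => φ (s, y))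
      (fun s _ => hasDerivAt_fst (h.differentiable (by simp)) s y)
      ((hline hd).intervalIntegrable _ _)]
    ring
  rw [hFTC t]
  exact integral_add_traceKernel_mul (hint h.continuous) (hint hd) ht (Eventually.of_forall hFTC)

section TraceLimits

variable {w z : ℝ × ℝ → ℝ} {t : ℝ} {τ : ℝ → ℝ}

theorem integral_weight_mul_add_traceKernel (hw : Integrable w muOmega) (hz : Integrable z muOmega)
    {k : ℝ → ℝ} (hk : IsWeight k) (t : ℝ) :
    ∫ p, k p.2 * (w p + traceKernel t p.1 * z p) ∂muOmega =
      ∫ p, k p.2 * w p ∂muOmega + ∫ p, k p.2 * traceKernel t p.1 * z p ∂muOmega := by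
  have hk' := hk.comp (measurable_snd (α := ℝ))
  rw [← integral_add (hk'.integrable_mul hw)
    ((hk'.mul ((isWeight_traceKernel t).comp measurable_fst)).integrable_mul hz)]
  simp only [mul_add, mul_assoc]

theorem ae_eq_traceAt_of_tendsto (hw : Integrable w muOmega) (hz : Integrable z muOmega)
    {φ : ℕ → ℝ × ℝ → ℝ} (hφ : ∀ i, ContDiff ℝ ∞ (φ i))
    (hφw : Tendsto (fun i => eLpNorm (φ i - w) 2 muOmega) atTop (𝓝 0))
    (hφz : Tendsto (fun i => eLpNorm (dx (φ i) - z) 2 muOmega) atTop (𝓝 0))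
    (ht : t ∈ Icc (0 : ℝ) 1) (hτ : IntegrableOn τ (Ioo 0 1))
    (hφτ : Tendsto (fun i => eLpNorm (fun y => φ i (t, y) - τ y) 2 (volume.restrict (Ioo 0 1)))
      atTop (𝓝 0)) :
    τ =ᵐ[volume.restrict (Ioo 0 1)] traceAt w z t := by
  have hT := integrableOn_traceAt hw hz t
  refine (ae_eq_zero_of_integral_test_mul_eq_zero isOpen_Ioo (hτ.sub hT) fun η hη => ?_).mono
    fun y hy => sub_eq_zero.1 hy
  have hk := hη.isWeight.comp (measurable_snd (α := ℝ))
  have hφi (i : ℕ) := integrable_muOmega_of_continuous (hφ i).continuous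
  have hdφi (i : ℕ) := integrable_muOmega_of_continuous (contDiff_dx (hφ i)).continuous
  have hlim := (tendsto_integral_weight_mul hk hφi hw hφw).add (tendsto_integral_weight_mul
    (hk.mul ((isWeight_traceKernel t).comp measurable_fst)) hdφi hz hφz)
  have hlimτ := tendsto_integral_weight_mul (F := fun i y => φ i (t, y)) hη.isWeight (fun i =>
    (((hφ i).continuous.comp (Continuous.prodMk_right t)).integrableOn_Icc).mono_set
      Ioo_subset_Icc_self) hτ hφτ
  simp only [Pi.sub_apply, mul_sub]
  rw [integral_sub (hη.isWeight.integrable_mul hτ) (hη.isWeight.integrable_mul hT), sub_eq_zero,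
    integral_mul_traceAt hw hz hη.isWeight, integral_weight_mul_add_traceKernel hw hz hη.isWeight]
  refine tendsto_nhds_unique hlimτ (hlim.congr fun i => ?_)
  rw [← integral_weight_mul_add_traceKernel (hφi i) (hdφi i) hη.isWeight,
    ← integral_mul_traceAt (hφi i) (hdφi i) hη.isWeight]
  simp only [traceAt_of_contDiff (hφ i) ht]

theorem IsWeakDeriv.ae_eq_weakDeriv {i j : ℕ} {u v : ℝ × ℝ → ℝ} (h : IsWeakDeriv i j u v) :
    weakDeriv i j u =ᵐ[muOmega] v := by
  have hex : ∃ v, IsWeakDeriv i j u v := ⟨v, h⟩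
  rw [weakDeriv, dif_pos hex]
  exact hex.choose_spec.ae_eq h

theorem HasWeakDx.ae_eq_traceAt (h : HasWeakDx w z) (ht : t ∈ Icc (0 : ℝ) 1)
    (hτ : IsTraceV w t τ) : τ =ᵐ[volume.restrict (Ioo 0 1)] traceAt w z t := by
  obtain ⟨hτ2, φ, ⟨hφ, hφw, hφx, -⟩, hφτ⟩ := hτ
  refine ae_eq_traceAt_of_tendsto h.integrable h.integrable_deriv hφ hφw ?_ ht
    (hτ2.integrable one_le_two) hφτ
  exact hφx.congr fun i => eLpNorm_congr_ae ((ae_eq_refl _).sub h.isWeakDeriv.ae_eq_weakDeriv)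

theorem HasWeakDy.ae_eq_traceAt (h : HasWeakDy w z) (ht : t ∈ Icc (0 : ℝ) 1)
    (hτ : IsTraceH w t τ) :
    τ =ᵐ[volume.restrict (Ioo 0 1)] traceAt (fun p => w p.swap) (fun p => z p.swap) t := by
  obtain ⟨hτ2, φ, ⟨hφ, hφw, -, hφy⟩, hφτ⟩ := hτ
  have hnorm {F f : ℝ × ℝ → ℝ} (hF : Continuous F) (hf : MemLp f 2 muOmega) :
      eLpNorm ((fun p => F p.swap) - fun p => f p.swap) 2 muOmega = eLpNorm (F - f) 2 muOmega :=
    eLpNorm_comp_measurePreserving (g := F - f)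
      ((integrable_muOmega_of_continuous hF).aestronglyMeasurable.sub hf.aestronglyMeasurable)
      measurePreserving_swap_muOmega
  refine ae_eq_traceAt_of_tendsto (φ := fun i p => φ i p.swap) h.swap.integrable
    h.swap.integrable_deriv (fun i => (hφ i).comp (contDiff_snd.prodMk contDiff_fst)) ?_ ?_ ht
    (hτ2.integrable one_le_two) hφτ
  · exact hφw.congr fun i => (hnorm (hφ i).continuous h.memLp).symm
  · refine hφy.congr fun i => ?_
    rw [funext (dx_comp_swap ((hφ i).differentiable (by simp))),
      hnorm (contDiff_dy (hφ i)).continuous h.memLp_deriv]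
    exact eLpNorm_congr_ae ((ae_eq_refl _).sub h.isWeakDeriv.ae_eq_weakDeriv)

theorem HasWeakDy.integral_deriv_mul_traceAt {wy zy : ℝ × ℝ → ℝ} (hw : HasWeakDy w wy)
    (hz : HasWeakDy z zy) {ψ : ℝ → ℝ} (hψ : IsTestOn (Ioo 0 1) ψ) (t : ℝ) :
    ∫ y in Ioo (0 : ℝ) 1, deriv ψ y * traceAt w z t y =
      -∫ y in Ioo (0 : ℝ) 1, ψ y * traceAt wy zy t y := by
  have hwi := hw.memLp.integrable one_le_two
  have hzi := hz.memLp.integrable one_le_two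
  have hwyi := hw.memLp_deriv.integrable one_le_two
  have hzyi := hz.memLp_deriv.integrable one_le_two
  have hψ' := hψ.isWeight.comp (measurable_snd (α := ℝ))
  have hdψ' := hψ.deriv.isWeight.comp (measurable_snd (α := ℝ))
  have hint {f g : ℝ × ℝ → ℝ} (hf : Integrable f muOmega) (hg : Integrable g muOmega) :
      Integrable (fun p => f p * deriv ψ p.2 + g p * ψ p.2) muOmega :=
    (hdψ'.integrable_mul' hf).add (hψ'.integrable_mul' hg)
  rw [eq_neg_iff_add_eq_zero, integral_mul_traceAt hwi hzi hψ.deriv.isWeight,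
    integral_mul_traceAt hwyi hzyi hψ.isWeight, ← integral_add
      (hdψ'.integrable_mul (integrable_add_traceKernel_mul hwi hzi t))
      (hψ'.integrable_mul (integrable_add_traceKernel_mul hwyi hzyi t))]
  calc ∫ p, (deriv ψ p.2 * (w p + traceKernel t p.1 * z p) +
          ψ p.2 * (wy p + traceKernel t p.1 * zy p)) ∂muOmega
      = ∫ p, (1 * (w p * deriv ψ p.2 + wy p * ψ p.2) +
          traceKernel t p.1 * (z p * deriv ψ p.2 + zy p * ψ p.2)) ∂muOmega := by
        congr 1
        funext p
        ring
    _ = 0 := by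
        rw [integral_add (((IsWeight.const 1).integrable_mul (hint hwi hwyi)))
          (((isWeight_traceKernel t).comp measurable_fst).integrable_mul (hint hzi hzyi)),
          hw.integral_weight (IsWeight.const 1) hψ, hz.integral_weight (isWeight_traceKernel t) hψ,
          add_zero]

theorem IsWeakSecondDeriv.ae_eq_traceAt {wx wy wxy wyy wxyy : ℝ × ℝ → ℝ} {G : ℝ → ℝ}
    (hG : IsWeakSecondDeriv τ G) (hτ : τ =ᵐ[volume.restrict (Ioo 0 1)] traceAt w wx t)
    (hw : HasWeakDy w wy) (hwy : HasWeakDy wy wyy) (hwx : HasWeakDy wx wxy)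
    (hwxy : HasWeakDy wxy wxyy) : G =ᵐ[volume.restrict (Ioo 0 1)] traceAt wyy wxyy t := by
  have hGi : IntegrableOn G (Ioo 0 1) := hG.1.integrable one_le_two
  have hT := integrableOn_traceAt (hwy.memLp_deriv.integrable one_le_two)
    (hwxy.memLp_deriv.integrable one_le_two) t
  refine (ae_eq_zero_of_integral_test_mul_eq_zero isOpen_Ioo (hGi.sub hT) fun ψ hψ => ?_).mono
    fun y hy => sub_eq_zero.1 hy
  simp only [Pi.sub_apply, mul_sub]
  rw [integral_sub (hψ.isWeight.integrable_mul hGi) (hψ.isWeight.integrable_mul hT), sub_eq_zero]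
  calc ∫ y in Ioo (0 : ℝ) 1, ψ y * G y
      = ∫ y in Ioo (0 : ℝ) 1, τ y * iteratedDeriv 2 ψ y := by
        rw [hG.2 ψ hψ.1 hψ.2.1 hψ.2.2]
        simp only [mul_comm]
    _ = ∫ y in Ioo (0 : ℝ) 1, deriv (deriv ψ) y * traceAt w wx t y := by
        refine integral_congr_ae (hτ.mono fun y hy => ?_)
        simp only [hy, iteratedDeriv_succ, iteratedDeriv_zero, mul_comm]
    _ = ∫ y in Ioo (0 : ℝ) 1, ψ y * traceAt wyy wxyy t y := by
        rw [hw.integral_deriv_mul_traceAt hwx hψ.deriv, hwy.integral_deriv_mul_traceAt hwxy hψ,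
          neg_neg]

end TraceLimits

/-! ### Elements of a mesh -/

section Partitions

variable {n : ℕ} {x : Fin (n + 1) → ℝ}

theorem disjoint_Icc_Ioo_of_strictMono (hx : StrictMono x) {i k : Fin n} (h : i ≠ k) :
    Disjoint (Icc (x k.castSucc) (x k.succ)) (Ioo (x i.castSucc) (x i.succ)) := by
  rw [Set.disjoint_left]
  rintro t ⟨hkt, htk⟩ ⟨hit, hti⟩
  rcases lt_or_gt_of_ne h with hik | hki
  · linarith [hx.monotone (Fin.succ_le_castSucc_iff.2 hik)]
  · linarith [hx.monotone (Fin.succ_le_castSucc_iff.2 hki)]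

theorem pairwise_disjoint_Ioc_of_monotone (hx : Monotone x) :
    Pairwise (Function.onFun Disjoint fun i : Fin n => Ioc (x i.castSucc) (x i.succ)) := by
  refine (Std.Symm.pairwise_on _).2 fun i k hik => ?_
  exact Set.disjoint_left.2 fun t hi hk =>
    hi.2.not_gt ((hx (Fin.succ_le_castSucc_iff.2 hik)).trans_lt hk.1)

theorem iUnion_Ioc_of_monotone (hx : Monotone x) :
    ⋃ i : Fin n, Ioc (x i.castSucc) (x i.succ) = Ioc (x 0) (x (Fin.last n)) := by
  refine Subset.antisymm (iUnion_subset fun i =>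
    Ioc_subset_Ioc (hx (Fin.zero_le _)) (hx (Fin.le_last _))) fun t ht => ?_
  suffices h : ∀ k : Fin (n + 1), t ≤ x k → t ∈ ⋃ i : Fin n, Ioc (x i.castSucc) (x i.succ) from
    h _ ht.2
  intro k
  induction k using Fin.induction with
  | zero => exact fun h => absurd ht.1 h.not_gt
  | succ i ih =>
    intro h
    rcases le_or_gt t (x i.castSucc) with hi | hi
    · exact ih hi
    · exact mem_iUnion.2 ⟨i, hi, h⟩

end Partitions

variable {n m : ℕ}

namespace Mesh

theorem x_mem (M : Mesh n m) (i : Fin (n + 1)) : M.x i ∈ Icc (0 : ℝ) 1 :=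
  ⟨M.x_zero ▸ M.x_strictMono.monotone (Fin.zero_le i),
    M.x_last ▸ M.x_strictMono.monotone (Fin.le_last i)⟩

theorem y_mem (M : Mesh n m) (j : Fin (m + 1)) : M.y j ∈ Icc (0 : ℝ) 1 :=
  ⟨M.y_zero ▸ M.y_strictMono.monotone (Fin.zero_le j),
    M.y_last ▸ M.y_strictMono.monotone (Fin.le_last j)⟩

theorem x_lt (M : Mesh n m) (i : Fin n) : M.x i.castSucc < M.x i.succ :=
  M.x_strictMono Fin.castSucc_lt_succ

theorem y_lt (M : Mesh n m) (j : Fin m) : M.y j.castSucc < M.y j.succ :=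
  M.y_strictMono Fin.castSucc_lt_succ

theorem Ioo_x_subset (M : Mesh n m) (i : Fin n) :
    Ioo (M.x i.castSucc) (M.x i.succ) ⊆ Ioo 0 1 :=
  Ioo_subset_Ioo (M.x_mem _).1 (M.x_mem _).2

theorem Ioo_y_subset (M : Mesh n m) (j : Fin m) :
    Ioo (M.y j.castSucc) (M.y j.succ) ⊆ Ioo 0 1 :=
  Ioo_subset_Ioo (M.y_mem _).1 (M.y_mem _).2

/-- The mesh with the two coordinates exchanged. The method is symmetric under this
exchange, so that an estimate in one coordinate direction yields the one in the other. -/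
def swap (M : Mesh n m) : Mesh m n :=
  ⟨M.y, M.x, M.y_strictMono, M.x_strictMono, M.y_zero, M.y_last, M.x_zero, M.x_last⟩

/-- The interior of the element `T_{ij}`. -/
def openElem (M : Mesh n m) (i : Fin n) (j : Fin m) : Set (ℝ × ℝ) :=
  Ioo (M.x i.castSucc) (M.x i.succ) ×ˢ Ioo (M.y j.castSucc) (M.y j.succ)

theorem isOpen_openElem (M : Mesh n m) (i : Fin n) (j : Fin m) : IsOpen (M.openElem i j) :=
  isOpen_Ioo.prod isOpen_Ioo

theorem openElem_subset (M : Mesh n m) (i : Fin n) (j : Fin m) : M.openElem i j ⊆ Omega :=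
  prod_mono (M.Ioo_x_subset i) (M.Ioo_y_subset j)

theorem eq_of_mem_elem_of_mem_openElem (M : Mesh n m) {i k : Fin n} {j l : Fin m} {p : ℝ × ℝ}
    (h : p ∈ M.elem k l) (h' : p ∈ M.openElem i j) : i = k ∧ j = l :=
  ⟨by_contra fun hik => Set.disjoint_left.1
      (disjoint_Icc_Ioo_of_strictMono M.x_strictMono hik) h.1 h'.1,
    by_contra fun hjl => Set.disjoint_left.1
      (disjoint_Icc_Ioo_of_strictMono M.y_strictMono hjl) h.2 h'.2⟩

theorem measurableSet_elem (M : Mesh n m) (i : Fin n) (j : Fin m) : MeasurableSet (M.elem i j) :=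
  measurableSet_Icc.prod measurableSet_Icc

theorem restrict_elem_eq_restrict_openElem (M : Mesh n m) (i : Fin n) (j : Fin m) :
    volume.restrict (M.elem i j) = volume.restrict (M.openElem i j) :=
  restrict_Icc_prod_Icc _ _ _ _

theorem restrict_elem_le (M : Mesh n m) (i : Fin n) (j : Fin m) :
    volume.restrict (M.elem i j) ≤ muOmega := by
  rw [M.restrict_elem_eq_restrict_openElem]
  exact Measure.restrict_mono (M.openElem_subset i j) le_rfl

theorem setIntegral_elem_swap (M : Mesh n m) (i : Fin n) (j : Fin m) (F : ℝ × ℝ → ℝ) :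
    ∫ p in M.swap.elem j i, F p.swap = ∫ p in M.elem i j, F p := by
  rw [elem, elem, Measure.volume_eq_prod]
  exact setIntegral_prod_swap (Icc (M.x i.castSucc) (M.x i.succ))
    (Icc (M.y j.castSucc) (M.y j.succ)) F

theorem sum_setIntegral_elem (M : Mesh n m) {F : ℝ × ℝ → ℝ} (hF : Integrable F muOmega) :
    ∑ i, ∑ j, ∫ p in M.elem i j, F p = ∫ p, F p ∂muOmega := by
  let box (T : Fin n × Fin m) : Set (ℝ × ℝ) :=
    Ioc (M.x T.1.castSucc) (M.x T.1.succ) ×ˢ Ioc (M.y T.2.castSucc) (M.y T.2.succ)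
  have restrict_Ioc (a b c d : ℝ) :
      (volume : Measure (ℝ × ℝ)).restrict (Ioc a b ×ˢ Ioc c d) =
        volume.restrict (Ioo a b ×ˢ Ioo c d) :=
    Measure.restrict_congr_set (Measure.set_prod_ae_eq Ioo_ae_eq_Ioc.symm Ioo_ae_eq_Ioc.symm)
  have box_disjoint : Pairwise (Function.onFun Disjoint box) := by
    intro S T hST
    by_cases h : S.1 = T.1
    · exact Disjoint.set_prod_right (pairwise_disjoint_Ioc_of_monotone M.y_strictMono.monotone
        fun h' => hST (Prod.ext h h')) _ _
    · exact Disjoint.set_prod_left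
        (pairwise_disjoint_Ioc_of_monotone M.x_strictMono.monotone h) _ _
  have iUnion_box : ⋃ T, box T = Ioc 0 1 ×ˢ Ioc 0 1 := by
    have hx := iUnion_Ioc_of_monotone M.x_strictMono.monotone
    have hy := iUnion_Ioc_of_monotone M.y_strictMono.monotone
    rw [M.x_zero, M.x_last] at hx
    rw [M.y_zero, M.y_last] at hy
    exact (iUnion_prod _ _).trans (congrArg₂ _ hx hy)
  calc ∑ i, ∑ j, ∫ p in M.elem i j, F p
      = ∑ T : Fin n × Fin m, ∫ p in box T, F p := by
        simp only [Fintype.sum_prod_type, box, restrict_Ioc,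
          restrict_elem_eq_restrict_openElem, openElem]
    _ = ∫ p in ⋃ T, box T, F p := by
        refine (integral_iUnion_fintype (fun T => measurableSet_Ioc.prod measurableSet_Ioc)
          box_disjoint fun T => ?_).symm
        rw [IntegrableOn, restrict_Ioc, ← openElem, ← restrict_elem_eq_restrict_openElem]
        exact hF.mono_measure (M.restrict_elem_le T.1 T.2)
    _ = ∫ p, F p ∂muOmega := by rw [iUnion_box, restrict_Ioc, muOmega, Omega]

end Mesh

/-! ### Continuity of the normal flux -/

theorem dx_eq_zero_of_notMem_tsupport {φ : ℝ × ℝ → ℝ} {p : ℝ × ℝ} (hp : p ∉ tsupport φ) :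
    dx φ p = 0 :=
  image_eq_zero_of_notMem_tsupport fun h => hp (tsupport_fderiv_apply_subset ℝ _ h)

theorem dy_eq_zero_of_notMem_tsupport {φ : ℝ × ℝ → ℝ} {p : ℝ × ℝ} (hp : p ∉ tsupport φ) :
    dy φ p = 0 :=
  image_eq_zero_of_notMem_tsupport fun h => hp (tsupport_fderiv_apply_subset ℝ _ h)

section Elements

variable {w z : ℝ × ℝ → ℝ} {k p : ℝ → ℝ}

theorem HasWeakDx.integral_elem (h : HasWeakDx w z) (hk : IsWeight k) (hp : ContDiff ℝ 1 p)
    (M : Mesh n m) (i : Fin n) (j : Fin m) :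
    ∫ q in M.elem i j, k q.2 * (w q * deriv p q.1 + z q * p q.1) =
      (∫ y in M.y j.castSucc..M.y j.succ, k y * traceAt w z (M.x i.succ) y) * p (M.x i.succ) -
      (∫ y in M.y j.castSucc..M.y j.succ, k y * traceAt w z (M.x i.castSucc) y) *
        p (M.x i.castSucc) :=
  h.integral_rect hk hp (M.x_mem _).1 (M.x_lt i).le (M.x_mem _).2 (M.y_mem _).1 (M.y_lt j).le
    (M.y_mem _).2

theorem HasWeakDy.integral_elem_eq_zero (h : HasWeakDy w z) (hk : IsWeight k)
    (hp : ContDiff ℝ 1 p) {M : Mesh n m} {j : Fin m} (h0 : p (M.y j.castSucc) = 0)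
    (h1 : p (M.y j.succ) = 0) (i : Fin n) :
    ∫ q in M.elem i j, k q.1 * (w q * deriv p q.2 + z q * p q.2) = 0 := by
  rw [← M.setIntegral_elem_swap]
  refine (h.swap.integral_elem hk hp M.swap j i).trans ?_
  change _ * p (M.y j.succ) - _ * p (M.y j.castSucc) = 0
  rw [h0, h1, mul_zero, mul_zero, sub_zero]

end Elements

/-- The weak form of `-∂_x (a11 wx) - ∂_y (a22 wy) = f`. -/
def IsFlux (M : Mesh n m) (a11 a22 : Fin n → Fin m → ℝ) (f wx wy : ℝ × ℝ → ℝ) : Prop :=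
  ∀ φ, IsTest φ → ∑ i, ∑ j, ∫ p in M.elem i j,
    (a11 i j * wx p * dx φ p + a22 i j * wy p * dy φ p) = ∫ p, f p * φ p ∂muOmega

section Equation

variable {M : Mesh n m} {a11 a22 : Fin n → Fin m → ℝ} {f wx wy wxx wyy : ℝ × ℝ → ℝ}

theorem IsFlux.swap (h : IsFlux M a11 a22 f wx wy) :
    IsFlux M.swap (fun j i => a22 i j) (fun j i => a11 i j) (fun p => f p.swap)
      (fun p => wy p.swap) (fun p => wx p.swap) := by
  intro φ hφ
  have e := h _ hφ.comp_swap
  rw [Finset.sum_comm] at e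
  refine Eq.trans ?_ (e.trans (integral_comp_swap_muOmega fun p => f p * φ p.swap).symm)
  refine Finset.sum_congr rfl fun j _ => Finset.sum_congr rfl fun i _ => ?_
  rw [← M.setIntegral_elem_swap]
  refine setIntegral_congr_fun (M.swap.measurableSet_elem j i) fun p _ => ?_
  simp only [dx_comp_swap hφ.differentiable, dy_comp_swap hφ.differentiable, Prod.swap_swap]
  ring

theorem IsFlux.integral_eq_of_isTestOn_openElem (h : IsFlux M a11 a22 f wx wy)
    (hwx : Integrable wx muOmega) (hwy : Integrable wy muOmega) {i : Fin n} {j : Fin m}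
    {φ : ℝ × ℝ → ℝ} (hφ : IsTestOn (M.openElem i j) φ) :
    a11 i j * ∫ p, wx p * dx φ p ∂muOmega + a22 i j * ∫ p, wy p * dy φ p ∂muOmega =
      ∫ p, f p * φ p ∂muOmega := by
  have hφ' : IsTest φ := hφ.mono (M.openElem_subset i j)
  have hx := (hφ'.dx.isWeight.integrable_mul' hwx).const_mul (a11 i j)
  have hy := (hφ'.dy.isWeight.integrable_mul' hwy).const_mul (a22 i j)
  rw [← h φ hφ', ← integral_const_mul, ← integral_const_mul, ← integral_add hx hy]
  refine (M.sum_setIntegral_elem (hx.add hy)).symm.trans ?_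
  refine Finset.sum_congr rfl fun k _ => Finset.sum_congr rfl fun l _ =>
    setIntegral_congr_fun (M.measurableSet_elem k l) fun p hp => ?_
  by_cases hp' : p ∈ tsupport φ
  · obtain ⟨rfl, rfl⟩ := M.eq_of_mem_elem_of_mem_openElem hp (hφ.2.2 hp')
    simp only [Pi.add_apply, mul_assoc]
  · simp only [Pi.add_apply, dx_eq_zero_of_notMem_tsupport hp', dy_eq_zero_of_notMem_tsupport hp',
      mul_zero]

theorem IsFlux.residual_ae_eq_zero (h : IsFlux M a11 a22 f wx wy) (hf : Integrable f muOmega)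
    (hx : HasWeakDx wx wxx) (hy : HasWeakDy wy wyy) (i : Fin n) (j : Fin m) :
    ∀ᵐ p ∂volume.restrict (M.elem i j), f p + a11 i j * wxx p + a22 i j * wyy p = 0 := by
  have hwxx := hx.integrable_deriv.const_mul (a11 i j)
  have hwyy := (hy.memLp_deriv.integrable one_le_two).const_mul (a22 i j)
  rw [M.restrict_elem_eq_restrict_openElem]
  refine ae_eq_zero_of_integral_test_mul_eq_zero (M.isOpen_openElem i j) (((hf.add hwxx).add
    hwyy).mono_measure (Measure.restrict_mono (M.openElem_subset i j) le_rfl)) fun φ hφ => ?_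
  have hφ' : IsTest φ := hφ.mono (M.openElem_subset i j)
  have weak := h.integral_eq_of_isTestOn_openElem hx.integrable (hy.memLp.integrable one_le_two) hφ
  rw [hx.integral_mul_dx φ hφ', hy.integral_mul_dy φ hφ'] at weak
  calc ∫ p in M.openElem i j, φ p * (f p + a11 i j * wxx p + a22 i j * wyy p)
      = ∫ p, φ p * (f p + a11 i j * wxx p + a22 i j * wyy p) ∂muOmega :=
        (setIntegral_eq_of_subset_of_forall_sdiff_eq_zero isOpen_Omega.measurableSet
          (M.openElem_subset i j) fun p hp => by rw [hφ.eq_zero hp.2, zero_mul]).symm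
    _ = ∫ p, f p * φ p ∂muOmega + a11 i j * ∫ p, wxx p * φ p ∂muOmega +
          a22 i j * ∫ p, wyy p * φ p ∂muOmega := by
        have hfφ := hφ'.isWeight.integrable_mul hf
        have hxφ := hφ'.isWeight.integrable_mul hwxx
        have hyφ := hφ'.isWeight.integrable_mul hwyy
        simp only [mul_add]
        refine (integral_add (hfφ.add hxφ) hyφ).trans ?_
        rw [integral_add' hfφ hxφ, ← integral_const_mul, ← integral_const_mul]
        simp only [mul_comm, mul_left_comm]
    _ = 0 := by linarith

theorem IsFlux.integral_elem_sub (h : IsFlux M a11 a22 f wx wy) (hf : Integrable f muOmega)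
    (hx : HasWeakDx wx wxx) (hy : HasWeakDy wy wyy) {ψ η : ℝ → ℝ} (hψ : IsTestOn (Ioo 0 1) ψ)
    (hη : IsTestOn (Ioo 0 1) η) (i : Fin n) {j : Fin m} (h0 : η (M.y j.castSucc) = 0)
    (h1 : η (M.y j.succ) = 0) :
    (∫ p in M.elem i j, (a11 i j * wx p * (deriv ψ p.1 * η p.2) +
        a22 i j * wy p * (ψ p.1 * deriv η p.2))) - ∫ p in M.elem i j, f p * (ψ p.1 * η p.2) =
      a11 i j * ((∫ y in M.y j.castSucc..M.y j.succ, η y * traceAt wx wxx (M.x i.succ) y) *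
        ψ (M.x i.succ) -
      (∫ y in M.y j.castSucc..M.y j.succ, η y * traceAt wx wxx (M.x i.castSucc) y) *
        ψ (M.x i.castSucc)) := by
  have integrable {F : ℝ × ℝ → ℝ} {k l : ℝ → ℝ} (hF : Integrable F muOmega) (hk : IsWeight k)
      (hl : IsWeight l) : IntegrableOn (fun p => F p * (k p.1 * l p.2)) (M.elem i j) :=
    (((hk.comp measurable_fst).mul (hl.comp measurable_snd)).integrable_mul' hF).mono_measure
      (M.restrict_elem_le i j)
  have hψ' := hψ.deriv.isWeight
  have hη' := hη.deriv.isWeight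
  have hwx := integrable hx.integrable hψ' hη.isWeight
  have hwxx := integrable hx.integrable_deriv hψ.isWeight hη.isWeight
  have hwy := integrable (hy.memLp.integrable one_le_two) hψ.isWeight hη'
  have hwyy := integrable (hy.memLp_deriv.integrable one_le_two) hψ.isWeight hη.isWeight
  have hfψ := integrable hf hψ.isWeight hη.isWeight
  calc _ = ∫ p in M.elem i j, (a11 i j * (η p.2 * (wx p * deriv ψ p.1 + wxx p * ψ p.1)) +
        a22 i j * (ψ p.1 * (wy p * deriv η p.2 + wyy p * η p.2))) := by
        rw [← integral_sub (by simpa only [mul_assoc] using!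
          (hwx.const_mul (a11 i j)).add (hwy.const_mul (a22 i j))) hfψ]
        refine integral_congr_ae ?_
        filter_upwards [h.residual_ae_eq_zero hf hx hy i j] with p hp
        linear_combination -(ψ p.1 * η p.2) * hp
    _ = a11 i j * (∫ p in M.elem i j, η p.2 * (wx p * deriv ψ p.1 + wxx p * ψ p.1)) +
          a22 i j * ∫ p in M.elem i j, ψ p.1 * (wy p * deriv η p.2 + wyy p * η p.2) := by
        rw [integral_add, integral_const_mul, integral_const_mul]
        · exact ((hwx.add hwxx).congr (Eventually.of_forall fun p => by
            simp only [Pi.add_apply]; ring)).const_mul _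
        · exact ((hwy.add hwyy).congr (Eventually.of_forall fun p => by
            simp only [Pi.add_apply]; ring)).const_mul _
    _ = _ := by
        rw [hx.integral_elem hη.isWeight (hψ.1.of_le (by norm_cast)) M i j,
          hy.integral_elem_eq_zero hψ.isWeight (hη.1.of_le (by norm_cast)) h0 h1 i, mul_zero,
          add_zero]

theorem IsFlux.sum_row_test_eq_zero (h : IsFlux M a11 a22 f wx wy) (hf : Integrable f muOmega)
    (hx : HasWeakDx wx wxx) (hy : HasWeakDy wy wyy) {j : Fin m} {ψ η : ℝ → ℝ}
    (hψ : IsTestOn (Ioo 0 1) ψ) (hη : IsTestOn (Ioo (M.y j.castSucc) (M.y j.succ)) η) :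
    ∑ i, a11 i j *
      ((∫ y in M.y j.castSucc..M.y j.succ, η y * traceAt wx wxx (M.x i.succ) y) * ψ (M.x i.succ) -
      (∫ y in M.y j.castSucc..M.y j.succ, η y * traceAt wx wxx (M.x i.castSucc) y) *
        ψ (M.x i.castSucc)) = 0 := by
  have hη' : IsTestOn (Ioo 0 1) η := hη.mono (M.Ioo_y_subset j)
  have hφ := isTest_mul hψ hη'
  have eq_zero {l : Fin m} (hl : l ≠ j) {y : ℝ} (hy : y ∈ Icc (M.y l.castSucc) (M.y l.succ)) :
      η y = 0 :=
    hη.eq_zero (Set.disjoint_left.1 (disjoint_Icc_Ioo_of_strictMono M.y_strictMono hl.symm) hy)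
  have node_zero (l : Fin m) : η (M.y l.castSucc) = 0 ∧ η (M.y l.succ) = 0 := by
    by_cases hl : l = j
    · subst hl
      exact ⟨hη.eq_zero fun h => h.1.false, hη.eq_zero fun h => h.2.false⟩
    · exact ⟨eq_zero hl (left_mem_Icc.2 (M.y_lt l).le), eq_zero hl (right_mem_Icc.2 (M.y_lt l).le)⟩
  have weak := h _ hφ
  simp only [dx_mul hψ hη', dy_mul hψ hη'] at weak
  rw [← M.sum_setIntegral_elem (hφ.isWeight.integrable_mul' hf), ← sub_eq_zero] at weak
  simp only [← Finset.sum_sub_distrib] at weak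
  rw [← weak]
  refine Finset.sum_congr rfl fun i _ => ?_
  refine Eq.symm ((Finset.sum_congr rfl fun l _ => h.integral_elem_sub hf hx hy hψ hη' i
    (node_zero l).1 (node_zero l).2).trans (Finset.sum_eq_single_of_mem j (Finset.mem_univ j)
      fun l _ hl => ?_))
  have row_zero (t : ℝ) :
      ∫ y in M.y l.castSucc..M.y l.succ, η y * traceAt wx wxx t y = 0 := by
    refine (intervalIntegral.integral_congr fun y hy => ?_).trans intervalIntegral.integral_zero
    rw [uIcc_of_le (M.y_lt l).le] at hy
    simp only [eq_zero hl hy, zero_mul]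
  rw [row_zero, row_zero]
  ring

theorem exists_isTestOn_eqOn_one {a b : ℝ} {K : Set ℝ} (hK : IsClosed K) (hKab : K ⊆ Ioo a b) :
    ∃ χ, IsTestOn (Ioo a b) χ ∧ EqOn χ 1 K := by
  obtain ⟨χ, zero, one, -⟩ := exists_contMDiffMap_zero_one_nhds_of_isClosed (n := ⊤)
    (modelWithCornersSelf ℝ ℝ) (isOpen_Ioo (a := a) (b := b)).isClosed_compl hK
    (disjoint_compl_left_iff_subset.2 hKab)
  have support : tsupport χ ⊆ Ioo a b := fun x hx => by
    by_contra hx'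
    exact notMem_tsupport_iff_eventuallyEq.2 (eventually_nhdsSet_iff_forall.1 zero x hx') hx
  exact ⟨χ, ⟨χ.contMDiff.contDiff, isCompact_Icc.of_isClosed_subset (isClosed_tsupport _)
    (support.trans Ioo_subset_Icc_self), support⟩, fun x hx => one.self_of_nhdsSet x hx⟩

theorem exists_isTestOn_interpolating {x : Fin (n + 1) → ℝ} (hx : StrictMono x) (h0 : x 0 = 0)
    (h1 : x (Fin.last n) = 1) {v : Fin (n + 1) → ℝ} (hv0 : v 0 = 0) (hv1 : v (Fin.last n) = 0) :
    ∃ ψ, IsTestOn (Ioo 0 1) ψ ∧ ∀ i, ψ (x i) = v i := by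
  obtain ⟨χ, hχ, hχ1⟩ := exists_isTestOn_eqOn_one
    (K := x '' {i | i ≠ 0 ∧ i ≠ Fin.last n}) (Set.toFinite _).isClosed (by
      rintro _ ⟨i, ⟨hi0, hi1⟩, rfl⟩
      exact ⟨h0 ▸ hx (Fin.pos_of_ne_zero hi0), h1 ▸ hx (lt_of_le_of_ne (Fin.le_last i) hi1)⟩)
  let P := Lagrange.interpolate Finset.univ x v
  have hψ : IsTestOn (Ioo 0 1) fun t => χ t * P.eval t :=
    ⟨hχ.1.mul (by simpa using P.contDiff_aeval (𝕜 := ℝ) (n := ∞)), hχ.2.1.mul_right,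
      tsupport_mul_subset_left.trans hχ.2.2⟩
  refine ⟨_, hψ, fun i => ?_⟩
  rcases eq_or_ne i 0 with rfl | hi0
  · rw [hv0, hψ.eq_zero (by simp [h0])]
  rcases eq_or_ne i (Fin.last n) with rfl | hi1
  · rw [hv1, hψ.eq_zero (by simp [h1])]
  rw [hχ1 ⟨i, ⟨hi0, hi1⟩, rfl⟩, Pi.one_apply, one_mul]
  exact Lagrange.eval_interpolate_at_node v hx.injective.injOn (Finset.mem_univ i)

/-- Summation by parts in a row: the normal flux is continuous across the interior edges. -/
theorem IsFlux.sum_edge_eq_zero (h : IsFlux M a11 a22 f wx wy) (hf : Integrable f muOmega)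
    (hx : HasWeakDx wx wxx) (hy : HasWeakDy wy wyy) (j : Fin m) {v : Fin (n + 1) → ℝ}
    (hv0 : v 0 = 0) (hv1 : v (Fin.last n) = 0) :
    ∑ i, a11 i j *
      ((∫ y in M.y j.castSucc..M.y j.succ, traceAt wx wxx (M.x i.succ) y) * v i.succ -
      (∫ y in M.y j.castSucc..M.y j.succ, traceAt wx wxx (M.x i.castSucc) y) * v i.castSucc) =
        0 := by
  obtain ⟨ψ, hψ, hψv⟩ := exists_isTestOn_interpolating M.x_strictMono M.x_zero M.x_last hv0 hv1
  have hT (t : ℝ) : IntegrableOn (traceAt wx wxx t) (Ioo (M.y j.castSucc) (M.y j.succ)) :=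
    (integrableOn_traceAt hx.integrable hx.integrable_deriv t).mono_set (M.Ioo_y_subset j)
  let jump (i : Fin n) (y : ℝ) : ℝ := a11 i j *
    (traceAt wx wxx (M.x i.succ) y * v i.succ - traceAt wx wxx (M.x i.castSucc) y * v i.castSucc)
  have hjump (i : Fin n) : IntegrableOn (jump i) (Ioo (M.y j.castSucc) (M.y j.succ)) :=
    (((hT _).mul_const _).sub ((hT _).mul_const _)).const_mul _
  have integral_mul_jump {k : ℝ → ℝ} (hk : IsWeight k) :
      ∫ y in Ioo (M.y j.castSucc) (M.y j.succ), k y * ∑ i, jump i y = ∑ i, a11 i j *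
        ((∫ y in M.y j.castSucc..M.y j.succ, k y * traceAt wx wxx (M.x i.succ) y) * v i.succ -
        (∫ y in M.y j.castSucc..M.y j.succ, k y * traceAt wx wxx (M.x i.castSucc) y) *
          v i.castSucc) := by
    simp only [Finset.mul_sum, intervalIntegral.integral_of_le (M.y_lt j).le,
      integral_Ioc_eq_integral_Ioo]
    rw [integral_finsetSum _ fun i _ => hk.integrable_mul (hjump i)]
    refine Finset.sum_congr rfl fun i _ => ?_
    rw [← integral_mul_const, ← integral_mul_const, ← integral_sub
      ((hk.integrable_mul (hT _)).mul_const _) ((hk.integrable_mul (hT _)).mul_const _),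
      ← integral_const_mul]
    congr 1
    funext y
    ring
  have jump_zero : ∀ᵐ y ∂volume.restrict (Ioo (M.y j.castSucc) (M.y j.succ)), ∑ i, jump i y = 0 :=
    ae_eq_zero_of_integral_test_mul_eq_zero isOpen_Ioo (integrable_finsetSum _ fun i _ => hjump i)
      fun η hη => (integral_mul_jump hη.isWeight).trans (by
        simpa only [hψv] using h.sum_row_test_eq_zero hf hx hy hψ hη)
  have total := integral_mul_jump (.const 1)
  simp only [one_mul] at total
  exact total.symm.trans (integral_eq_zero_of_ae jump_zero)

end Equation

/-! ### Means over elements and edges -/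

namespace Mesh

variable (M : Mesh n m) (i : Fin n) (j : Fin m)

theorem hx_pos : 0 < M.hx i := sub_pos.2 (M.x_lt i)

theorem hy_pos : 0 < M.hy j := sub_pos.2 (M.y_lt j)

theorem area_pos : 0 < M.area i j := mul_pos (M.hx_pos i) (M.hy_pos j)

theorem area_swap : M.swap.area j i = M.area i j := mul_comm _ _

theorem size_swap : M.swap.size = M.size := by
  rw [size, size, ← (Equiv.prodComm (Fin n) (Fin m)).iSup_comp]
  exact iSup_congr fun T => congrArg Real.sqrt (add_comm _ _)

theorem sqrt_le_size : Real.sqrt (M.hx i ^ 2 + M.hy j ^ 2) ≤ M.size :=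
  le_ciSup (f := fun T : Fin n × Fin m => Real.sqrt (M.hx T.1 ^ 2 + M.hy T.2 ^ 2))
    (Set.finite_range _).bddAbove (i, j)

include j in
theorem hx_le_size : M.hx i ≤ M.size :=
  (Real.le_sqrt_of_sq_le (le_add_of_nonneg_right (sq_nonneg _))).trans (M.sqrt_le_size i j)

include i in
theorem hy_le_size : M.hy j ≤ M.size :=
  (Real.le_sqrt_of_sq_le (le_add_of_nonneg_left (sq_nonneg _))).trans (M.sqrt_le_size i j)

/-- The midpoint of the `i`-th interval of the partition in `x`. -/
noncomputable def xMid : ℝ := (M.x i.castSucc + M.x i.succ) / 2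

theorem abs_sub_xMid_le {p : ℝ × ℝ} (hp : p ∈ M.elem i j) : |p.1 - M.xMid i| ≤ M.hx i / 2 := by
  have hp₁ := hp.1
  rw [xMid, hx, abs_le]
  constructor <;> linarith [hp₁.1, hp₁.2]

theorem measureReal_elem : volume.real (M.elem i j) = M.area i j := by
  rw [elem, Measure.volume_eq_prod, measureReal_prod_prod, Real.volume_real_Icc_of_le (M.x_lt i).le,
    Real.volume_real_Icc_of_le (M.y_lt j).le, area, hx, hy]

theorem area_mul_Qh (w : ℝ × ℝ → ℝ) : M.area i j * M.Qh i j w = ∫ p in M.elem i j, w p := by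
  rw [Qh, setAverage_eq, M.measureReal_elem, smul_eq_mul, mul_inv_cancel_left₀ (M.area_pos i j).ne']

theorem Qh_swap (w : ℝ × ℝ → ℝ) : M.swap.Qh j i (fun p => w p.swap) = M.Qh i j w := by
  refine mul_left_cancel₀ (M.area_pos i j).ne' ?_
  rw [← M.area_swap, area_mul_Qh, area_swap, area_mul_Qh, setIntegral_elem_swap]

theorem isCompact_elem : IsCompact (M.elem i j) := isCompact_Icc.prod isCompact_Icc

variable {F p : ℝ × ℝ → ℝ}

theorem integrableOn_elem_mul (hF : Integrable F muOmega) (hp : Continuous p) :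
    IntegrableOn (fun q => F q * p q) (M.elem i j) :=
  IntegrableOn.mul_continuousOn (hF.mono_measure (M.restrict_elem_le i j)) hp.continuousOn
    (M.isCompact_elem i j)

theorem Qh_mul_add_const (hF : Integrable F muOmega) (hp : Continuous p) (c : ℝ) :
    M.Qh i j (fun q => F q * (p q + c)) = M.Qh i j (fun q => F q * p q) + c * M.Qh i j F := by
  refine mul_left_cancel₀ (M.area_pos i j).ne' ?_
  have hFc := integral_mul_const (μ := volume.restrict (M.elem i j)) c F
  simp only [mul_add, area_mul_Qh]
  rw [integral_add (M.integrableOn_elem_mul i j hF hp)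
    (M.integrableOn_elem_mul i j hF continuous_const), hFc, mul_left_comm, area_mul_Qh,
    mul_comm c]

/-- Jensen's inequality, with the weight `p` bounded by `B`. -/
theorem sq_Qh_mul_le (hF : MemLp F 2 muOmega) (hp : Continuous p) {B : ℝ}
    (hB : ∀ q ∈ M.elem i j, |p q| ≤ B) :
    M.Qh i j (fun q => F q * p q) ^ 2 * M.area i j ≤ B ^ 2 * ∫ q in M.elem i j, F q ^ 2 := by
  have hF' : MemLp F 2 (volume.restrict (M.elem i j)) := hF.mono_measure (M.restrict_elem_le i j)
  have pointwise : ∀ q ∈ M.elem i j, (F q * p q) ^ 2 ≤ B ^ 2 * F q ^ 2 := fun q hq => by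
    rw [mul_pow, mul_comm, ← sq_abs (p q)]
    gcongr
    exact hB q hq
  have hint : IntegrableOn (fun q => B ^ 2 * F q ^ 2) (M.elem i j) :=
    hF'.integrable_sq.const_mul (B ^ 2)
  have hsq : IntegrableOn (fun q => (F q * p q) ^ 2) (M.elem i j) := by
    refine hint.mono' ?_ ?_
    · exact ((hF'.aestronglyMeasurable).mul hp.aestronglyMeasurable).pow 2
    · filter_upwards [ae_restrict_mem (M.measurableSet_elem i j)] with q hq
      rw [Real.norm_of_nonneg (sq_nonneg _)]
      exact pointwise q hq
  have hvolume : volume (M.elem i j) ≠ 0 := fun h => (M.area_pos i j).ne' <| by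
    rw [← M.measureReal_elem, measureReal_def, h, ENNReal.toReal_zero]
  have jensen : M.Qh i j (fun q => F q * p q) ^ 2 ≤ M.Qh i j (fun q => (F q * p q) ^ 2) :=
    (even_two.convexOn_pow (𝕜 := ℝ)).map_set_average_le (continuous_pow 2).continuousOn
      isClosed_univ hvolume (M.isCompact_elem i j).measure_lt_top.ne
      (ae_of_all _ fun _ => mem_univ _)
      (M.integrableOn_elem_mul i j (hF.integrable one_le_two) hp) hsq
  calc M.Qh i j (fun q => F q * p q) ^ 2 * M.area i j
      ≤ M.area i j * M.Qh i j (fun q => (F q * p q) ^ 2) := by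
        rw [mul_comm]
        exact mul_le_mul_of_nonneg_left jensen (M.area_pos i j).le
    _ = ∫ q in M.elem i j, (F q * p q) ^ 2 := M.area_mul_Qh i j _
    _ ≤ ∫ q in M.elem i j, B ^ 2 * F q ^ 2 :=
        setIntegral_mono_on hsq hint (M.measurableSet_elem i j) pointwise
    _ = B ^ 2 * ∫ q in M.elem i j, F q ^ 2 := integral_const_mul _ _

/-- The mean of the trace of `w` over the vertical edge `{x_k} × [y_j, y_{j+1}]`, for
`z = ∂_x w`. -/
noncomputable def edgeMean (w z : ℝ × ℝ → ℝ) (k : Fin (n + 1)) : ℝ :=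
  ⨍ y in M.y j.castSucc..M.y j.succ, traceAt w z (M.x k) y

theorem hy_mul_edgeMean (w z : ℝ × ℝ → ℝ) (k : Fin (n + 1)) :
    M.hy j * M.edgeMean j w z k =
      ∫ y in M.y j.castSucc..M.y j.succ, traceAt w z (M.x k) y := by
  rw [edgeMean, interval_average_eq, smul_eq_mul, ← hy, mul_inv_cancel_left₀ (M.hy_pos j).ne']

end Mesh

/-- The vertical line `x = x_k` contains a side of the `i`-th column, with outward unit normal
`(σ, 0)`. -/
def IsSide (i : Fin n) (k : Fin (n + 1)) (σ : ℝ) : Prop :=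
  (k = i.castSucc ∧ σ = -1) ∨ (k = i.succ ∧ σ = 1)

section Moments

variable {w z w' z' : ℝ × ℝ → ℝ} {M : Mesh n m} {i : Fin n} {j : Fin m} {k : Fin (n + 1)} {σ : ℝ}

theorem HasWeakDx.Qh_mul_deriv_add (h : HasWeakDx w z) {p p' : ℝ → ℝ} (hp : ContDiff ℝ 1 p)
    (hp' : deriv p = p') :
    M.hx i * (M.Qh i j (fun q => w q * p' q.1) + M.Qh i j (fun q => z q * p q.1)) =
      M.edgeMean j w z i.succ * p (M.x i.succ) -
        M.edgeMean j w z i.castSucc * p (M.x i.castSucc) := by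
  have hw := M.integrableOn_elem_mul i j h.integrable
    ((hp.continuous_deriv le_rfl).comp continuous_fst)
  have hz := M.integrableOn_elem_mul i j h.integrable_deriv (hp.continuous.comp continuous_fst)
  have key := h.integral_elem (IsWeight.const 1) hp M i j
  simp only [one_mul, ← M.hy_mul_edgeMean] at key
  have hsplit := integral_add hw hz
  subst hp'
  refine mul_left_cancel₀ (M.hy_pos j).ne' ?_
  calc M.hy j * (M.hx i * (M.Qh i j (fun q => w q * deriv p q.1) +
          M.Qh i j (fun q => z q * p q.1)))
      = M.area i j * M.Qh i j (fun q => w q * deriv p q.1) +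
          M.area i j * M.Qh i j (fun q => z q * p q.1) := by rw [Mesh.area]; ring
    _ = M.hy j * M.edgeMean j w z i.succ * p (M.x i.succ) -
          M.hy j * M.edgeMean j w z i.castSucc * p (M.x i.castSucc) := by
        rw [M.area_mul_Qh, M.area_mul_Qh]
        exact hsplit.symm.trans key
    _ = _ := by ring

theorem HasWeakDx.edgeMean_sub (h : HasWeakDx w z) :
    M.edgeMean j w z i.succ - M.edgeMean j w z i.castSucc = M.hx i * M.Qh i j z := by
  have key := h.Qh_mul_deriv_add (M := M) (i := i) (j := j) (contDiff_const (c := (1 : ℝ)))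
    (deriv_const' 1)
  have hzero : M.Qh i j (fun _ => 0) = 0 := by simp [Mesh.Qh]
  simp only [mul_zero, mul_one] at key
  rw [← key, hzero, zero_add]

theorem HasWeakDx.edgeMean_eq (h : HasWeakDx w z) (hk : IsSide i k σ) :
    M.edgeMean j w z k =
      M.Qh i j w + M.Qh i j (fun q => z q * (q.1 - M.xMid i)) + σ * M.hx i / 2 * M.Qh i j z := by
  have hshift := M.Qh_mul_add_const i j h.integrable_deriv
    (p := fun q => q.1 - M.xMid i) (by fun_prop) (σ * M.hx i / 2)
  have hderiv (c : ℝ) : deriv (fun x => x - M.xMid i + c) = fun _ => 1 := by simp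
  have key := h.Qh_mul_deriv_add (M := M) (i := i) (j := j)
    (p := fun x => x - M.xMid i + σ * M.hx i / 2) (by fun_prop) (hderiv _)
  simp only [mul_one] at key
  refine mul_left_cancel₀ (M.hx_pos i).ne' ?_
  rw [add_assoc, ← hshift, key, Mesh.xMid, Mesh.hx]
  rcases hk with ⟨rfl, rfl⟩ | ⟨rfl, rfl⟩ <;> ring

/-- The weight on the right vanishes at both ends of the interval. -/
theorem HasWeakDx.first_moment (h : HasWeakDx w z) :
    M.Qh i j (fun q => w q * (q.1 - M.xMid i)) =
      -M.Qh i j (fun q => z q * ((q.1 - M.xMid i) ^ 2 / 2 - M.hx i ^ 2 / 8)) := by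
  have key := h.Qh_mul_deriv_add (M := M) (i := i) (j := j)
    (p := fun x => (x - M.xMid i) ^ 2 / 2 - M.hx i ^ 2 / 8) (p' := fun x => x - M.xMid i)
    (by fun_prop) (by ext; simp)
  refine eq_neg_of_add_eq_zero_left (mul_left_cancel₀ (M.hx_pos i).ne' (key.trans ?_))
  rw [Mesh.xMid, Mesh.hx]
  ring

theorem HasWeakDx.second_moment (h : HasWeakDx w z) :
    M.Qh i j (fun q => w q * ((q.1 - M.xMid i) ^ 2 / 2 - M.hx i ^ 2 / 8)) =
      -(M.hx i ^ 2 / 12 * M.Qh i j w) - M.Qh i j (fun q => z q *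
        ((q.1 - M.xMid i) ^ 3 / 6 - M.hx i ^ 2 / 24 * (q.1 - M.xMid i))) := by
  have key := h.Qh_mul_deriv_add (M := M) (i := i) (j := j)
    (p := fun x => (x - M.xMid i) ^ 3 / 6 - M.hx i ^ 2 / 24 * (x - M.xMid i))
    (p' := fun x => (x - M.xMid i) ^ 2 / 2 - M.hx i ^ 2 / 24)
    (by fun_prop) (by
      ext x
      have h₁ : DifferentiableAt ℝ (fun x => (x - M.xMid i) ^ 3 / 6) x := by fun_prop
      have h₂ : DifferentiableAt ℝ (fun x => M.hx i ^ 2 / 24 * (x - M.xMid i)) x := by fun_prop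
      rw [deriv_fun_sub h₁ h₂]
      simp
      ring)
  have hvanish : M.hx i * (M.Qh i j (fun q => w q * ((q.1 - M.xMid i) ^ 2 / 2 - M.hx i ^ 2 / 24)) +
      M.Qh i j (fun q => z q *
        ((q.1 - M.xMid i) ^ 3 / 6 - M.hx i ^ 2 / 24 * (q.1 - M.xMid i)))) = M.hx i * 0 := by
    refine key.trans ?_
    rw [Mesh.xMid, Mesh.hx]
    ring
  have hshift := M.Qh_mul_add_const i j h.integrable
    (p := fun q => (q.1 - M.xMid i) ^ 2 / 2 - M.hx i ^ 2 / 24) (by fun_prop) (-(M.hx i ^ 2 / 12))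
  have hweight : ∀ q : ℝ × ℝ, (q.1 - M.xMid i) ^ 2 / 2 - M.hx i ^ 2 / 24 + -(M.hx i ^ 2 / 12) =
      (q.1 - M.xMid i) ^ 2 / 2 - M.hx i ^ 2 / 8 := fun q => by ring
  simp only [hweight] at hshift
  linarith [mul_left_cancel₀ (M.hx_pos i).ne' hvanish]

theorem HasWeakDx.sq_first_moment_mul_area_le (h : HasWeakDx w z) :
    M.Qh i j (fun q => w q * (q.1 - M.xMid i)) ^ 2 * M.area i j ≤
      M.hx i ^ 4 * ∫ q in M.elem i j, z q ^ 2 := by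
  rw [h.first_moment, neg_sq, show M.hx i ^ 4 = (M.hx i ^ 2) ^ 2 by ring]
  refine M.sq_Qh_mul_le i j h.memLp_deriv (by fun_prop) fun q hq => ?_
  have ht : (q.1 - M.xMid i) ^ 2 ≤ (M.hx i / 2) ^ 2 := sq_le_sq.2 <|
    (M.abs_sub_xMid_le i j hq).trans (le_abs_self _)
  rw [abs_le]
  constructor <;> nlinarith [sq_nonneg (q.1 - M.xMid i), sq_nonneg (M.hx i)]

theorem sq_Qh_mul_area_le (hw : MemLp w 2 muOmega) :
    M.Qh i j w ^ 2 * M.area i j ≤ ∫ q in M.elem i j, w q ^ 2 := by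
  have := M.sq_Qh_mul_le i j hw (continuous_const (y := (1 : ℝ))) (B := 1) (by simp)
  simpa only [mul_one, one_pow, one_mul] using this

theorem HasWeakDx.sq_edgeMean_sub_mul_area_le (h : HasWeakDx w z) (hk : IsSide i k σ) :
    (M.edgeMean j w z k - M.Qh i j w) ^ 2 * M.area i j ≤
      M.hx i ^ 2 * ∫ q in M.elem i j, z q ^ 2 := by
  rw [h.edgeMean_eq hk, add_assoc, add_sub_cancel_left,
    ← M.Qh_mul_add_const i j h.integrable_deriv (p := fun q => q.1 - M.xMid i) (by fun_prop)]
  refine M.sq_Qh_mul_le i j h.memLp_deriv (by fun_prop) fun q hq => ?_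
  have := abs_le.1 (M.abs_sub_xMid_le i j hq)
  have hx := M.hx_pos i
  rw [abs_le]
  rcases hk with ⟨-, rfl⟩ | ⟨-, rfl⟩ <;> constructor <;> linarith

theorem HasWeakDx.sq_edgeMean_sub_sub_mul_area_le (h : HasWeakDx w z) (h' : HasWeakDx z z')
    (hk : IsSide i k σ) :
    (M.edgeMean j w z k - M.Qh i j w - σ * M.hx i / 2 * M.Qh i j z) ^ 2 * M.area i j ≤
      M.hx i ^ 4 * ∫ q in M.elem i j, z' q ^ 2 := by
  rw [h.edgeMean_eq hk]
  convert h'.sq_first_moment_mul_area_le (M := M) (i := i) (j := j) using 3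
  ring

/-- The error of the trapezoidal rule in `x`, with its leading term removed. -/
theorem HasWeakDx.sq_trapezoid_error_mul_area_le (h : HasWeakDx w z) (h' : HasWeakDx z w')
    (h'' : HasWeakDx w' z') :
    (M.edgeMean j w z i.castSucc + M.edgeMean j w z i.succ -
        (2 * M.Qh i j w + M.hx i ^ 2 / 6 * M.Qh i j w')) ^ 2 * M.area i j ≤
      M.hx i ^ 6 * ∫ q in M.elem i j, z' q ^ 2 := by
  have herror : M.edgeMean j w z i.castSucc + M.edgeMean j w z i.succ -
      (2 * M.Qh i j w + M.hx i ^ 2 / 6 * M.Qh i j w') = 2 * M.Qh i j (fun q => z' q *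
        ((q.1 - M.xMid i) ^ 3 / 6 - M.hx i ^ 2 / 24 * (q.1 - M.xMid i))) := by
    have hm := h'.first_moment (M := M) (i := i) (j := j)
    rw [h''.second_moment] at hm
    rw [h.edgeMean_eq (Or.inl ⟨rfl, rfl⟩), h.edgeMean_eq (Or.inr ⟨rfl, rfl⟩), hm]
    ring
  have hbound : ∀ q ∈ M.elem i j,
      |(q.1 - M.xMid i) ^ 3 / 6 - M.hx i ^ 2 / 24 * (q.1 - M.xMid i)| ≤ M.hx i ^ 3 / 2 := by
    intro q hq
    have ht := M.abs_sub_xMid_le i j hq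
    have hx := M.hx_pos i
    calc |(q.1 - M.xMid i) ^ 3 / 6 - M.hx i ^ 2 / 24 * (q.1 - M.xMid i)|
        ≤ |q.1 - M.xMid i| ^ 3 / 6 + M.hx i ^ 2 / 24 * |q.1 - M.xMid i| := by
          refine (abs_sub _ _).trans_eq ?_
          rw [abs_div, abs_pow, abs_mul, abs_of_pos (by norm_num : (0 : ℝ) < 6),
            abs_of_pos (by positivity : 0 < M.hx i ^ 2 / 24)]
      _ ≤ (M.hx i / 2) ^ 3 / 6 + M.hx i ^ 2 / 24 * (M.hx i / 2) := by gcongr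
      _ ≤ M.hx i ^ 3 / 2 := by nlinarith [pow_pos hx 3]
  have hsq := M.sq_Qh_mul_le i j h''.memLp_deriv (by fun_prop) hbound
  rw [herror]
  linarith

end Moments

/-! ### Means of a jet on one element -/

namespace Mesh

variable (M : Mesh n m) (D : ℕ → ℕ → ℝ × ℝ → ℝ) (i : Fin n) (j : Fin m)

/-- The sum of the squares of the `L²(T_{ij})` norms of the third derivatives. -/
noncomputable def seminormSq : ℝ :=
  ∑ s ∈ Finset.HasAntidiagonal.antidiagonal 3, ∫ p in M.elem i j, D s.1 s.2 p ^ 2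

variable {D} in
theorem integral_sq_le_seminormSq {r s : ℕ} (hrs : r + s = 3) :
    ∫ p in M.elem i j, D r s p ^ 2 ≤ M.seminormSq D i j :=
  Finset.single_le_sum (f := fun s : ℕ × ℕ => ∫ p in M.elem i j, D s.1 s.2 p ^ 2)
    (fun _ _ => integral_nonneg fun _ => sq_nonneg _)
    (Finset.HasAntidiagonal.mem_antidiagonal.2 hrs : (r, s) ∈ Finset.HasAntidiagonal.antidiagonal 3)

theorem seminormSq_nonneg : 0 ≤ M.seminormSq D i j :=
  Finset.sum_nonneg fun _ _ => integral_nonneg fun _ => sq_nonneg _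

theorem seminormSq_swap : M.swap.seminormSq (swapJet D) j i = M.seminormSq D i j := by
  rw [seminormSq, ← Finset.Nat.sum_antidiagonal_swap, seminormSq]
  exact Finset.sum_congr rfl fun s _ => M.setIntegral_elem_swap i j fun p => D s.1 s.2 p ^ 2

theorem Qh_swapJet (r s : ℕ) : M.swap.Qh j i (swapJet D r s) = M.Qh i j (D s r) :=
  M.Qh_swap i j (D s r)

theorem size_pos (i : Fin n) (j : Fin m) : 0 < M.size := (M.hx_pos i).trans_le (M.hx_le_size i j)

/-- The perturbed mean of `D 0 0` over the vertical edge `{x_k} × [y_j, y_{j+1}]` that is prescribed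
as a boundary value. -/
noncomputable def perturbedMean (ρ a' : ℝ) (k : Fin (n + 1)) : ℝ :=
  M.edgeMean j (D 0 0) (D 1 0) k +
    1 / 12 * M.hy j * (M.hy j - 6 * ρ⁻¹ * a' * M.size) * M.edgeMean j (D 0 2) (D 1 2) k

/-- The mean of `D 0 0` over the edge `{x_k} × [y_j, y_{j+1}]` with the second order correction that
makes the sums over opposite edges of an element agree up to third order. -/
noncomputable def correctedMean (k : Fin (n + 1)) : ℝ :=
  M.edgeMean j (D 0 0) (D 1 0) k + M.hy j ^ 2 / 12 * M.edgeMean j (D 0 2) (D 1 2) k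

/-- The part of the residual of the stabilizer that is common to the four edges of `T_{ij}`. -/
noncomputable def residualShift (ρ a a' : ℝ) : ℝ :=
  M.size / ρ * (a * M.hx i / 2 * M.Qh i j (D 2 0) + a' * M.hy j / 2 * M.Qh i j (D 0 2))

theorem residualShift_swap (ρ a a' : ℝ) :
    M.swap.residualShift (swapJet D) j i ρ a' a = M.residualShift D i j ρ a a' := by
  rw [residualShift, Qh_swapJet, Qh_swapJet, size_swap, residualShift, add_comm]
  rfl

end Mesh

section CorrectedMeans

variable {D : ℕ → ℕ → ℝ × ℝ → ℝ} {M : Mesh n m} {i : Fin n} {j : Fin m}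

theorem IsJet.sq_correctedMean_add_sub_le (h : IsJet 3 D) {L : ℝ} (hx : M.hx i ≤ L)
    (hy : M.hy j ≤ L) :
    (M.correctedMean D j i.castSucc + M.correctedMean D j i.succ - (2 * M.Qh i j (D 0 0) +
        M.hx i ^ 2 / 6 * M.Qh i j (D 2 0) + M.hy j ^ 2 / 6 * M.Qh i j (D 0 2))) ^ 2 *
      M.area i j ≤ 4 * L ^ 6 * M.seminormSq D i j := by
  have hx0 := M.hx_pos i
  have hy0 := M.hy_pos j
  have hA := M.area_pos i j
  have hN := M.seminormSq_nonneg D i j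
  have three_term (x y z : ℝ) : (x + y + z) ^ 2 ≤ 3 * (x ^ 2 + y ^ 2 + z ^ 2) := by
    linarith [sq_nonneg (x - y), sq_nonneg (y - z), sq_nonneg (x - z)]
  have htrapezoid := (HasWeakDx.sq_trapezoid_error_mul_area_le (M := M) (i := i) (j := j)
    (h.hasWeakDx 0 0 (by decide)) (h.hasWeakDx 1 0 (by decide)) (h.hasWeakDx 2 0 (by decide))).trans
    (mul_le_mul (pow_le_pow_left₀ hx0.le hx 6) (M.integral_sq_le_seminormSq i j rfl)
      (integral_nonneg fun _ => sq_nonneg _) (pow_nonneg (hx0.le.trans hx) 6))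
  have hcorrection {k : Fin (n + 1)} {σ : ℝ} (hk : IsSide i k σ) :
      (M.hy j ^ 2 / 12 * (M.edgeMean j (D 0 2) (D 1 2) k - M.Qh i j (D 0 2))) ^ 2 * M.area i j ≤
        L ^ 6 * M.seminormSq D i j / 144 := by
    have hs := HasWeakDx.sq_edgeMean_sub_mul_area_le (M := M) (j := j)
      (h.hasWeakDx 0 2 (by decide)) hk
    have hs' := M.integral_sq_le_seminormSq (D := D) i j (r := 1) (s := 2) rfl
    calc (M.hy j ^ 2 / 12 * (M.edgeMean j (D 0 2) (D 1 2) k - M.Qh i j (D 0 2))) ^ 2 * M.area i j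
        = M.hy j ^ 4 / 144 *
            ((M.edgeMean j (D 0 2) (D 1 2) k - M.Qh i j (D 0 2)) ^ 2 * M.area i j) := by ring
      _ ≤ L ^ 4 / 144 * (M.hx i ^ 2 * ∫ p in M.elem i j, D 1 2 p ^ 2) := by gcongr
      _ ≤ L ^ 4 / 144 * (L ^ 2 * M.seminormSq D i j) := by gcongr
      _ = _ := by ring
  have hW := hcorrection (Or.inl ⟨rfl, rfl⟩)
  have hE := hcorrection (Or.inr ⟨rfl, rfl⟩)
  have hsum := mul_le_mul_of_nonneg_right (three_term
    (M.edgeMean j (D 0 0) (D 1 0) i.castSucc + M.edgeMean j (D 0 0) (D 1 0) i.succ -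
      (2 * M.Qh i j (D 0 0) + M.hx i ^ 2 / 6 * M.Qh i j (D 2 0)))
    (M.hy j ^ 2 / 12 * (M.edgeMean j (D 0 2) (D 1 2) i.castSucc - M.Qh i j (D 0 2)))
    (M.hy j ^ 2 / 12 * (M.edgeMean j (D 0 2) (D 1 2) i.succ - M.Qh i j (D 0 2)))) hA.le
  have hL : 0 ≤ L ^ 6 * M.seminormSq D i j := mul_nonneg (pow_nonneg (hx0.le.trans hx) 6) hN
  simp only [Mesh.correctedMean]
  refine le_trans (le_of_eq ?_) (hsum.trans (by linarith))
  ring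

theorem IsJet.sq_correctedMean_defect_le (h : IsJet 3 D) {L : ℝ} (hx : M.hx i ≤ L)
    (hy : M.hy j ≤ L) :
    (M.correctedMean D j i.castSucc + M.correctedMean D j i.succ -
        (M.swap.correctedMean (swapJet D) i j.castSucc +
          M.swap.correctedMean (swapJet D) i j.succ)) ^ 2 * M.area i j ≤
      16 * L ^ 6 * M.seminormSq D i j := by
  have hX := h.sq_correctedMean_add_sub_le hx hy
  have hY := h.swap.sq_correctedMean_add_sub_le (M := M.swap) (i := j) (j := i) hy hx
  simp only [M.area_swap, M.seminormSq_swap, M.Qh_swapJet] at hY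
  set P := 2 * M.Qh i j (D 0 0) + M.hx i ^ 2 / 6 * M.Qh i j (D 2 0) +
    M.hy j ^ 2 / 6 * M.Qh i j (D 0 2)
  have hP : 2 * M.Qh i j (D 0 0) + M.swap.hx j ^ 2 / 6 * M.Qh i j (D 0 2) +
      M.swap.hy i ^ 2 / 6 * M.Qh i j (D 2 0) = P := add_right_comm _ _ _
  rw [hP] at hY
  set X := M.correctedMean D j i.castSucc + M.correctedMean D j i.succ
  set Y := M.swap.correctedMean (swapJet D) i j.castSucc + M.swap.correctedMean (swapJet D) i j.succ
  have htwo : (X - Y) ^ 2 ≤ 2 * ((X - P) ^ 2 + (Y - P) ^ 2) := by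
    linarith [sq_nonneg (X - P + (Y - P))]
  nlinarith [mul_le_mul_of_nonneg_right htwo (M.area_pos i j).le]

/-- The defect is put on the pair of edges at the larger distance. -/
theorem IsJet.exists_defects (h : IsJet 3 D) (M : Mesh n m) (i : Fin n) (j : Fin m) :
    ∃ δ δ' : ℝ,
      M.correctedMean D j i.castSucc - δ + (M.correctedMean D j i.succ - δ) =
        M.swap.correctedMean (swapJet D) i j.castSucc - δ' +
          (M.swap.correctedMean (swapJet D) i j.succ - δ') ∧
      δ ^ 2 * M.area i j ≤ M.hx i ^ 6 * (4 * M.seminormSq D i j) ∧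
      δ' ^ 2 * M.area i j ≤ M.hy j ^ 6 * (4 * M.seminormSq D i j) := by
  have hN := M.seminormSq_nonneg D i j
  have hx0 := M.hx_pos i
  have hy0 := M.hy_pos j
  have hzero {l : ℝ} (hl : 0 < l) :
      (0 : ℝ) ^ 2 * M.area i j ≤ l ^ 6 * (4 * M.seminormSq D i j) := by
    rw [zero_pow two_ne_zero, zero_mul]
    positivity
  set X := M.correctedMean D j i.castSucc + M.correctedMean D j i.succ with hX
  set Y := M.swap.correctedMean (swapJet D) i j.castSucc +
    M.swap.correctedMean (swapJet D) i j.succ with hY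
  rcases le_total (M.hy j) (M.hx i) with hle | hle
  · refine ⟨(X - Y) / 2, 0, by rw [hX, hY]; ring, ?_, hzero hy0⟩
    have := h.sq_correctedMean_defect_le le_rfl hle
    linarith
  · refine ⟨0, (Y - X) / 2, by rw [hX, hY]; ring, hzero hx0, ?_⟩
    have := h.sq_correctedMean_defect_le hle le_rfl
    linarith

end CorrectedMeans

/-! ### Weak functions on one element -/

theorem affine_apply (F : ℝ × ℝ →ᵃ[ℝ] ℝ) (p q : ℝ × ℝ) :
    F p = F q + F.linear (1, 0) * (p.1 - q.1) + F.linear (0, 1) * (p.2 - q.2) := by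
  have hdecomp : p - q = (p.1 - q.1) • ((1, 0) : ℝ × ℝ) + (p.2 - q.2) • ((0, 1) : ℝ × ℝ) := by
    ext <;> simp
  have hlinear := F.linearMap_vsub p q
  rw [vsub_eq_sub, vsub_eq_sub, hdecomp, map_add, map_smul, map_smul, smul_eq_mul,
    smul_eq_mul] at hlinear
  linarith

theorem average_affine {c d : ℝ} (hcd : c < d) (α β : ℝ) :
    ⨍ t in c..d, (α + β * (t - (c + d) / 2)) = α := by
  rw [interval_average_eq_div, intervalIntegral.integral_add (by simp)
    ((by fun_prop : Continuous fun t : ℝ => β * (t - (c + d) / 2)).intervalIntegrable _ _),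
    intervalIntegral.integral_const, intervalIntegral.integral_const_mul,
    intervalIntegral.integral_sub (by simp) (by simp), integral_id,
    intervalIntegral.integral_const]
  have hne : d - c ≠ 0 := (sub_pos.2 hcd).ne'
  simp only [smul_eq_mul]
  field_simp
  ring

namespace Mesh

variable (M : Mesh n m)

theorem QbV_affine (k : Fin (n + 1)) (j : Fin m) (F : ℝ × ℝ →ᵃ[ℝ] ℝ) :
    M.QbV k j F = F (M.x k, M.swap.xMid j) := by
  rw [QbV, ← average_affine (M.y_lt j) (F (M.x k, M.swap.xMid j)) (F.linear (0, 1))]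
  congr 1
  funext t
  rw [affine_apply F (M.x k, t) (M.x k, M.swap.xMid j), sub_self, mul_zero, add_zero]
  rfl

theorem QbH_affine (i : Fin n) (k : Fin (m + 1)) (F : ℝ × ℝ →ᵃ[ℝ] ℝ) :
    M.QbH i k F = F (M.xMid i, M.y k) := by
  rw [QbH, ← average_affine (M.x_lt i) (F (M.xMid i, M.y k)) (F.linear (1, 0))]
  congr 1
  funext t
  rw [affine_apply F (t, M.y k) (M.xMid i, M.y k), sub_self, mul_zero, add_zero]
  rfl

theorem exists_affine_edgeMeans (i : Fin n) (j : Fin m) {mW mE mS mN : ℝ}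
    (h : mW + mE = mS + mN) : ∃ F : ℝ × ℝ →ᵃ[ℝ] ℝ,
      M.QbV i.castSucc j F = mW ∧ M.QbV i.succ j F = mE ∧
      M.QbH i j.castSucc F = mS ∧ M.QbH i j.succ F = mN := by
  let L : ℝ × ℝ →ₗ[ℝ] ℝ := ((mE - mW) / M.hx i) • LinearMap.fst ℝ ℝ ℝ +
    ((mN - mS) / M.hy j) • LinearMap.snd ℝ ℝ ℝ
  let c : ℝ × ℝ := (M.xMid i, M.swap.xMid j)
  let F : ℝ × ℝ →ᵃ[ℝ] ℝ := L.toAffineMap + AffineMap.const ℝ (ℝ × ℝ) ((mW + mE) / 2 - L c)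
  have hF : ∀ p : ℝ × ℝ, F p = (mW + mE) / 2 + (mE - mW) / M.hx i * (p.1 - M.xMid i) +
      (mN - mS) / M.hy j * (p.2 - M.swap.xMid j) := fun p => by
    simp only [F, L, c, AffineMap.coe_add, LinearMap.coe_toAffineMap, Pi.add_apply,
      LinearMap.add_apply, LinearMap.smul_apply, LinearMap.fst_apply, LinearMap.snd_apply,
      smul_eq_mul, AffineMap.const_apply]
    ring
  have hW : M.x i.castSucc - M.xMid i = -(M.hx i / 2) := by rw [xMid, hx]; ring
  have hE : M.x i.succ - M.xMid i = M.hx i / 2 := by rw [xMid, hx]; ring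
  have hS : M.y j.castSucc - M.swap.xMid j = -(M.hy j / 2) := by rw [xMid, hy, swap]; ring
  have hN : M.y j.succ - M.swap.xMid j = M.hy j / 2 := by rw [xMid, hy, swap]; ring
  have hx0 := (M.hx_pos i).ne'
  have hy0 := (M.hy_pos j).ne'
  refine ⟨F, ?_, ?_, ?_, ?_⟩
  · rw [QbV_affine, hF, hW]
    field_simp
    ring
  · rw [QbV_affine, hF, hE]
    field_simp
    ring
  · rw [QbH_affine, hF, hS]
    field_simp
    linear_combination M.hx i * h
  · rw [QbH_affine, hF, hN]
    field_simp
    linear_combination M.hx i * h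

end Mesh

/-- Reflection of a weak function in the diagonal of the square. -/
def WeakFun.swap (v : WeakFun n m) : WeakFun m n where
  v0 j i := (v.v0 i j).comp (LinearEquiv.prodComm ℝ ℝ ℝ).toLinearMap.toAffineMap
  vV k i := v.vH i k
  vH j k := v.vV k j

theorem weakGrad_swap (M : Mesh n m) (v : WeakFun n m) (i : Fin n) (j : Fin m) :
    weakGrad M.swap v.swap j i = (weakGrad M v i j).swap := by
  simp only [weakGrad, M.area_swap]
  rfl

theorem hx_mul_weakGrad_fst (M : Mesh n m) (v : WeakFun n m) (i : Fin n) (j : Fin m) :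
    M.hx i * (weakGrad M v i j).1 = v.vV i.succ j - v.vV i.castSucc j := by
  have hx := (M.hx_pos i).ne'
  have hy := (M.hy_pos j).ne'
  simp only [weakGrad, Mesh.area]
  field_simp

/-- The jump `v_b - Q_b v_0` on the vertical edge `{x_k} × [y_j, y_{j+1}]`, with `v_0` taken from
`T_{ij}`. -/
noncomputable def edgeJump (M : Mesh n m) (v : WeakFun n m) (i : Fin n) (j : Fin m)
    (k : Fin (n + 1)) : ℝ :=
  v.vV k j - M.QbV k j (v.v0 i j)

/-- The residual `ρ h⁻¹ (w_b - Q_b w_0) - a (⟨∂_n u⟩_e - ⟨∂_n u⟩_T)` of the stabilizer, where `D` is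
the jet of `u`, `e` is the edge `{x_k} × [y_j, y_{j+1}]` of `T = T_{ij}` with outward normal
`(σ, 0)`, and `⟨·⟩` denotes means. -/
noncomputable def edgeResidual (M : Mesh n m) (ρ a : ℝ) (D : ℕ → ℕ → ℝ × ℝ → ℝ) (w : WeakFun n m)
    (i : Fin n) (j : Fin m) (k : Fin (n + 1)) (σ : ℝ) : ℝ :=
  ρ * M.size⁻¹ * edgeJump M w i j k -
    σ * a * (M.edgeMean j (D 1 0) (D 2 0) k - M.Qh i j (D 1 0))

/-- On the vertical edges of `T_{ij}`, `w_b` is the perturbed mean. -/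
def HasPerturbedMeans (M : Mesh n m) (ρ a' : ℝ) (D : ℕ → ℕ → ℝ × ℝ → ℝ) (w : WeakFun n m)
    (i : Fin n) (j : Fin m) : Prop :=
  ∀ k σ, IsSide i k σ → w.vV k j = M.perturbedMean D j ρ a' k

/-- The constant in the estimate of the residual of the stabilizer on an edge. -/
noncomputable def edgeConst (ρ Λ : ℝ) : ℝ := 3 * (Λ ^ 2 / 4 + Λ ^ 2 + 4 * ρ ^ 2)

/-- On the vertical edges of `T_{ij}`, the residual of the stabilizer is of second order. -/
def HasSmallResiduals (M : Mesh n m) (ρ a Λ : ℝ) (D : ℕ → ℕ → ℝ × ℝ → ℝ) (w : WeakFun n m)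
    (i : Fin n) (j : Fin m) : Prop :=
  ∀ k σ, IsSide i k σ → M.hy j * M.size * edgeResidual M ρ a D w i j k σ ^ 2 ≤
    edgeConst ρ Λ * M.size ^ 4 * M.seminormSq D i j

/-- The constant in the estimate of the perturbation of the discrete gradient. -/
noncomputable def gradConst (ρ Λ : ℝ) : ℝ := (1 + 6 * ρ⁻¹ * Λ) ^ 2

section Residuals

variable {M : Mesh n m} {ρ a a' Λ : ℝ} {D : ℕ → ℕ → ℝ × ℝ → ℝ} {w : WeakFun n m}
  {i : Fin n} {j : Fin m} {k : Fin (n + 1)} {σ δ : ℝ}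

theorem edgeResidual_eq (hρ : 0 < ρ) (hk : IsSide i k σ)
    (hjump : edgeJump M w i j k = M.perturbedMean D j ρ a' k -
      (M.correctedMean D j k - M.residualShift D i j ρ a a' - δ)) :
    edgeResidual M ρ a D w i j k σ =
      a' * (M.hy j / 2) * (M.Qh i j (D 0 2) - M.edgeMean j (D 0 2) (D 1 2) k) -
        σ * a * (M.edgeMean j (D 1 0) (D 2 0) k - M.Qh i j (D 1 0) -
          σ * M.hx i / 2 * M.Qh i j (D 2 0)) + ρ * M.size⁻¹ * δ := by
  have hsize := (M.size_pos i j).ne'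
  rw [edgeResidual, hjump, Mesh.perturbedMean, Mesh.correctedMean, Mesh.residualShift]
  rcases hk with ⟨-, rfl⟩ | ⟨-, rfl⟩ <;> field_simp <;> ring

theorem Mesh.hy_mul_sq_le (M : Mesh n m) (i : Fin n) (j : Fin m) {X N : ℝ} {r : ℕ} (hN : 0 ≤ N)
    (h : X ^ 2 * M.area i j ≤ M.hx i ^ (r + 1) * N) : M.hy j * X ^ 2 ≤ M.size ^ r * N := by
  have hx := M.hx_pos i
  have hcancel : M.hx i * (M.hy j * X ^ 2) ≤ M.hx i * (M.hx i ^ r * N) := by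
    rw [Mesh.area, pow_succ (M.hx i)] at h
    linarith
  refine (le_of_mul_le_mul_left hcancel hx).trans ?_
  gcongr
  exact M.hx_le_size i j

theorem IsJet.sq_edgeResidual_le (h : IsJet 3 D) (hρ : 0 < ρ) (ha : a ∈ Icc 0 Λ)
    (ha' : a' ∈ Icc 0 Λ) (hk : IsSide i k σ)
    (hjump : edgeJump M w i j k = M.perturbedMean D j ρ a' k -
      (M.correctedMean D j k - M.residualShift D i j ρ a a' - δ))
    (hδ : δ ^ 2 * M.area i j ≤ M.hx i ^ 6 * (4 * M.seminormSq D i j)) :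
    M.hy j * M.size * edgeResidual M ρ a D w i j k σ ^ 2 ≤
      edgeConst ρ Λ * M.size ^ 4 * M.seminormSq D i j := by
  obtain ⟨ha, haΛ⟩ := ha
  obtain ⟨ha', haΛ'⟩ := ha'
  have hsize := M.size_pos i j
  have hy := M.hy_pos j
  have hyh := M.hy_le_size i j
  have hN := M.seminormSq_nonneg D i j
  have hσ : σ ^ 2 = 1 := by rcases hk with ⟨-, rfl⟩ | ⟨-, rfl⟩ <;> norm_num
  have htangential := M.hy_mul_sq_le i j (r := 1) hN
    ((HasWeakDx.sq_edgeMean_sub_mul_area_le (h.hasWeakDx 0 2 (by decide)) hk).trans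
      (mul_le_mul_of_nonneg_left (M.integral_sq_le_seminormSq i j rfl) (sq_nonneg _)))
  have hnormal := M.hy_mul_sq_le i j (r := 3) hN
    ((HasWeakDx.sq_edgeMean_sub_sub_mul_area_le (h.hasWeakDx 1 0 (by decide))
      (h.hasWeakDx 2 0 (by decide)) hk).trans
      (mul_le_mul_of_nonneg_left (M.integral_sq_le_seminormSq i j rfl) (by positivity)))
  have hdefect := M.hy_mul_sq_le i j (r := 5) (by positivity) hδ
  rw [edgeResidual_eq hρ hk hjump]
  rw [← neg_sub (M.Qh i j (D 0 2)), neg_sq] at htangential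
  set X := M.Qh i j (D 0 2) - M.edgeMean j (D 0 2) (D 1 2) k
  set Y := M.edgeMean j (D 1 0) (D 2 0) k - M.Qh i j (D 1 0) - σ * M.hx i / 2 * M.Qh i j (D 2 0)
  have three_term (x y z : ℝ) : (x - y + z) ^ 2 ≤ 3 * (x ^ 2 + y ^ 2 + z ^ 2) := by
    linarith [sq_nonneg (x + y), sq_nonneg (y + z), sq_nonneg (x - z)]
  calc M.hy j * M.size *
        (a' * (M.hy j / 2) * X - σ * a * Y + ρ * M.size⁻¹ * δ) ^ 2
      ≤ M.hy j * M.size * (3 * ((a' * (M.hy j / 2) * X) ^ 2 + (σ * a * Y) ^ 2 +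
          (ρ * M.size⁻¹ * δ) ^ 2)) := by
        gcongr
        exact three_term _ _ _
    _ = 3 * M.size * (a' ^ 2 * M.hy j ^ 2 / 4 * (M.hy j * X ^ 2) +
          a ^ 2 * (M.hy j * Y ^ 2) * σ ^ 2 + ρ ^ 2 * M.size⁻¹ ^ 2 * (M.hy j * δ ^ 2)) := by ring
    _ ≤ 3 * M.size * (Λ ^ 2 * M.size ^ 2 / 4 * (M.size ^ 1 * M.seminormSq D i j) +
          Λ ^ 2 * (M.size ^ 3 * M.seminormSq D i j) * σ ^ 2 +
          ρ ^ 2 * M.size⁻¹ ^ 2 * (M.size ^ 5 * (4 * M.seminormSq D i j))) := by gcongr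
    _ = edgeConst ρ Λ * M.size ^ 4 * M.seminormSq D i j := by
        rw [hσ, edgeConst]
        field_simp

theorem IsJet.exists_affine_hasSmallResiduals (h : IsJet 3 D) (hρ : 0 < ρ) (ha : a ∈ Icc 0 Λ)
    (ha' : a' ∈ Icc 0 Λ) (M : Mesh n m) (i : Fin n) (j : Fin m) :
    ∃ F : ℝ × ℝ →ᵃ[ℝ] ℝ, ∀ w : WeakFun n m, w.v0 i j = F →
      HasPerturbedMeans M ρ a' D w i j → HasPerturbedMeans M.swap ρ a (swapJet D) w.swap j i →
      HasSmallResiduals M ρ a Λ D w i j ∧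
        HasSmallResiduals M.swap ρ a' Λ (swapJet D) w.swap j i := by
  obtain ⟨δ, δ', hsum, hδ, hδ'⟩ := h.exists_defects M i j
  set κ := M.residualShift D i j ρ a a' with hκ
  obtain ⟨F, hW, hE, hS, hN⟩ := M.exists_affine_edgeMeans i j
    (mW := M.correctedMean D j i.castSucc - κ - δ) (mE := M.correctedMean D j i.succ - κ - δ)
    (mS := M.swap.correctedMean (swapJet D) i j.castSucc - κ - δ')
    (mN := M.swap.correctedMean (swapJet D) i j.succ - κ - δ') (by linarith)
  rw [← M.area_swap, ← M.seminormSq_swap] at hδ'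
  refine ⟨F, fun w hw hV hH => ⟨fun k σ hk => h.sq_edgeResidual_le hρ ha ha' hk ?_ hδ,
    fun k σ hk => h.swap.sq_edgeResidual_le (M := M.swap) hρ ha' ha hk ?_ hδ'⟩⟩
  · rw [edgeJump, hV k σ hk, hw]
    rcases hk with ⟨rfl, -⟩ | ⟨rfl, -⟩
    · rw [hW]
    · rw [hE]
  · have hedge : M.swap.QbV k i (w.swap.v0 j i) = M.QbH i k F := by
      rw [← hw]
      rfl
    rw [edgeJump, hH k σ hk, hedge, M.residualShift_swap]
    rcases hk with ⟨rfl, -⟩ | ⟨rfl, -⟩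
    · rw [hS]
    · rw [hN]

theorem IsJet.weakGrad_fst_sub_eq (h : IsJet 3 D) (hw : HasPerturbedMeans M ρ a' D w i j) :
    (weakGrad M w i j).1 - M.Qh i j (D 1 0) =
      1 / 12 * M.hy j * (M.hy j - 6 * ρ⁻¹ * a' * M.size) * M.Qh i j (D 1 2) := by
  have hmean := HasWeakDx.edgeMean_sub (M := M) (i := i) (j := j) (h.hasWeakDx 0 0 (by decide))
  have htangential := HasWeakDx.edgeMean_sub (M := M) (i := i) (j := j)
    (h.hasWeakDx 0 2 (by decide))
  refine mul_left_cancel₀ (M.hx_pos i).ne' ?_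
  rw [mul_sub, hx_mul_weakGrad_fst, hw _ _ (Or.inl ⟨rfl, rfl⟩), hw _ _ (Or.inr ⟨rfl, rfl⟩),
    Mesh.perturbedMean, Mesh.perturbedMean]
  linear_combination
    hmean + 1 / 12 * M.hy j * (M.hy j - 6 * ρ⁻¹ * a' * M.size) * htangential

theorem IsJet.area_mul_sq_weakGrad_sub_le (h : IsJet 3 D) (hρ : 0 < ρ)
    (ha' : a' ∈ Icc 0 Λ) (hw : HasPerturbedMeans M ρ a' D w i j) :
    M.area i j * ((weakGrad M w i j).1 - M.Qh i j (D 1 0)) ^ 2 ≤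
      gradConst ρ Λ * M.size ^ 4 * M.seminormSq D i j := by
  obtain ⟨ha', haΛ'⟩ := ha'
  have hsize := M.size_pos i j
  have hy := M.hy_pos j
  have hyh := M.hy_le_size i j
  have hN := M.seminormSq_nonneg D i j
  have hA := M.area_pos i j
  rw [h.weakGrad_fst_sub_eq hw]
  set c := M.hy j - 6 * ρ⁻¹ * a' * M.size
  have hc : c ^ 2 ≤ ((1 + 6 * ρ⁻¹ * Λ) * M.size) ^ 2 := by
    have hpos : 0 ≤ 6 * ρ⁻¹ * a' * M.size := by positivity
    have hle : 6 * ρ⁻¹ * a' * M.size ≤ 6 * ρ⁻¹ * Λ * M.size := by gcongr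
    exact sq_le_sq' (by linarith) (by linarith)
  have hmixed := (sq_Qh_mul_area_le (M := M) (i := i) (j := j) (h.memLp 1 2 (by decide))).trans
    (M.integral_sq_le_seminormSq i j rfl)
  calc M.area i j * (1 / 12 * M.hy j * c * M.Qh i j (D 1 2)) ^ 2
      = 1 / 144 * M.hy j ^ 2 * c ^ 2 * (M.Qh i j (D 1 2) ^ 2 * M.area i j) := by ring
    _ ≤ 1 / 144 * M.size ^ 2 * ((1 + 6 * ρ⁻¹ * Λ) * M.size) ^ 2 * M.seminormSq D i j := by gcongr
    _ = 1 / 144 * (gradConst ρ Λ * M.size ^ 4 * M.seminormSq D i j) := by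
        rw [gradConst]
        ring
    _ ≤ gradConst ρ Λ * M.size ^ 4 * M.seminormSq D i j := by
        have : 0 ≤ gradConst ρ Λ * M.size ^ 4 * M.seminormSq D i j := by
          rw [gradConst]
          positivity
        linarith

end Residuals

/-! ### The estimate on one element -/

/-- The part of the energy norm on `T_{ij}` that belongs to the first coordinate direction. -/
noncomputable def energyX (M : Mesh n m) (v : WeakFun n m) (i : Fin n) (j : Fin m) : ℝ :=
  M.area i j * (weakGrad M v i j).1 ^ 2 + M.size⁻¹ *
    (M.hy j * (edgeJump M v i j i.castSucc ^ 2 + edgeJump M v i j i.succ ^ 2))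

/-- The part of the weak Galerkin form on `T_{ij}` that belongs to the first coordinate direction,
where `a` is the value of `a₁₁`. -/
noncomputable def formX (M : Mesh n m) (ρ a : ℝ) (w v : WeakFun n m) (i : Fin n) (j : Fin m) : ℝ :=
  M.area i j * (a * (weakGrad M w i j).1 * (weakGrad M v i j).1) + ρ * M.size⁻¹ *
    (M.hy j * (edgeJump M w i j i.castSucc * edgeJump M v i j i.castSucc) +
      M.hy j * (edgeJump M w i j i.succ * edgeJump M v i j i.succ))

/-- The pairing of `a ∂_x u` with `v_b` on the vertical edges of `T_{ij}`, where `D` is the jet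
of `u`. -/
noncomputable def fluxX (M : Mesh n m) (a : ℝ) (D : ℕ → ℕ → ℝ × ℝ → ℝ) (v : WeakFun n m)
    (i : Fin n) (j : Fin m) : ℝ :=
  a * (M.hy j * M.edgeMean j (D 1 0) (D 2 0) i.succ * v.vV i.succ j -
    M.hy j * M.edgeMean j (D 1 0) (D 2 0) i.castSucc * v.vV i.castSucc j)

/-- The constant in the estimate of the consistency error on an element. -/
noncomputable def elemConst (κ ρ Λ : ℝ) : ℝ :=
  κ⁻¹ * (Λ ^ 2 * gradConst ρ Λ + 2 * edgeConst ρ Λ + 3 * Λ ^ 2)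

section ElementEstimate

variable {M : Mesh n m} {ρ a a' Λ κ : ℝ} {D : ℕ → ℕ → ℝ × ℝ → ℝ} {w v : WeakFun n m}
  {i : Fin n} {j : Fin m}

theorem hx_mul_linear_fst (M : Mesh n m) (v : WeakFun n m) (i : Fin n) (j : Fin m) :
    M.hx i * (v.v0 i j).linear (1, 0) =
      M.hx i * (weakGrad M v i j).1 - (edgeJump M v i j i.succ - edgeJump M v i j i.castSucc) := by
  have haffine := affine_apply (v.v0 i j) (M.x i.succ, M.swap.xMid j)
    (M.x i.castSucc, M.swap.xMid j)
  rw [hx_mul_weakGrad_fst, edgeJump, edgeJump, M.QbV_affine, M.QbV_affine, haffine, Mesh.hx]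
  ring

theorem HasWeakDx.integral_mul_affine {f z : ℝ × ℝ → ℝ} (h : HasWeakDx f z) (M : Mesh n m)
    (i : Fin n) (j : Fin m) (F : ℝ × ℝ →ᵃ[ℝ] ℝ) :
    ∫ q in M.elem i j, z q * F q =
      M.hy j * M.edgeMean j f z i.succ * M.QbV i.succ j F -
          M.hy j * M.edgeMean j f z i.castSucc * M.QbV i.castSucc j F -
        F.linear (1, 0) * (M.area i j * M.Qh i j f) +
      F.linear (0, 1) * ∫ q in M.elem i j, z q * (q.2 - M.swap.xMid j) := by
  set β := F.linear (1, 0)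
  set γ := F.linear (0, 1)
  set c : ℝ × ℝ := (M.xMid i, M.swap.xMid j)
  have hF : ∀ q : ℝ × ℝ, F q = F c + β * (q.1 - M.xMid i) + γ * (q.2 - M.swap.xMid j) :=
    fun q => affine_apply F q c
  have key := h.Qh_mul_deriv_add (M := M) (i := i) (j := j)
    (p := fun x => F c + β * (x - M.xMid i)) (p' := fun _ => β) (by fun_prop) (by ext; simp)
  have hsplit : ∫ q in M.elem i j, z q * F q =
      (∫ q in M.elem i j, z q * (F c + β * (q.1 - M.xMid i))) +
        γ * ∫ q in M.elem i j, z q * (q.2 - M.swap.xMid j) := by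
    rw [← integral_const_mul, ← integral_add
      (M.integrableOn_elem_mul i j h.integrable_deriv (by fun_prop))
      ((M.integrableOn_elem_mul i j h.integrable_deriv (by fun_prop)).const_mul γ)]
    refine integral_congr_ae (ae_of_all _ fun q => ?_)
    simp only [hF q]
    ring
  have hconst : M.area i j * M.Qh i j (fun q => f q * β) = β * (M.area i j * M.Qh i j f) := by
    rw [M.area_mul_Qh, M.area_mul_Qh, integral_mul_const, mul_comm]
  have hedge (k : Fin (n + 1)) : M.QbV k j F = F c + β * (M.x k - M.xMid i) := by
    rw [M.QbV_affine, hF, sub_self, mul_zero, add_zero]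
  rw [hsplit, hedge, hedge, ← M.area_mul_Qh, ← hconst, Mesh.area]
  linear_combination M.hy j * key

/-- Integration by parts on the element turns the consistency error into the residuals. -/
theorem IsJet.formX_add_eq (h : IsJet 3 D) (M : Mesh n m) (ρ a : ℝ) (w v : WeakFun n m)
    (i : Fin n) (j : Fin m) :
    formX M ρ a w v i j + a * ((∫ q in M.elem i j, D 2 0 q * v.v0 i j q) -
        (v.v0 i j).linear (0, 1) * ∫ q in M.elem i j, D 2 0 q * (q.2 - M.swap.xMid j)) =
      fluxX M a D v i j +
        (M.area i j * (a * ((weakGrad M w i j).1 - M.Qh i j (D 1 0)) * (weakGrad M v i j).1) +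
        M.hy j * (edgeResidual M ρ a D w i j i.castSucc (-1) * edgeJump M v i j i.castSucc +
          edgeResidual M ρ a D w i j i.succ 1 * edgeJump M v i j i.succ)) := by
  have hparts := HasWeakDx.integral_mul_affine (h.hasWeakDx 1 0 (by decide)) M i j (v.v0 i j)
  have hlinear := hx_mul_linear_fst M v i j
  have hjump (k : Fin (n + 1)) : v.vV k j = edgeJump M v i j k + M.QbV k j (v.v0 i j) :=
    (sub_add_cancel _ _).symm
  rw [hparts, formX, fluxX, edgeResidual, edgeResidual, hjump i.castSucc, hjump i.succ, Mesh.area]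
  linear_combination a * M.Qh i j (D 1 0) * M.hy j * (-hlinear)

theorem young_weighted {κ w : ℝ} (hκ : 0 < κ) (hw : 0 < w) (x y : ℝ) :
    x * y ≤ κ / 4 * (w * x ^ 2) + y ^ 2 / (κ * w) := by
  have hsquare : κ / 4 * (w * x ^ 2) + y ^ 2 / (κ * w) - x * y =
      (κ * w * x / 2 - y) ^ 2 / (κ * w) := by
    field_simp
    ring
  have hnonneg : 0 ≤ (κ * w * x / 2 - y) ^ 2 / (κ * w) := by positivity
  linarith

theorem pairing_le_energyX (M : Mesh n m) (v : WeakFun n m) (i : Fin n) (j : Fin m) (hκ : 0 < κ)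
    (δ r s : ℝ) :
    M.area i j * (δ * (weakGrad M v i j).1) +
        M.hy j * (r * edgeJump M v i j i.castSucc + s * edgeJump M v i j i.succ) ≤
      κ / 4 * energyX M v i j +
        κ⁻¹ * (M.area i j * δ ^ 2 + M.hy j * M.size * r ^ 2 + M.hy j * M.size * s ^ 2) := by
  have hA := M.area_pos i j
  have hy := M.hy_pos j
  have hsize := M.size_pos i j
  have hweight : 0 < M.size⁻¹ * M.hy j := by positivity
  have hgrad := young_weighted hκ hA (weakGrad M v i j).1 (M.area i j * δ)
  have hwest := young_weighted hκ hweight (edgeJump M v i j i.castSucc) (M.hy j * r)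
  have heast := young_weighted hκ hweight (edgeJump M v i j i.succ) (M.hy j * s)
  have hdual_area : (M.area i j * δ) ^ 2 / (κ * M.area i j) = κ⁻¹ * (M.area i j * δ ^ 2) := by
    field_simp
  have hdual_edge (t : ℝ) : (M.hy j * t) ^ 2 / (κ * (M.size⁻¹ * M.hy j)) =
      κ⁻¹ * (M.hy j * M.size * t ^ 2) := by
    field_simp
  rw [hdual_area] at hgrad
  rw [hdual_edge] at hwest heast
  rw [energyX]
  linarith

theorem IsJet.residual_pairing_le (h : IsJet 3 D) (hρ : 0 < ρ) (hκ : 0 < κ) (ha : a ∈ Icc 0 Λ)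
    (ha' : a' ∈ Icc 0 Λ) (hw : HasPerturbedMeans M ρ a' D w i j)
    (hr : HasSmallResiduals M ρ a Λ D w i j) :
    M.area i j * (a * ((weakGrad M w i j).1 - M.Qh i j (D 1 0)) * (weakGrad M v i j).1) +
        M.hy j * (edgeResidual M ρ a D w i j i.castSucc (-1) * edgeJump M v i j i.castSucc +
          edgeResidual M ρ a D w i j i.succ 1 * edgeJump M v i j i.succ) ≤
      κ / 4 * energyX M v i j + κ⁻¹ * (Λ ^ 2 * gradConst ρ Λ + 2 * edgeConst ρ Λ) *
        M.size ^ 4 * M.seminormSq D i j := by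
  obtain ⟨ha, haΛ⟩ := ha
  have hA := M.area_pos i j
  have hgrad : M.area i j * (a * ((weakGrad M w i j).1 - M.Qh i j (D 1 0))) ^ 2 ≤
      Λ ^ 2 * (gradConst ρ Λ * M.size ^ 4 * M.seminormSq D i j) := by
    rw [mul_pow, mul_left_comm]
    exact mul_le_mul (pow_le_pow_left₀ ha haΛ 2) (h.area_mul_sq_weakGrad_sub_le hρ ha' hw)
      (by positivity) (by positivity)
  have hwest := hr i.castSucc (-1) (Or.inl ⟨rfl, rfl⟩)
  have heast := hr i.succ 1 (Or.inr ⟨rfl, rfl⟩)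
  refine (pairing_le_energyX M v i j hκ _ _ _).trans ?_
  rw [mul_assoc κ⁻¹, mul_assoc κ⁻¹]
  gcongr κ / 4 * energyX M v i j + κ⁻¹ * ?_
  linarith

theorem IsJet.tangential_moment_le (h : IsJet 3 D) (hκ : 0 < κ) (ha' : a' ∈ Icc 0 Λ) :
    a' * (v.v0 i j).linear (1, 0) * ∫ q in M.elem i j, D 0 2 q * (q.1 - M.xMid i) ≤
      κ / 4 * energyX M v i j + κ⁻¹ * (3 * Λ ^ 2) * M.size ^ 4 * M.seminormSq D i j := by
  obtain ⟨ha', haΛ'⟩ := ha'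
  have hsize := M.size_pos i j
  have hx := M.hx_pos i
  have hN := M.seminormSq_nonneg D i j
  set N := M.seminormSq D i j
  set μ := M.Qh i j (fun q => D 0 2 q * (q.1 - M.xMid i))
  have hμ : μ ^ 2 * M.area i j ≤ M.hx i ^ 4 * N :=
    (HasWeakDx.sq_first_moment_mul_area_le (h.hasWeakDx 0 2 (by decide))).trans
      (mul_le_mul_of_nonneg_left (M.integral_sq_le_seminormSq i j rfl) (by positivity))
  have hgrad : M.area i j * (a' * μ) ^ 2 ≤ Λ ^ 2 * (M.size ^ 4 * N) := by
    calc M.area i j * (a' * μ) ^ 2 = a' ^ 2 * (μ ^ 2 * M.area i j) := by ring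
      _ ≤ a' ^ 2 * (M.hx i ^ 4 * N) := by gcongr
      _ ≤ Λ ^ 2 * (M.size ^ 4 * N) := by
        gcongr
        exact M.hx_le_size i j
  have hjump : M.hy j * M.size * (a' * μ) ^ 2 ≤ Λ ^ 2 * (M.size ^ 4 * N) := by
    have hμy := mul_le_mul_of_nonneg_left (M.hy_mul_sq_le i j hN hμ) hsize.le
    calc M.hy j * M.size * (a' * μ) ^ 2 = a' ^ 2 * (M.size * (M.hy j * μ ^ 2)) := by ring
      _ ≤ a' ^ 2 * (M.size * (M.size ^ 3 * N)) := mul_le_mul_of_nonneg_left hμy (sq_nonneg _)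
      _ = a' ^ 2 * (M.size ^ 4 * N) := by ring
      _ ≤ Λ ^ 2 * (M.size ^ 4 * N) := by gcongr
  have hpairing := pairing_le_energyX M v i j hκ (a' * μ) (a' * μ) (-(a' * μ))
  have hlinear := hx_mul_linear_fst M v i j
  have hdual := mul_le_mul_of_nonneg_left (add_le_add_three hgrad hjump hjump)
    (inv_nonneg.2 hκ.le)
  rw [neg_sq] at hpairing
  rw [← M.area_mul_Qh, Mesh.area] at *
  linear_combination hpairing + hdual + a' * M.hy j * μ * hlinear

theorem IsJet.formX_add_le (h : IsJet 3 D) (hρ : 0 < ρ) (hκ : 0 < κ) (ha : a ∈ Icc 0 Λ)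
    (ha' : a' ∈ Icc 0 Λ) (hw : HasPerturbedMeans M ρ a' D w i j)
    (hr : HasSmallResiduals M ρ a Λ D w i j) :
    formX M ρ a w v i j + a * ((∫ q in M.elem i j, D 2 0 q * v.v0 i j q) -
          (v.v0 i j).linear (0, 1) * ∫ q in M.elem i j, D 2 0 q * (q.2 - M.swap.xMid j)) +
        a' * (v.v0 i j).linear (1, 0) * ∫ q in M.elem i j, D 0 2 q * (q.1 - M.xMid i) ≤
      fluxX M a D v i j + κ / 2 * energyX M v i j +
        elemConst κ ρ Λ * M.size ^ 4 * M.seminormSq D i j := by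
  have hresidual := h.residual_pairing_le (v := v) hρ hκ ha ha' hw hr
  have hmoment := h.tangential_moment_le (M := M) (v := v) (i := i) (j := j) hκ ha'
  rw [h.formX_add_eq, elemConst]
  linarith

/-- The moments that are not controlled in one coordinate direction are those that are added in the
other one. -/
theorem IsJet.localForm_le (h : IsJet 3 D) (hρ : 0 < ρ) (hκ : 0 < κ) (ha : a ∈ Icc 0 Λ)
    (ha' : a' ∈ Icc 0 Λ) {f : ℝ × ℝ → ℝ}
    (hf : ∀ᵐ p ∂volume.restrict (M.elem i j), f p + a * D 2 0 p + a' * D 0 2 p = 0)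
    (hwV : HasPerturbedMeans M ρ a' D w i j)
    (hwH : HasPerturbedMeans M.swap ρ a (swapJet D) w.swap j i)
    (hrV : HasSmallResiduals M ρ a Λ D w i j)
    (hrH : HasSmallResiduals M.swap ρ a' Λ (swapJet D) w.swap j i) :
    formX M ρ a w v i j + formX M.swap ρ a' w.swap v.swap j i ≤
      (∫ p in M.elem i j, f p * v.v0 i j p) +
        (fluxX M a D v i j + fluxX M.swap a' (swapJet D) v.swap j i) +
        κ / 2 * (energyX M v i j + energyX M.swap v.swap j i) +
        2 * elemConst κ ρ Λ * M.size ^ 4 * M.seminormSq D i j := by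
  have hX := h.formX_add_le (v := v) hρ hκ ha ha' hwV hrV
  have hY := h.swap.formX_add_le (v := v.swap) hρ hκ ha' ha hwH hrH
  rw [M.seminormSq_swap, M.size_swap] at hY
  have hload := M.setIntegral_elem_swap i j fun q => D 0 2 q * v.v0 i j q
  have hmoment := M.setIntegral_elem_swap i j fun q => D 0 2 q * (q.1 - M.xMid i)
  have hmoment' := M.setIntegral_elem_swap i j fun q => D 2 0 q * (q.2 - M.swap.xMid j)
  have hlinear_fst : (v.swap.v0 j i).linear (1, 0) = (v.v0 i j).linear (0, 1) := rfl
  have hlinear_snd : (v.swap.v0 j i).linear (0, 1) = (v.v0 i j).linear (1, 0) := rfl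
  have hequation : ∫ p in M.elem i j, f p * v.v0 i j p =
      -a * (∫ q in M.elem i j, D 2 0 q * v.v0 i j q) +
        -a' * ∫ q in M.elem i j, D 0 2 q * v.v0 i j q := by
    have hv : Continuous (v.v0 i j) := (v.v0 i j).continuous_of_finiteDimensional
    have hxx := M.integrableOn_elem_mul i j ((h.memLp 2 0 (by decide)).integrable one_le_two) hv
    have hyy := M.integrableOn_elem_mul i j ((h.memLp 0 2 (by decide)).integrable one_le_two) hv
    rw [← integral_const_mul, ← integral_const_mul,
      ← integral_add (hxx.const_mul (-a)) (hyy.const_mul (-a'))]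
    refine integral_congr_ae (hf.mono fun p hp => ?_)
    linear_combination v.v0 i j p * hp
  rw [hlinear_fst, hlinear_snd] at hY
  change formX M.swap ρ a' w.swap v.swap j i +
    a' * ((∫ q in M.swap.elem j i, D 0 2 q.swap * v.v0 i j q.swap) -
      (v.v0 i j).linear (1, 0) * ∫ q in M.swap.elem j i, D 0 2 q.swap * (q.swap.1 - M.xMid i)) +
    a * (v.v0 i j).linear (0, 1) *
      ∫ q in M.swap.elem j i, D 2 0 q.swap * (q.swap.2 - M.swap.xMid j) ≤ _ at hY
  rw [hload, hmoment, hmoment'] at hY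
  rw [hequation]
  linarith

end ElementEstimate

/-! ### Boundary values and single-valued edge values -/

section Congruence

variable {u u' : ℝ × ℝ → ℝ}

theorem weakDeriv_congr_ae (h : u =ᵐ[muOmega] u') (i j : ℕ) :
    weakDeriv i j u = weakDeriv i j u' := by
  have hiff : IsWeakDeriv i j u = IsWeakDeriv i j u' := by
    funext v
    have hint (φ : ℝ × ℝ → ℝ) : ∫ p in Omega, u p * φ p = ∫ p in Omega, u' p * φ p :=
      integral_congr_ae (h.mono fun p hp => congrArg (· * φ p) hp)
    simp only [IsWeakDeriv, hint]
  rw [weakDeriv, hiff, weakDeriv]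

theorem TendstoH1.congr_ae {φ : ℕ → ℝ × ℝ → ℝ} (hφ : TendstoH1 φ u) (h : u =ᵐ[muOmega] u') :
    TendstoH1 φ u' := by
  obtain ⟨hsmooth, hlim, hlimx, hlimy⟩ := hφ
  rw [weakDeriv_congr_ae h] at hlimx hlimy
  exact ⟨hsmooth, hlim.congr fun k => eLpNorm_congr_ae ((ae_eq_refl (φ k)).sub h), hlimx, hlimy⟩

theorem HasBoundaryValue.congr_ae {g : ℝ × ℝ → ℝ} (hg : HasBoundaryValue u g)
    (h : u =ᵐ[muOmega] u') : HasBoundaryValue u' g := by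
  obtain ⟨⟨hW, φW, hφW, hlimW⟩, ⟨hE, φE, hφE, hlimE⟩, ⟨hS, φS, hφS, hlimS⟩,
    hN, φN, hφN, hlimN⟩ := hg
  exact ⟨⟨hW, φW, hφW.congr_ae h, hlimW⟩, ⟨hE, φE, hφE.congr_ae h, hlimE⟩,
    ⟨hS, φS, hφS.congr_ae h, hlimS⟩, hN, φN, hφN.congr_ae h, hlimN⟩

end Congruence

section EdgeValues

variable {M : Mesh n m} {ρ : ℝ} {a11 a22 : Fin n → Fin m → ℝ} {D : ℕ → ℕ → ℝ × ℝ → ℝ}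
  {g gxx gyy : ℝ × ℝ → ℝ} {uh w : WeakFun n m} {j : Fin m} {k : Fin (n + 1)}

theorem Mesh.average_eq_edgeMean (M : Mesh n m) (j : Fin m) {τ : ℝ → ℝ} {f z : ℝ × ℝ → ℝ}
    (h : τ =ᵐ[volume.restrict (Ioo 0 1)] traceAt f z (M.x k)) :
    ⨍ t in M.y j.castSucc..M.y j.succ, τ t = M.edgeMean j f z k := by
  rw [Mesh.edgeMean, interval_average_eq, interval_average_eq,
    intervalIntegral.integral_of_le (M.y_lt j).le, intervalIntegral.integral_of_le (M.y_lt j).le,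
    integral_Ioc_eq_integral_Ioo, integral_Ioc_eq_integral_Ioo,
    integral_congr_ae (ae_mono (Measure.restrict_mono (M.Ioo_y_subset j) le_rfl) h)]

theorem IsJet.average_eq_perturbedMean (h : IsJet 3 D) (M : Mesh n m) (ρ a' : ℝ) (j : Fin m)
    (hg : (fun y => g (M.x k, y)) =ᵐ[volume.restrict (Ioo 0 1)]
      traceAt (D 0 0) (D 1 0) (M.x k))
    (hgyy : IsWeakSecondDeriv (fun y => g (M.x k, y)) fun y => gyy (M.x k, y)) :
    M.QbV k j g + 1 / 12 * M.hy j * (M.hy j - 6 * ρ⁻¹ * a' * M.size) * M.QbV k j gyy =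
      M.perturbedMean D j ρ a' k := by
  have hyy := hgyy.ae_eq_traceAt hg (h.hasWeakDy 0 0 (by decide)) (h.hasWeakDy 0 1 (by decide))
    (h.hasWeakDy 1 0 (by decide)) (h.hasWeakDy 1 1 (by decide))
  rw [Mesh.QbV, Mesh.QbV, M.average_eq_edgeMean j hg, M.average_eq_edgeMean j hyy,
    Mesh.perturbedMean]

theorem HasPerturbedBoundaryValue.vV_eq (hb : HasPerturbedBoundaryValue M ρ a11 a22 g gxx gyy uh)
    (h : IsJet 3 D) (hg : HasBoundaryValue (D 0 0) g) (hgg : IsTangentialSecondDeriv g gxx gyy)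
    (i : Fin n) (j : Fin m) (k : Fin (n + 1))
    (hk : (k = 0 ∧ k = i.castSucc) ∨ (k = Fin.last n ∧ k = i.succ)) :
    uh.vV k j = M.perturbedMean D j ρ (a22 i j) k := by
  have hside : M.x k = 0 ∨ M.x k = 1 := by
    rcases hk with ⟨hk, -⟩ | ⟨hk, -⟩
    exacts [Or.inl (hk ▸ M.x_zero), Or.inr (hk ▸ M.x_last)]
  have htrace : IsTraceV (D 0 0) (M.x k) fun y => g (M.x k, y) := by
    rcases hside with hx | hx <;> rw [hx]
    exacts [hg.1, hg.2.1]
  rw [hb.1 i j k hk]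
  exact h.average_eq_perturbedMean M ρ _ j
    ((h.hasWeakDx 0 0 (by decide)).ae_eq_traceAt (M.x_mem k) htrace) (hgg.1 _ hside)

theorem HasPerturbedBoundaryValue.vH_eq (hb : HasPerturbedBoundaryValue M ρ a11 a22 g gxx gyy uh)
    (h : IsJet 3 D) (hg : HasBoundaryValue (D 0 0) g) (hgg : IsTangentialSecondDeriv g gxx gyy)
    (j : Fin m) (i : Fin n) (k : Fin (m + 1))
    (hk : (k = 0 ∧ k = j.castSucc) ∨ (k = Fin.last m ∧ k = j.succ)) :
    uh.vH i k = M.swap.perturbedMean (swapJet D) i ρ (a11 i j) k := by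
  have hside : M.y k = 0 ∨ M.y k = 1 := by
    rcases hk with ⟨hk, -⟩ | ⟨hk, -⟩
    exacts [Or.inl (hk ▸ M.y_zero), Or.inr (hk ▸ M.y_last)]
  have htrace : IsTraceH (D 0 0) (M.y k) fun x => g (x, M.y k) := by
    rcases hside with hy | hy <;> rw [hy]
    exacts [hg.2.2.1, hg.2.2.2]
  rw [hb.2 i j k hk, ← M.size_swap]
  exact h.swap.average_eq_perturbedMean (g := fun p => g p.swap) (gyy := fun p => gxx p.swap)
    M.swap ρ _ i ((h.hasWeakDy 0 0 (by decide)).ae_eq_traceAt (M.y_mem k) htrace) (hgg.2 _ hside)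

theorem exists_node_values {φ : Fin n → Fin (n + 1) → ℝ}
    (h : ∀ i i' : Fin n, i'.val = i.val + 1 → φ i i.succ = φ i' i.succ) :
    ∃ p : Fin (n + 1) → ℝ, ∀ i k σ, IsSide i k σ → p k = φ i k := by
  cases n with
  | zero => exact ⟨fun _ => 0, fun i => i.elim0⟩
  | succ n =>
    refine ⟨Fin.cases (φ 0 0) fun i => φ i i.succ, fun i k σ hk => ?_⟩
    rcases hk with ⟨rfl, -⟩ | ⟨rfl, -⟩
    · refine Fin.cases rfl (fun l => ?_) i
      rw [Fin.castSucc_succ]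
      exact h _ _ (by simp)
    · rfl

theorem Mesh.exists_vertical_values (M : Mesh n m) (ρ : ℝ) (D : ℕ → ℕ → ℝ × ℝ → ℝ)
    (h : ∀ (i i' : Fin n) (j : Fin m), i'.val = i.val + 1 → a22 i j ≠ a22 i' j →
      M.edgeMean j (D 0 2) (D 1 2) i.succ = 0) :
    ∃ p : Fin (n + 1) → Fin m → ℝ, ∀ i j k σ, IsSide i k σ →
      p k j = M.perturbedMean D j ρ (a22 i j) k := by
  have hsingle (j : Fin m) (i i' : Fin n) (hi : i'.val = i.val + 1) :
      M.perturbedMean D j ρ (a22 i j) i.succ = M.perturbedMean D j ρ (a22 i' j) i.succ := by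
    by_cases ha : a22 i j = a22 i' j
    · rw [ha]
    · rw [Mesh.perturbedMean, Mesh.perturbedMean, h i i' j hi ha, mul_zero, mul_zero]
  choose p hp using fun j => exists_node_values (hsingle j)
  exact ⟨fun k j => p j k, fun i j k σ hk => hp j i k σ hk⟩

end EdgeValues

/-! ### Summation over the elements -/

instance : Sub (WeakFun n m) :=
  ⟨fun w v => ⟨fun i j => w.v0 i j - v.v0 i j, fun k j => w.vV k j - v.vV k j,
    fun i k => w.vH i k - v.vH i k⟩⟩

theorem WeakFun.swap_sub (w v : WeakFun n m) : (w - v).swap = w.swap - v.swap := rfl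

/-- `w` interpolates the jet `D`: on every element, its edge values are the perturbed means and the
residuals of the stabilizer are small. -/
structure IsInterpolant (M : Mesh n m) (ρ Λ : ℝ) (a11 a22 : Fin n → Fin m → ℝ)
    (D : ℕ → ℕ → ℝ × ℝ → ℝ) (w : WeakFun n m) : Prop where
  vV i j : HasPerturbedMeans M ρ (a22 i j) D w i j
  vH i j : HasPerturbedMeans M.swap ρ (a11 i j) (swapJet D) w.swap j i
  residualV i j : HasSmallResiduals M ρ (a11 i j) Λ D w i j
  residualH i j : HasSmallResiduals M.swap ρ (a22 i j) Λ (swapJet D) w.swap j i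

/-- The square of the energy norm, `‖∇_d v‖² + h⁻¹ ‖v_b - Q_b v_0‖²`. -/
noncomputable def energy (M : Mesh n m) (v : WeakFun n m) : ℝ :=
  ∑ i, ∑ j, (energyX M v i j + energyX M.swap v.swap j i)

theorem edgeJump_sub (M : Mesh n m) (w v : WeakFun n m) (i : Fin n) (j : Fin m)
    (k : Fin (n + 1)) : edgeJump M (w - v) i j k = edgeJump M w i j k - edgeJump M v i j k := by
  simp only [edgeJump, M.QbV_affine]
  exact sub_sub_sub_comm _ _ _ _

theorem weakGrad_fst_sub (M : Mesh n m) (w v : WeakFun n m) (i : Fin n) (j : Fin m) :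
    (weakGrad M (w - v) i j).1 = (weakGrad M w i j).1 - (weakGrad M v i j).1 := by
  refine mul_left_cancel₀ (M.hx_pos i).ne' ?_
  rw [mul_sub, hx_mul_weakGrad_fst, hx_mul_weakGrad_fst, hx_mul_weakGrad_fst]
  exact sub_sub_sub_comm _ _ _ _

theorem formX_sub (M : Mesh n m) (ρ a : ℝ) (w w' v : WeakFun n m) (i : Fin n) (j : Fin m) :
    formX M ρ a (w - w') v i j = formX M ρ a w v i j - formX M ρ a w' v i j := by
  simp only [formX, weakGrad_fst_sub, edgeJump_sub]
  ring

theorem sq_weakGrad_le_energyX (M : Mesh n m) (v : WeakFun n m) (i : Fin n) (j : Fin m) :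
    M.area i j * (weakGrad M v i j).1 ^ 2 ≤ energyX M v i j := by
  have hy := M.hy_pos j
  have hsize := M.size_pos i j
  exact le_add_of_nonneg_right (by positivity)

theorem mul_energyX_le_formX (M : Mesh n m) {ρ κ a : ℝ} (hκρ : κ ≤ ρ) (hκa : κ ≤ a)
    (v : WeakFun n m) (i : Fin n) (j : Fin m) : κ * energyX M v i j ≤ formX M ρ a v v i j := by
  have hA := M.area_pos i j
  have hy := M.hy_pos j
  have hsize := M.size_pos i j
  have hgrad : κ * (M.area i j * (weakGrad M v i j).1 ^ 2) ≤
      a * (M.area i j * (weakGrad M v i j).1 ^ 2) := by gcongr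
  have hjump : κ * (M.size⁻¹ * (M.hy j * (edgeJump M v i j i.castSucc ^ 2 +
        edgeJump M v i j i.succ ^ 2))) ≤
      ρ * (M.size⁻¹ * (M.hy j * (edgeJump M v i j i.castSucc ^ 2 +
        edgeJump M v i j i.succ ^ 2))) := by gcongr
  rw [energyX, formX]
  linarith

theorem diffusionForm_add_stabilizer (M : Mesh n m) (ρ : ℝ) (a11 a22 : Fin n → Fin m → ℝ)
    (w v : WeakFun n m) :
    diffusionForm M a11 a22 w v + stabilizer M ρ w v =
      ∑ i, ∑ j, (formX M ρ (a11 i j) w v i j +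
        formX M.swap ρ (a22 i j) w.swap v.swap j i) := by
  have hjump (v : WeakFun n m) (i : Fin n) (j : Fin m) (k : Fin (m + 1)) :
      edgeJump M.swap v.swap j i k = v.vH i k - M.QbH i k (v.v0 i j) := rfl
  have hhy (i : Fin n) : M.swap.hy i = M.hx i := rfl
  simp only [diffusionForm, stabilizer, Finset.mul_sum, ← Finset.sum_add_distrib, formX,
    weakGrad_swap, M.area_swap, M.size_swap, hjump, hhy, Prod.fst_swap]
  refine Finset.sum_congr rfl fun i _ => Finset.sum_congr rfl fun j _ => ?_
  rw [edgeJump, edgeJump, edgeJump, edgeJump]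
  ring

theorem IsFlux.sum_fluxX_eq_zero {M : Mesh n m} {a11 a22 : Fin n → Fin m → ℝ} {f : ℝ × ℝ → ℝ}
    {D : ℕ → ℕ → ℝ × ℝ → ℝ} (h : IsFlux M a11 a22 f (D 1 0) (D 0 1)) (hD : IsJet 3 D)
    (hf : Integrable f muOmega) {v : WeakFun n m}
    (hv : ∀ j, v.vV 0 j = 0 ∧ v.vV (Fin.last n) j = 0) :
    ∑ i, ∑ j, fluxX M (a11 i j) D v i j = 0 := by
  rw [Finset.sum_comm]
  refine Finset.sum_eq_zero fun j _ => ?_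
  simp only [fluxX, M.hy_mul_edgeMean]
  exact h.sum_edge_eq_zero hf (hD.hasWeakDx 1 0 (by decide)) (hD.hasWeakDy 0 1 (by decide)) j
    (v := fun k => v.vV k j) (hv j).1 (hv j).2

section Interpolant

variable {M : Mesh n m} {ρ Λ κ : ℝ} {a11 a22 : Fin n → Fin m → ℝ} {D : ℕ → ℕ → ℝ × ℝ → ℝ}
  {f : ℝ × ℝ → ℝ} {uh w v : WeakFun n m}

theorem IsJet.exists_isInterpolant (h : IsJet 3 D) (hρ : 0 < ρ) (M : Mesh n m)
    (ha11 : ∀ i j, a11 i j ∈ Icc 0 Λ) (ha22 : ∀ i j, a22 i j ∈ Icc 0 Λ)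
    (hV : ∀ (i i' : Fin n) (j : Fin m), i'.val = i.val + 1 → a22 i j ≠ a22 i' j →
      M.edgeMean j (D 0 2) (D 1 2) i.succ = 0)
    (hH : ∀ (j j' : Fin m) (i : Fin n), j'.val = j.val + 1 → a11 i j ≠ a11 i j' →
      M.swap.edgeMean i (swapJet D 0 2) (swapJet D 1 2) j.succ = 0) :
    ∃ w, IsInterpolant M ρ Λ a11 a22 D w := by
  choose F hF using fun i j => h.exists_affine_hasSmallResiduals hρ (ha11 i j) (ha22 i j) M i j
  obtain ⟨pV, hpV⟩ := M.exists_vertical_values ρ D hV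
  obtain ⟨pH, hpH⟩ := M.swap.exists_vertical_values (a22 := fun j i => a11 i j) ρ (swapJet D) hH
  have hres i j := hF i j ⟨F, pV, fun i k => pH k i⟩ rfl (hpV i j) (hpH j i)
  exact ⟨⟨F, pV, fun i k => pH k i⟩, hpV, fun i j => hpH j i,
    fun i j => (hres i j).1, fun i j => (hres i j).2⟩

theorem vV_sub_eq_zero (hw : ∀ i j, HasPerturbedMeans M ρ (a22 i j) D w i j)
    (huh : ∀ (i : Fin n) (j : Fin m) (k : Fin (n + 1)),
      (k = 0 ∧ k = i.castSucc) ∨ (k = Fin.last n ∧ k = i.succ) →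
      uh.vV k j = M.perturbedMean D j ρ (a22 i j) k) (j : Fin m) :
    (w - uh).vV 0 j = 0 ∧ (w - uh).vV (Fin.last n) j = 0 := by
  have hn : n ≠ 0 := by
    rintro rfl
    exact zero_ne_one (M.x_zero.symm.trans M.x_last)
  obtain ⟨n, rfl⟩ := Nat.exists_eq_succ_of_ne_zero hn
  constructor
  · exact sub_eq_zero.2 ((hw 0 j 0 (-1) (Or.inl ⟨rfl, rfl⟩)).trans
      (huh 0 j 0 (Or.inl ⟨rfl, rfl⟩)).symm)
  · exact sub_eq_zero.2 ((hw (Fin.last n) j _ 1 (Or.inr ⟨rfl, rfl⟩)).trans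
      (huh (Fin.last n) j _ (Or.inr ⟨rfl, rfl⟩)).symm)

theorem IsInterpolant.sum_form_le (hw : IsInterpolant M ρ Λ a11 a22 D w) (h : IsJet 3 D)
    (hρ : 0 < ρ) (hκ : 0 < κ) (ha11 : ∀ i j, a11 i j ∈ Icc 0 Λ) (ha22 : ∀ i j, a22 i j ∈ Icc 0 Λ)
    (hf : Integrable f muOmega) (hflux : IsFlux M a11 a22 f (D 1 0) (D 0 1))
    (hv : v.VanishesOnBoundary) :
    diffusionForm M a11 a22 w v + stabilizer M ρ w v ≤
      (∑ i, ∑ j, ∫ p in M.elem i j, f p * v.v0 i j p) + κ / 2 * energy M v +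
        2 * elemConst κ ρ Λ * M.size ^ 4 * ∑ i, ∑ j, M.seminormSq D i j := by
  have hlocal i j := h.localForm_le (v := v) hρ hκ (ha11 i j) (ha22 i j)
    (hflux.residual_ae_eq_zero hf (h.hasWeakDx 1 0 (by decide)) (h.hasWeakDy 0 1 (by decide)) i j)
    (hw.vV i j) (hw.vH i j) (hw.residualV i j) (hw.residualH i j)
  have hsum := Finset.sum_le_sum fun i (_ : i ∈ Finset.univ) =>
    Finset.sum_le_sum fun j (_ : j ∈ Finset.univ) => hlocal i j
  have hfluxX : ∑ i, ∑ j, fluxX M (a11 i j) D v i j = 0 := hflux.sum_fluxX_eq_zero h hf hv.1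
  have hfluxY : ∑ i, ∑ j, fluxX M.swap (a22 i j) (swapJet D) v.swap j i = 0 := by
    rw [Finset.sum_comm]
    exact hflux.swap.sum_fluxX_eq_zero h.swap
      (measurePreserving_swap_muOmega.integrable_comp_of_integrable hf) (v := v.swap) hv.2
  rw [diffusionForm_add_stabilizer, energy]
  simp only [Finset.sum_add_distrib, ← Finset.mul_sum, hfluxX, hfluxY, add_zero] at hsum ⊢
  exact hsum

theorem mul_energy_le (hκρ : κ ≤ ρ) (ha11 : ∀ i j, κ ≤ a11 i j) (ha22 : ∀ i j, κ ≤ a22 i j)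
    (v : WeakFun n m) :
    κ * energy M v ≤ diffusionForm M a11 a22 v v + stabilizer M ρ v v := by
  rw [diffusionForm_add_stabilizer, energy, Finset.mul_sum]
  refine Finset.sum_le_sum fun i _ => ?_
  rw [Finset.mul_sum]
  refine Finset.sum_le_sum fun j _ => ?_
  rw [mul_add]
  exact add_le_add (mul_energyX_le_formX M hκρ (ha11 i j) v i j)
    (mul_energyX_le_formX M.swap hκρ (ha22 i j) v.swap j i)

theorem form_sub (M : Mesh n m) (ρ : ℝ) (a11 a22 : Fin n → Fin m → ℝ) (w w' v : WeakFun n m) :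
    diffusionForm M a11 a22 (w - w') v + stabilizer M ρ (w - w') v =
      (diffusionForm M a11 a22 w v + stabilizer M ρ w v) -
        (diffusionForm M a11 a22 w' v + stabilizer M ρ w' v) := by
  simp only [diffusionForm_add_stabilizer, WeakFun.swap_sub, formX_sub, ← Finset.sum_sub_distrib]
  exact Finset.sum_congr rfl fun i _ => Finset.sum_congr rfl fun j _ => (add_sub_add_comm ..).symm

/-- The error against an interpolant is a test function, so coercivity turns the consistency
estimate into an estimate of its energy. -/
theorem IsInterpolant.energy_sub_le (hw : IsInterpolant M ρ Λ a11 a22 D w) (h : IsJet 3 D)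
    (hκ : 0 < κ) (hκρ : κ ≤ ρ) (ha11 : ∀ i j, a11 i j ∈ Icc κ Λ) (ha22 : ∀ i j, a22 i j ∈ Icc κ Λ)
    (hf : Integrable f muOmega) (hflux : IsFlux M a11 a22 f (D 1 0) (D 0 1))
    (huh : IsWGSolution M ρ a11 a22 f uh) (hv : (w - uh).VanishesOnBoundary) :
    energy M (w - uh) ≤
      4 * elemConst κ ρ Λ / κ * M.size ^ 4 * ∑ i, ∑ j, M.seminormSq D i j := by
  have hupper := hw.sum_form_le h (hκ.trans_le hκρ) hκ
    (fun i j => Icc_subset_Icc_left hκ.le (ha11 i j))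
    (fun i j => Icc_subset_Icc_left hκ.le (ha22 i j)) hf hflux hv
  have hlower := mul_energy_le (M := M) hκρ (fun i j => (ha11 i j).1) (fun i j => (ha22 i j).1)
    (w - uh)
  rw [form_sub, huh _ hv] at hlower
  have henergy : κ * energy M (w - uh) ≤
      4 * elemConst κ ρ Λ * M.size ^ 4 * ∑ i, ∑ j, M.seminormSq D i j := by linarith
  calc energy M (w - uh)
      ≤ (4 * elemConst κ ρ Λ * M.size ^ 4 * ∑ i, ∑ j, M.seminormSq D i j) / κ :=
        (le_div_iff₀' hκ).2 henergy
    _ = _ := by ring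

theorem IsJet.sq_weakGrad_error_le (h : IsJet 3 D) (hρ : 0 < ρ) {a' : ℝ} (ha' : a' ∈ Icc 0 Λ)
    {i : Fin n} {j : Fin m} (hw : HasPerturbedMeans M ρ a' D w i j) :
    M.area i j * (M.Qh i j (D 1 0) - (weakGrad M uh i j).1) ^ 2 ≤
      2 * gradConst ρ Λ * M.size ^ 4 * M.seminormSq D i j + 2 * energyX M (w - uh) i j := by
  have hinterp := h.area_mul_sq_weakGrad_sub_le hρ ha' hw
  have hdiscrete := sq_weakGrad_le_energyX M (w - uh) i j
  rw [weakGrad_fst_sub] at hdiscrete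
  have hA := (M.area_pos i j).le
  have htriangle : (M.Qh i j (D 1 0) - (weakGrad M uh i j).1) ^ 2 ≤
      2 * (((weakGrad M w i j).1 - M.Qh i j (D 1 0)) ^ 2 +
        ((weakGrad M w i j).1 - (weakGrad M uh i j).1) ^ 2) := by
    rw [sub_sq_comm (weakGrad M w i j).1 (M.Qh i j (D 1 0))]
    exact (congrArg (· ^ 2) (sub_add_sub_cancel _ _ _).symm).trans_le (add_sq_le ..)
  linarith [mul_le_mul_of_nonneg_left htriangle hA]

theorem IsInterpolant.sum_sq_weakGrad_error_le (hw : IsInterpolant M ρ Λ a11 a22 D w)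
    (h : IsJet 3 D) (hρ : 0 < ρ) (ha11 : ∀ i j, a11 i j ∈ Icc 0 Λ)
    (ha22 : ∀ i j, a22 i j ∈ Icc 0 Λ) (uh : WeakFun n m) :
    ∑ i, ∑ j, M.area i j * ((M.Qh i j (D 1 0) - (weakGrad M uh i j).1) ^ 2 +
        (M.Qh i j (D 0 1) - (weakGrad M uh i j).2) ^ 2) ≤
      4 * gradConst ρ Λ * M.size ^ 4 * (∑ i, ∑ j, M.seminormSq D i j) +
        2 * energy M (w - uh) := by
  rw [energy]
  simp only [Finset.mul_sum, ← Finset.sum_add_distrib]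
  refine Finset.sum_le_sum fun i _ => Finset.sum_le_sum fun j _ => ?_
  have hX := h.sq_weakGrad_error_le (uh := uh) hρ (ha22 i j) (hw.vV i j)
  have hY := h.swap.sq_weakGrad_error_le (uh := uh.swap) hρ (ha11 i j) (hw.vH i j)
  rw [M.area_swap, M.Qh_swapJet, weakGrad_swap, M.size_swap, M.seminormSq_swap] at hY
  rw [WeakFun.swap_sub]
  rw [Prod.fst_swap] at hY
  linarith

end Interpolant

/-- The square of the constant of the error estimate. -/
noncomputable def errorConst (κ ρ Λ : ℝ) : ℝ := 4 * gradConst ρ Λ + 8 * elemConst κ ρ Λ / κ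

theorem errorConst_nonneg {κ ρ Λ : ℝ} (hκ : 0 < κ) : 0 ≤ errorConst κ ρ Λ := by
  rw [errorConst, elemConst, gradConst, edgeConst]
  positivity

theorem sum_seminormSq_le (M : Mesh n m) {u : ℝ × ℝ → ℝ} (hu : MemSobolev 3 u) :
    ∑ i, ∑ j, M.seminormSq (fun r s => weakDeriv r s u) i j ≤ sobolevNorm 3 u ^ 2 := by
  have hnonneg (r s : ℕ) : 0 ≤ ∫ p in Omega, weakDeriv r s u p ^ 2 :=
    integral_nonneg fun _ => sq_nonneg _
  have hglobal : ∑ i, ∑ j, M.seminormSq (fun r s => weakDeriv r s u) i j =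
      ∑ r ∈ Finset.range 4, ∫ p in Omega, weakDeriv r (3 - r) u p ^ 2 := by
    simp only [Mesh.seminormSq, Finset.Nat.sum_antidiagonal_eq_sum_range_succ_mk]
    rw [Finset.sum_congr rfl fun i _ => Finset.sum_comm, Finset.sum_comm]
    exact Finset.sum_congr rfl fun r hr => M.sum_setIntegral_elem
      (weakDeriv_spec hu (Nat.add_sub_of_le (Finset.mem_range_succ_iff.1 hr)).le).1.integrable_sq
  rw [hglobal, sobolevNorm, Real.sq_sqrt
    (Finset.sum_nonneg fun r _ => Finset.sum_nonneg fun s _ => hnonneg r s)]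
  refine Finset.sum_le_sum fun r hr => ?_
  refine Finset.single_le_sum (f := fun s => ∫ p in Omega, weakDeriv r s u p ^ 2)
    (fun s _ => hnonneg r s) (Finset.mem_range.2 ?_)
  have := Finset.mem_range.1 hr
  omega

section Solution

variable {M : Mesh n m} {κ ρ Λ : ℝ} {a11 a22 : Fin n → Fin m → ℝ} {D : ℕ → ℕ → ℝ × ℝ → ℝ}
  {f u g gxx gyy : ℝ × ℝ → ℝ} {uh w : WeakFun n m}

theorem EdgeSingleValued.exists_isInterpolant (he : EdgeSingleValued M a11 a22 u)
    (hu : MemSobolev 3 u) (hρ : 0 < ρ) (ha11 : ∀ i j, a11 i j ∈ Icc 0 Λ)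
    (ha22 : ∀ i j, a22 i j ∈ Icc 0 Λ) :
    ∃ w, IsInterpolant M ρ Λ a11 a22 (fun r s => weakDeriv r s u) w := by
  refine hu.isJet.exists_isInterpolant hρ M ha11 ha22 (fun i i' j hi ha => ?_)
    fun j j' i hj ha => ?_
  · obtain ⟨τ, hτ, hzero⟩ := he.1 i i' j hi ha
    exact (M.average_eq_edgeMean j ((hu.isJet.hasWeakDx 0 2 (by decide)).ae_eq_traceAt
      (M.x_mem _) hτ)).symm.trans hzero
  · obtain ⟨τ, hτ, hzero⟩ := he.2 i j j' hj ha
    exact (M.swap.average_eq_edgeMean i ((hu.isJet.hasWeakDy 2 0 (by decide)).ae_eq_traceAt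
      (M.y_mem _) hτ)).symm.trans hzero

theorem IsInterpolant.vanishesOnBoundary_sub (hw : IsInterpolant M ρ Λ a11 a22 D w)
    (hb : HasPerturbedBoundaryValue M ρ a11 a22 g gxx gyy uh) (h : IsJet 3 D)
    (hg : HasBoundaryValue (D 0 0) g) (hgg : IsTangentialSecondDeriv g gxx gyy) :
    (w - uh).VanishesOnBoundary :=
  ⟨vV_sub_eq_zero hw.vV (hb.vV_eq h hg hgg),
    vV_sub_eq_zero (M := M.swap) (a22 := fun j i => a11 i j) (w := w.swap) (uh := uh.swap)
      (fun j i => hw.vH i j) (hb.vH_eq h hg hgg)⟩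

theorem IsWGSolution.gradError_le (huh : IsWGSolution M ρ a11 a22 f uh)
    (hb : HasPerturbedBoundaryValue M ρ a11 a22 g gxx gyy uh) (hκ : 0 < κ) (hκρ : κ ≤ ρ)
    (ha11 : ∀ i j, a11 i j ∈ Icc κ Λ) (ha22 : ∀ i j, a22 i j ∈ Icc κ Λ)
    (hf : Integrable f muOmega) (hu : MemSobolev 3 u) (hsol : IsWeakSolution M a11 a22 f u)
    (hg : HasBoundaryValue u g) (hgg : IsTangentialSecondDeriv g gxx gyy)
    (he : EdgeSingleValued M a11 a22 u) :
    gradError M u uh ≤ √(errorConst κ ρ Λ) * M.size ^ 2 * sobolevNorm 3 u := by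
  have hρ : 0 < ρ := hκ.trans_le hκρ
  have ha11' i j : a11 i j ∈ Icc 0 Λ := Icc_subset_Icc_left hκ.le (ha11 i j)
  have ha22' i j : a22 i j ∈ Icc 0 Λ := Icc_subset_Icc_left hκ.le (ha22 i j)
  obtain ⟨w, hw⟩ := he.exists_isInterpolant hu hρ ha11' ha22'
  have henergy := hw.energy_sub_le hu.isJet hκ hκρ ha11 ha22 hf hsol huh
    (hw.vanishesOnBoundary_sub hb hu.isJet (hg.congr_ae hu.ae_eq_weakDeriv_zero) hgg)
  have herror := hw.sum_sq_weakGrad_error_le hu.isJet hρ ha11' ha22' uh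
  have hsum := mul_le_mul_of_nonneg_left (sum_seminormSq_le M hu)
    (mul_nonneg (errorConst_nonneg (ρ := ρ) (Λ := Λ) hκ) (by positivity : 0 ≤ M.size ^ 4))
  have hnorm : 0 ≤ M.size ^ 2 * sobolevNorm 3 u := mul_nonneg (sq_nonneg _) (Real.sqrt_nonneg _)
  calc gradError M u uh
      ≤ √(errorConst κ ρ Λ * (M.size ^ 2 * sobolevNorm 3 u) ^ 2) := by
        refine Real.sqrt_le_sqrt (herror.trans ?_)
        rw [errorConst] at hsum ⊢
        linear_combination 2 * henergy + hsum
    _ = √(errorConst κ ρ Λ) * M.size ^ 2 * sobolevNorm 3 u := by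
        rw [Real.sqrt_mul (errorConst_nonneg hκ), Real.sqrt_sq hnorm, mul_assoc]

end Solution

end WG

theorem mainTheorem2 (ρ lam Lam : ℝ) (hρ : 0 < ρ) (hlam : 0 < lam) :
    ∃ C : ℝ, 0 < C ∧
      ∀ (n m : ℕ) (M : WG.Mesh n m) (a11 a22 : Fin n → Fin m → ℝ)
        (f u g gxx gyy : ℝ × ℝ → ℝ) (uh : WG.WeakFun n m),
        (∀ i j, lam ≤ a11 i j ∧ a11 i j ≤ Lam ∧ lam ≤ a22 i j ∧ a22 i j ≤ Lam) →
        MemLp f 2 WG.muOmega →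
        WG.MemSobolev 3 u →
        WG.IsWeakSolution M a11 a22 f u →
        WG.HasBoundaryValue u g →
        WG.IsTangentialSecondDeriv g gxx gyy →
        WG.EdgeSingleValued M a11 a22 u →
        WG.IsWGSolution M ρ a11 a22 f uh →
        WG.HasPerturbedBoundaryValue M ρ a11 a22 g gxx gyy uh →
        WG.gradError M u uh ≤ C * M.size ^ 2 * WG.sobolevNorm 3 u := by
  refine ⟨√(WG.errorConst (min lam ρ) ρ Lam) + 1, by positivity, ?_⟩
  intro n m M a11 a22 f u g gxx gyy uh ha hf hu hsol hg hgg he huh hb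
  have ha11 i j : a11 i j ∈ Icc (min lam ρ) Lam :=
    ⟨(min_le_left lam ρ).trans (ha i j).1, (ha i j).2.1⟩
  have ha22 i j : a22 i j ∈ Icc (min lam ρ) Lam :=
    ⟨(min_le_left lam ρ).trans (ha i j).2.2.1, (ha i j).2.2.2⟩
  have hnorm : 0 ≤ WG.sobolevNorm 3 u := Real.sqrt_nonneg _
  refine (huh.gradError_le hb (lt_min hlam hρ) (min_le_right lam ρ) ha11 ha22
    (hf.integrable one_le_two) hu hsol hg hgg he).trans ?_
  gcongr
  exact le_add_of_nonneg_right zero_le_one
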